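/- Let $k\ge 1$ be an integer. A $k$-oriented graph is a finite simple undirected graph together with an orientation of its edges (each edge in one of its two directions) in which every vertex has out-degree at most $k$. The model of computation is a unit-cost word RAM: registers and a random access memory holding natural numbers, with assignment of constants, addition, truncated subtraction, multiplication, integer division, indirect load and store, comparisons, conditionals and loops, each elementary instruction and each test taking one time unit, and with a write-only output. A $k$-oriented graph with vertices $0,\dots,n-1$ is given as input by the number $n$ followed, for each vertex, by its out-degree and the list (in any order) of its outgoing neighbours. There is a single program which, for every $k\ge 1$, lists all maximal independent sets of every $n$-vertex $k$-oriented graph in time $O(n^{2-1/k})$ per set, space $O(n)$ and polynomial delay. Precisely: there is a program $P$ such that for every $k\ge 1$ there are constants $C,d\in\mathbb N$, such that for every $n\ge 0$ and every $k$-oriented graph $G$ on $n$ vertices, $P$ run on $G$ halts and 1. its output consists of all inclusion-maximal independent sets of $G$ and nothing else, each exactly once, a set being written as the list of its elements (each once, in some order) followed by an end-of-set mark; 2. the total running time, preprocessing included, is at most $C\,(n+1)^{2-1/k}$ times the number of maximal independent sets of $G$; 3. only memory cells with addresses less than $C\,(n+1)$ are read or written, the input being stored in the cells $0,1,2,\dots$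 at the start, when all other cells and all registers are $0$; 4. any $C\,(n+1)^d$ consecutive time units of the computation contain the completion of an output set; so this bounds the time before the first set, between consecutive sets, and after the last set; 5. all words handled are at most $C\,(n+1)^d$, that is, they have $O(\log n)$ bits for fixed $k$. -/

import Mathlib

/-! ## A word RAM

The machine has registers and a random access memory, both holding natural numbers ("words").
Programs are structured (sequencing, conditionals, loops) over elementary three-address
instructions. Every elementary instruction and every evaluation of a test costs one time unit.
There is a write-only output, to which words and an end-of-set mark can be appended.
A program is a finite object, hence mentions only finitely many registers. -/

namespace RAM

/-- Arithmetic on words: addition, truncated subtraction, multiplication, and integer division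
with remainder dropped (division by zero yields zero). -/
inductive ArithOp : Type
  | plus | minus | times | quot

def ArithOp.eval : ArithOp → ℕ → ℕ → ℕ
  | .plus, x, y => x + y
  | .minus, x, y => x - y
  | .times, x, y => x * y
  | .quot, x, y => x / y

/-- Tests on the contents of two registers. -/
inductive Test : Type
  | lt (a b : ℕ)
  | eq (a b : ℕ)

/-- Elementary instructions; the arguments `r`, `a`, `b` are register names, `c` is a constant. -/
inductive Instr : Type
  /-- `r := c` -/
  | const (r c : ℕ)
  /-- `r := a op b` -/
  | arith (op : ArithOp) (r a b : ℕ)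
  /-- `r := mem[a]` -/
  | load (r a : ℕ)
  /-- `mem[a] := r` -/
  | store (a r : ℕ)
  /-- append the word in `r` to the output -/
  | emit (r : ℕ)
  /-- append the end-of-set mark to the output -/
  | endSet

inductive Prog : Type
  | skip
  | instr (i : Instr)
  | seq (p q : Prog)
  | ite (t : Test) (p q : Prog)
  | while (t : Test) (p : Prog)

/-- Contents of the registers and of the memory. -/
structure State : Type where
  reg : ℕ → ℕ
  mem : ℕ → ℕ

def Test.Holds (s : State) : Test → Prop
  | .lt a b => s.reg a < s.reg b
  | .eq a b => s.reg a = s.reg b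

/-- What one time unit of a computation does; a computation is recorded as the list of its
events, one per time unit. -/
inductive Event : Type
  /-- evaluation of a test -/
  | test
  /-- the word `x` is computed and put into a register -/
  | compute (x : ℕ)
  /-- the word `x` is read from the memory cell with address `a` -/
  | read (a x : ℕ)
  /-- the word `x` is written to the memory cell with address `a` -/
  | write (a x : ℕ)
  /-- the word `x` is appended to the output -/
  | emit (x : ℕ)
  /-- the end-of-set mark is appended to the output -/
  | endSet

def Instr.event (s : State) : Instr → Event
  | .const _ c => .compute c
  | .arith op _ a b => .compute (op.eval (s.reg a) (s.reg b))
  | .load _ a => .read (s.reg a) (s.mem (s.reg a))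
  | .store a r => .write (s.reg a) (s.reg r)
  | .emit r => .emit (s.reg r)
  | .endSet => .endSet

def Instr.next (s : State) : Instr → State
  | .const r c => { s with reg := Function.update s.reg r c }
  | .arith op r a b => { s with reg := Function.update s.reg r (op.eval (s.reg a) (s.reg b)) }
  | .load r a => { s with reg := Function.update s.reg r (s.mem (s.reg a)) }
  | .store a r => { s with mem := Function.update s.mem (s.reg a) (s.reg r) }
  | .emit _ => s
  | .endSet => s

/-- `Exec p s tr s'`: program `p`, started in state `s`, terminates in state `s'`, and `tr` is
the list of the events of this computation in order of time. -/
inductive Exec : Prog → State → List Event → State → Prop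
  | skip (s : State) : Exec .skip s [] s
  | instr (i : Instr) (s : State) : Exec (.instr i) s [i.event s] (i.next s)
  | seq {p q : Prog} {s s' s'' : State} {tr tr' : List Event} :
      Exec p s tr s' → Exec q s' tr' s'' → Exec (.seq p q) s (tr ++ tr') s''
  | iteTrue {t : Test} {p q : Prog} {s s' : State} {tr : List Event} :
      t.Holds s → Exec p s tr s' → Exec (.ite t p q) s (.test :: tr) s'
  | iteFalse {t : Test} {p q : Prog} {s s' : State} {tr : List Event} :
      ¬ t.Holds s → Exec q s tr s' → Exec (.ite t p q) s (.test :: tr) s'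
  | whileTrue {t : Test} {p : Prog} {s s' s'' : State} {tr tr' : List Event} :
      t.Holds s → Exec p s tr s' → Exec (.while t p) s' tr' s'' →
      Exec (.while t p) s (.test :: (tr ++ tr')) s''
  | whileFalse {t : Test} {p : Prog} {s : State} :
      ¬ t.Holds s → Exec (.while t p) s [.test] s

/-- The machine is started with the input list in the memory cells `0, 1, 2, …`; all other
cells and all registers are zero. -/
def initial (input : List ℕ) : State where
  reg := fun _ => 0
  mem := fun a => input.getD a 0

/-- The output symbol produced by an event: a word, or the end-of-set mark `none`. -/
def Event.symbol : Event → Option (Option ℕ)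
  | .emit x => some (some x)
  | .endSet => some none
  | _ => none

/-- The complete output of a computation. -/
def output (tr : List Event) : List (Option ℕ) := tr.filterMap Event.symbol

/-- All words handled during the computation are at most `W`. -/
def WordsAtMost (W : ℕ) (tr : List Event) : Prop :=
  ∀ e ∈ tr, match e with
    | .compute x => x ≤ W
    | .read _ x => x ≤ W
    | .write _ x => x ≤ W
    | .emit x => x ≤ W
    | .test => True
    | .endSet => True

/-- Only the memory cells with addresses `0, …, s - 1` are accessed during the computation. -/
def UsesSpace (s : ℕ) (tr : List Event) : Prop :=
  ∀ e ∈ tr, match e with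
    | .read a _ => a < s
    | .write a _ => a < s
    | _ => True

/-- Any `D` consecutive time units contain the completion of an output set. In particular, at
most `D` time units pass before the first set is completed, between the completions of two
consecutive sets, and from the completion of the last set to the end. -/
def DelayAtMost (D : ℕ) (tr : List Event) : Prop :=
  ∀ block : List Event, block <:+: tr → D ≤ block.length → Event.endSet ∈ block

end RAM

/-! ## Oriented graphs and their maximal independent sets -/

/-- An orientation of `G` with out-degrees at most `k`, given by lists of outgoing neighbours
(in arbitrary order): each edge of `G` is oriented in exactly one of its two directions. -/
structure KOrientation {n : ℕ} (G : SimpleGraph (Fin n)) (k : ℕ) : Type where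
  out : Fin n → List (Fin n)
  nodup : ∀ v, (out v).Nodup
  adj_iff : ∀ u v, G.Adj u v ↔ v ∈ out u ∨ u ∈ out v
  asymm : ∀ u v, v ∈ out u → u ∉ out v
  outdegree_le : ∀ v, (out v).length ≤ k

/-- The input for the machine: the number `n` of vertices, followed, for each of the vertices
`0, …, n - 1`, by its out-degree and the list of its outgoing neighbours. -/
def KOrientation.encode {n : ℕ} {G : SimpleGraph (Fin n)} {k : ℕ} (o : KOrientation G k) :
    List ℕ :=
  n :: (List.finRange n).flatMap fun v => (o.out v).length :: (o.out v).map Fin.val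

/-- The family of all (inclusion-)maximal independent sets of `G`. -/
def maximalIndepSets {n : ℕ} (G : SimpleGraph (Fin n)) : Set (Finset (Fin n)) :=
  {S | Maximal (fun T : Finset (Fin n) => G.IsIndepSet (T : Set (Fin n))) S}

/-- The output `w` is a listing of the family `F`: every member of `F`, and nothing else, is
written exactly once, as the list of its elements (each once, in some order) followed by the
end-of-set mark. -/
def IsListing {n : ℕ} (F : Set (Finset (Fin n))) (w : List (Option ℕ)) : Prop :=
  ∃ M : List (List (Fin n)),
    w = M.flatMap (fun l => l.map (fun v => some v.val) ++ [none]) ∧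
    (∀ l ∈ M, l.Nodup) ∧
    (M.map List.toFinset).Nodup ∧
    ∀ S : Finset (Fin n), S ∈ M.map List.toFinset ↔ S ∈ F

/-! The maximal independent sets of the graphs induced on `0, …, i - 1` form level `i` of a tree. A
set `T` at level `i + 1` that does not contain `i` has itself as parent. If `i ∈ T`, its parent is
the greedy completion, in increasing order of vertices, of `T` without `i`. So a node `S` has the
single child `S ∪ {i}` if `i` has no neighbour in `S`. Otherwise its children are `S` and possibly
`(S \ N(i)) ∪ {i}`; the latter is a child exactly when `Mis.Valid` holds (`Mis.mem_kids_iff`).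
Parents exist and are unique, so the leaves at level `n` are the required sets, each once
(`Mis.lists_leaves`). Every node has a child. A round therefore descends along first children to a
leaf, writes it, and climbs to the deepest level with an unvisited second child. It yields one set
and visits each level at most once in each direction.

The cost lies in testing for a second child. The test at level `j` compares two numbers
(`Dat.valid_iff`): how many `u < j` lose their last neighbour in `S` when `N(j)` is dropped, and how
many of these are adjacent to `j` and have a smaller neighbour in `S`. Let `K` be the larger of `1`
and the greatest out-degree, and `r` the least positive number with `n ≤ r ^ K`. A vertex is heavy
if its in-degree is at least `n / r`. There are at most `K * r` heavy vertices, and a light one has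
in-degree below `r ^ (K - 1)`. Each `u` stores a code, a `K`-digit numeral in base `b` naming its
heavy out-neighbours in `S`, and the number `DEF` of its other neighbours in `S`. A table counts the
active `u` with `DEF = 0` by code.

A lost vertex belongs to one of two classes (`Dat.Good.card_lost`). It may have a neighbour `w ∈ S ∩
N(j)` that does not enter its code. It is then found on a short list of `w`: the whole adjacency
list if `w` is light, the out-neighbours only if `w` is heavy. Otherwise `DEF` is zero and its
nonzero code uses only heavy vertices of `S ∩ N(j)`. These vertices are counted by adding the table
entries of all such codes, of which there are fewer than `(q + 1) ^ K` if `S ∩ N(j)` has `q` heavy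
vertices.

Summed over `j`, the short lists cost `∑ w, deg w * (K + r ^ (K - 1))`. Since `q ≤ deg j` and `q <
b`, the tables cost at most `∑ j, (deg j + 1) * b ^ (K - 1)`. As there are at most `n * K` arcs and
`b = O(r)`, both sums are `O(n * r ^ (K - 1)) = O(n ^ (2 - 1 / K))` for fixed `k` (`cost_le`,
`root_pow_pred_le`), and `K ≤ k`. The table has `b ^ K = O(n)` entries, hence linear space. Adding
or removing a vertex takes time linear in its degree (`wp_flip`), and along a path a vertex is
removed at most once, so all other work in a round is smaller. The program computes `K` from its
input, so one program serves every `k`.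

The algorithm is written in a small language of bounded loops, in which cost, bounds and effect are
computed by recursion on commands. `correct` transfers these to the RAM; only the outermost loop,
over the rounds, is a machine loop. -/

set_option linter.constructorNameAsVariable false

/-! ## A language of bounded loops over arrays, compiled to the word RAM -/

namespace Loop

/-- Variables. The variable `zero` is never assigned. -/
inductive Var : Type
  | zero | alive | n | K | r | b | p | d | e | v | w | g | acc | pw | t
  | lvl | i | bi | found
  | f | fw | fx | fu
  | a1 | b1 | a2 | b2
  | x1 | w1 | x2 | u2 | ow | x3 | z | okf
  | q | c | y | s | X | Y
  deriving DecidableEq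

/-- Arrays. The array `inp` is the read-only input. -/
inductive Arr : Type
  -- Static data: out-degree, in-degree, index of a heavy vertex, start of the adjacency list, its
  -- writing position, its length, the length of its short prefix, its entries and their weights.
  | inp | OD | ID | IX | ST | PS | LN | SL | NB | WT
  -- Data of the current set: `DEF` and `CODE` split the neighbours in the set by weight, `LOW`
  -- counts the smaller ones, `INS` is membership, `T` the table, `REM` the level of removal. `MK`,
  -- `DC`, `QA` are scratch arrays of the test.
  | DEF | CODE | LOW | INS | T | REM | MK | DC | QA
  deriving DecidableEq

/-- Expressions. -/
inductive Ex : Type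
  | lit (c : ℕ)
  | var (x : Var)
  | op (o : RAM.ArithOp) (a b : Ex)
  | get (a : Arr) (i : Ex)

instance : Add Ex := ⟨.op .plus⟩
instance : Sub Ex := ⟨.op .minus⟩
instance : Mul Ex := ⟨.op .times⟩
instance : Div Ex := ⟨.op .quot⟩
instance (k : ℕ) : OfNat Ex k := ⟨.lit k⟩
instance : Coe Var Ex := ⟨.var⟩

/-- Comparisons of expressions. -/
inductive Cond : Type
  | lt (a b : Ex)
  | eq (a b : Ex)

inductive Cmd : Type
  | skip
  | set (x : Var) (e : Ex)
  | put (a : Arr) (i e : Ex)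
  | emit (e : Ex)
  | endSet
  | seq (p q : Cmd)
  | ite (c : Cond) (p q : Cmd)
  | loop (i : Var) (lo hi : Ex) (body : Cmd)

infixr:60 " ;; " => Cmd.seq

/-- Values of variables and arrays, and the output so far. -/
structure St : Type where
  v : Var → ℕ
  a : Arr → ℕ → ℕ
  out : List (Option ℕ)

def St.setV (s : St) (x : Var) (k : ℕ) : St := { s with v := Function.update s.v x k }

def St.setA (s : St) (a : Arr) (i k : ℕ) : St :=
  { s with a := Function.update s.a a (Function.update (s.a a) i k) }

def St.addOut (s : St) (o : Option ℕ) : St := { s with out := s.out ++ [o] }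

section StateLemmas
variable (s : St) (x y : Var) (a c : Arr) (i k : ℕ) (o : Option ℕ)

@[simp] theorem St.setV_v_self : (s.setV x k).v x = k := by simp [St.setV]
@[simp] theorem St.setV_v_ne (h : y ≠ x) : (s.setV x k).v y = s.v y := by simp [St.setV, h]
@[simp] theorem St.setV_a : (s.setV x k).a = s.a := rfl
@[simp] theorem St.setV_out : (s.setV x k).out = s.out := rfl
@[simp] theorem St.setA_v : (s.setA a i k).v = s.v := rfl
@[simp] theorem St.setA_a_self : (s.setA a i k).a a = Function.update (s.a a) i k := by
  simp [St.setA]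
@[simp] theorem St.setA_a_ne (h : c ≠ a) : (s.setA a i k).a c = s.a c := by simp [St.setA, h]
@[simp] theorem St.setA_out : (s.setA a i k).out = s.out := rfl
@[simp] theorem St.addOut_v : (s.addOut o).v = s.v := rfl
@[simp] theorem St.addOut_a : (s.addOut o).a = s.a := rfl
@[simp] theorem St.addOut_out : (s.addOut o).out = s.out ++ [o] := rfl

end StateLemmas

/-- Bounds: `B` is the length of the input, `L` bounds the indices of the other arrays,
`W` bounds all words. -/
structure Lim : Type where
  B : ℕ
  L : ℕ
  W : ℕ

def Lim.idx (M : Lim) : Arr → ℕ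
  | .inp => M.B
  | _ => M.L

def Ex.eval (s : St) : Ex → ℕ
  | .lit c => c
  | .var x => s.v x
  | .op o a b => o.eval (a.eval s) (b.eval s)
  | .get a i => s.a a (i.eval s)

/-- The evaluation stays within the bounds. -/
def Ex.Safe (M : Lim) (s : St) : Ex → Prop
  | .lit c => c ≤ M.W
  | .var _ => True
  | .op o a b => a.Safe M s ∧ b.Safe M s ∧
      (match o with
        | .plus => a.eval s + b.eval s ≤ M.W
        | .times => a.eval s * b.eval s ≤ M.W
        | _ => True)
  | .get a i => i.Safe M s ∧ i.eval s < M.idx a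

/-- The charges bound the length of the compiled code from above: a `get` pays five instructions for
the address and one for the load, although `inp` needs no address computation. -/
def Ex.cost : Ex → ℕ
  | .lit _ => 1
  | .var _ => 2
  | .op _ a b => a.cost + b.cost + 1
  | .get _ i => i.cost + 6

def Cond.Holds (s : St) : Cond → Prop
  | .lt a b => a.eval s < b.eval s
  | .eq a b => a.eval s = b.eval s

def Cond.Safe (M : Lim) (s : St) : Cond → Prop
  | .lt a b => a.Safe M s ∧ b.Safe M s
  | .eq a b => a.Safe M s ∧ b.Safe M s

def Cond.cost : Cond → ℕ
  | .lt a b => a.cost + b.cost + 1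
  | .eq a b => a.cost + b.cost + 1

open Classical in
/-- The effect of a command. -/
noncomputable def Cmd.run : Cmd → St → St
  | .skip, s => s
  | .set x e, s => s.setV x (e.eval s)
  | .put a i e, s => s.setA a (i.eval s) (e.eval s)
  | .emit e, s => s.addOut (some (e.eval s))
  | .endSet, s => s.addOut none
  | .seq p q, s => q.run (p.run s)
  | .ite c p q, s => if c.Holds s then p.run s else q.run s
  -- Both bounds are evaluated once, on entry, so every command terminates; an assignment to `i` in
  -- the body does not change the number of rounds.
  | .loop i lo hi body, s =>
      Nat.rec s (fun k s' => body.run (s'.setV i (lo.eval s + k))) (hi.eval s - lo.eval s)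

/-- The state before round `k` of a loop whose counter starts with the value `l`. -/
noncomputable def Cmd.iter (body : Cmd) (i : Var) (l : ℕ) (s : St) : ℕ → St
  | 0 => s
  | k + 1 => body.run ((Cmd.iter body i l s k).setV i (l + k))

theorem Cmd.run_loop (i : Var) (lo hi : Ex) (body : Cmd) (s : St) :
    (Cmd.loop i lo hi body).run s
      = Cmd.iter body i (lo.eval s) s (hi.eval s - lo.eval s) := by
  rw [Cmd.run]
  induction hi.eval s - lo.eval s with
  | zero => rfl
  | succ k ih => simp only [Cmd.iter]; rw [← ih]

open Classical in
-- The 5 per round of a loop pays for the test, the copy of the counter into the variable (2) and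
-- the increment (2); the single 1 is the last, failing test.
noncomputable def Cmd.cost : Cmd → St → ℕ
  | .skip, _ => 0
  | .set _ e, _ => e.cost + 2
  | .put _ i e, _ => i.cost + e.cost + 6
  | .emit e, _ => e.cost + 1
  | .endSet, _ => 1
  | .seq p q, s => p.cost s + q.cost (p.run s)
  | .ite c p q, s => c.cost + if c.Holds s then p.cost s else q.cost s
  | .loop i lo hi body, s => lo.cost + hi.cost + 1 +
      ∑ k ∈ Finset.range (hi.eval s - lo.eval s),
        (5 + body.cost ((Cmd.iter body i (lo.eval s) s k).setV i (lo.eval s + k)))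

open Classical in
def Cmd.Safe (M : Lim) : Cmd → St → Prop
  | .skip, _ => True
  | .set _ e, s => e.Safe M s
  | .put a i e, s => a ≠ .inp ∧ i.Safe M s ∧ e.Safe M s ∧ i.eval s < M.L
  | .emit e, s => e.Safe M s
  | .endSet, _ => True
  | .seq p q, s => p.Safe M s ∧ q.Safe M (p.run s)
  | .ite c p q, s => c.Safe M s ∧ if c.Holds s then p.Safe M s else q.Safe M s
  | .loop i lo hi body, s => lo.Safe M s ∧ hi.Safe M s ∧
      ∀ k < hi.eval s - lo.eval s,
        body.Safe M ((Cmd.iter body i (lo.eval s) s k).setV i (lo.eval s + k))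

/-- The variables that a command may change. -/
def Cmd.wv : Cmd → Var → Bool
  | .set x _, y => y = x
  | .seq p q, y => p.wv y || q.wv y
  | .ite _ p q, y => p.wv y || q.wv y
  | .loop i _ _ body, y => y = i || body.wv y
  | _, _ => false

/-- The arrays that a command may change. -/
def Cmd.wa : Cmd → Arr → Bool
  | .put a _ _, c => c = a
  | .seq p q, c => p.wa c || q.wa c
  | .ite _ p q, c => p.wa c || q.wa c
  | .loop _ _ _ body, c => body.wa c
  | _, _ => false

/-- Whether a command may write output. -/
def Cmd.wo : Cmd → Bool
  | .emit _ => true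
  | .endSet => true
  | .seq p q => p.wo || q.wo
  | .ite _ p q => p.wo || q.wo
  | .loop _ _ _ body => body.wo
  | _ => false

/-- `s'` agrees with `s` in all that the command `c` cannot change. -/
structure Frame (c : Cmd) (s s' : St) : Prop where
  v : ∀ x, c.wv x = false → s'.v x = s.v x
  a : ∀ x, c.wa x = false → s'.a x = s.a x
  out : c.wo = false → s'.out = s.out

/-- The syntactic footprint bounds the effect. Since `wv`, `wa` and `wo` compute, on a concrete
command every side condition of the frame is settled by `rfl`. -/
theorem Cmd.frame_run (c : Cmd) (s : St) : Frame c s (c.run s) := by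
  induction c generalizing s with
  | skip => exact ⟨fun _ _ => rfl, fun _ _ => rfl, fun _ => rfl⟩
  | set x e =>
    refine ⟨fun y hy => ?_, fun _ _ => rfl, fun _ => rfl⟩
    simp only [Cmd.wv, decide_eq_false_iff_not] at hy
    simp [Cmd.run, hy]
  | put a i e =>
    refine ⟨fun _ _ => rfl, fun y hy => ?_, fun _ => rfl⟩
    simp only [Cmd.wa, decide_eq_false_iff_not] at hy
    simp [Cmd.run, hy]
  | emit e => exact ⟨fun _ _ => rfl, fun _ _ => rfl, fun h => by simp [Cmd.wo] at h⟩
  | endSet => exact ⟨fun _ _ => rfl, fun _ _ => rfl, fun h => by simp [Cmd.wo] at h⟩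
  | seq p q hp hq =>
    refine ⟨fun y hy => ?_, fun y hy => ?_, fun hy => ?_⟩
    · simp only [Cmd.wv, Bool.or_eq_false_iff] at hy
      rw [Cmd.run, (hq _).v y hy.2, (hp _).v y hy.1]
    · simp only [Cmd.wa, Bool.or_eq_false_iff] at hy
      rw [Cmd.run, (hq _).a y hy.2, (hp _).a y hy.1]
    · simp only [Cmd.wo, Bool.or_eq_false_iff] at hy
      rw [Cmd.run, (hq _).out hy.2, (hp _).out hy.1]
  | ite c p q hp hq =>
    refine ⟨fun y hy => ?_, fun y hy => ?_, fun hy => ?_⟩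
    · simp only [Cmd.wv, Bool.or_eq_false_iff] at hy
      rw [Cmd.run]; split
      exacts [(hp _).v y hy.1, (hq _).v y hy.2]
    · simp only [Cmd.wa, Bool.or_eq_false_iff] at hy
      rw [Cmd.run]; split
      exacts [(hp _).a y hy.1, (hq _).a y hy.2]
    · simp only [Cmd.wo, Bool.or_eq_false_iff] at hy
      rw [Cmd.run]; split
      exacts [(hp _).out hy.1, (hq _).out hy.2]
  | loop i lo hi body hb =>
    rw [Cmd.run_loop]
    generalize lo.eval s = l
    induction hi.eval s - l with
    | zero => exact ⟨fun _ _ => rfl, fun _ _ => rfl, fun _ => rfl⟩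
    | succ k ih =>
      refine ⟨fun y hy => ?_, fun y hy => ?_, fun hy => ?_⟩
      · have h := ih.v y hy
        simp only [Cmd.wv, Bool.or_eq_false_iff, decide_eq_false_iff_not] at hy
        rw [Cmd.iter, (hb _).v y hy.2, St.setV_v_ne _ _ _ _ hy.1, h]
      · have h := ih.a y hy
        simp only [Cmd.wa] at hy
        rw [Cmd.iter, (hb _).a y hy, St.setV_a, h]
      · have h := ih.out hy
        simp only [Cmd.wo] at hy
        rw [Cmd.iter, (hb _).out hy, St.setV_out, h]

/-- The first `k` rounds are the run of a loop with literal bounds, and the footprint of a loop does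
not depend on its bounds. -/
theorem Cmd.frame_iter (body : Cmd) (i : Var) (lo hi : Ex) (l : ℕ) (s : St) (k : ℕ) :
    Frame (.loop i lo hi body) s (body.iter i l s k) := by
  have h := Cmd.frame_run (.loop i (.lit l) (.lit (l + k)) body) s
  rw [Cmd.run_loop] at h
  simp only [Ex.eval, Nat.add_sub_cancel_left] at h
  exact ⟨h.v, h.a, h.out⟩

/-! ### Weakest preconditions with cost -/

/-- From `s`, the command `c` runs within the bounds `M`, and its cost and final state
satisfy `Q`. -/
def wp (M : Lim) (c : Cmd) (s : St) (Q : ℕ → St → Prop) : Prop :=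
  c.Safe M s ∧ Q (c.cost s) (c.run s)

section Rules
variable {M : Lim} {s : St} {Q : ℕ → St → Prop}

theorem wp_mono {c : Cmd} {P : ℕ → St → Prop} (h : wp M c s P)
    (hPQ : ∀ k s', Frame c s s' → P k s' → Q k s') : wp M c s Q :=
  ⟨h.1, hPQ _ _ (c.frame_run s) h.2⟩

@[simp] theorem wp_skip : wp M .skip s Q ↔ Q 0 s := by
  simp [wp, Cmd.Safe, Cmd.cost, Cmd.run]

@[simp] theorem wp_set (x : Var) (e : Ex) :
    wp M (.set x e) s Q ↔ e.Safe M s ∧ Q (e.cost + 2) (s.setV x (e.eval s)) := Iff.rfl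

@[simp] theorem wp_put (a : Arr) (i e : Ex) :
    wp M (.put a i e) s Q ↔ (a ≠ .inp ∧ i.Safe M s ∧ e.Safe M s ∧ i.eval s < M.L) ∧
      Q (i.cost + e.cost + 6) (s.setA a (i.eval s) (e.eval s)) := Iff.rfl

@[simp] theorem wp_emit (e : Ex) :
    wp M (.emit e) s Q ↔ e.Safe M s ∧ Q (e.cost + 1) (s.addOut (some (e.eval s))) := Iff.rfl

@[simp] theorem wp_endSet : wp M .endSet s Q ↔ Q 1 (s.addOut none) := by
  simp [wp, Cmd.Safe, Cmd.cost, Cmd.run]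

@[simp] theorem wp_seq (c d : Cmd) :
    wp M (c ;; d) s Q ↔ wp M c s (fun k s' => wp M d s' (fun l s'' => Q (k + l) s'')) := by
  simp only [wp, Cmd.Safe, Cmd.cost, Cmd.run, and_assoc]

open Classical in
theorem wp_ite (c : Cond) (p q : Cmd) :
    wp M (.ite c p q) s Q ↔ c.Safe M s ∧ (c.Holds s → wp M p s (fun k => Q (c.cost + k))) ∧
      (¬ c.Holds s → wp M q s (fun k => Q (c.cost + k))) := by
  by_cases h : c.Holds s <;> simp [wp, Cmd.Safe, Cmd.cost, Cmd.run, h, and_assoc]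

@[simp] theorem wp_ite_lt (a b : Ex) (p q : Cmd) :
    wp M (.ite (.lt a b) p q) s Q ↔ (a.Safe M s ∧ b.Safe M s) ∧
      (a.eval s < b.eval s → wp M p s (fun k => Q (a.cost + b.cost + 1 + k))) ∧
      (¬ a.eval s < b.eval s → wp M q s (fun k => Q (a.cost + b.cost + 1 + k))) := wp_ite _ _ _

@[simp] theorem wp_ite_eq (a b : Ex) (p q : Cmd) :
    wp M (.ite (.eq a b) p q) s Q ↔ (a.Safe M s ∧ b.Safe M s) ∧
      (a.eval s = b.eval s → wp M p s (fun k => Q (a.cost + b.cost + 1 + k))) ∧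
      (¬ a.eval s = b.eval s → wp M q s (fun k => Q (a.cost + b.cost + 1 + k))) := wp_ite _ _ _

/-- The invariant rule; the cost of the round with counter `x` is bounded by `kf x`. -/
theorem wp_loop {i : Var} {lo hi : Ex} {body : Cmd} (l h : ℕ) (Inv : ℕ → St → Prop) (kf : ℕ → ℕ)
    (hl : lo.eval s = l) (hh : hi.eval s = h) (hle : l ≤ h)
    (hlo : lo.Safe M s) (hhi : hi.Safe M s) (h0 : Inv l s)
    (step : ∀ x s', l ≤ x → x < h → Inv x s' → Frame (.loop i lo hi body) s s' →
      wp M body (s'.setV i x) (fun k s'' => k ≤ kf x ∧ Inv (x + 1) s''))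
    (hQ : ∀ k s', Frame (.loop i lo hi body) s s' →
      k ≤ lo.cost + hi.cost + 1 + ∑ x ∈ Finset.Ico l h, (5 + kf x) → Inv h s' → Q k s') :
    wp M (.loop i lo hi body) s Q := by
  subst hl hh
  have key : ∀ k ≤ hi.eval s - lo.eval s, Inv (lo.eval s + k) (body.iter i (lo.eval s) s k) := by
    intro k hk
    induction k with
    | zero => exact h0
    | succ k ih =>
      exact (step (lo.eval s + k) _ (by omega) (by omega) (ih (by omega))
        (Cmd.frame_iter body i lo hi _ s k)).2.2
  refine ⟨⟨hlo, hhi, fun k hk => ?_⟩, hQ _ _ (Cmd.frame_run _ s) ?_ ?_⟩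
  · exact (step (lo.eval s + k) _ (by omega) (by omega) (key k hk.le)
      (Cmd.frame_iter body i lo hi _ s k)).1
  · rw [Cmd.cost, Finset.sum_Ico_eq_sum_range]
    refine Nat.add_le_add_left (Finset.sum_le_sum fun k hk => ?_) _
    have hk := Finset.mem_range.1 hk
    exact Nat.add_le_add_left (step (lo.eval s + k) _ (by omega) (by omega) (key k hk.le)
      (Cmd.frame_iter body i lo hi _ s k)).2.1 _
  · rw [Cmd.run_loop]
    have := key _ le_rfl
    rwa [Nat.add_sub_cancel' hle] at this

end Rules

section EvalLemmas
variable (M : Lim) (s : St) (a b : Ex) (k : ℕ) (x : Var) (c : Arr)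

@[simp] theorem eval_var : (Ex.var x).eval s = s.v x := rfl
@[simp] theorem eval_get : (Ex.get c a).eval s = s.a c (a.eval s) := rfl
@[simp] theorem eval_ofNat : (OfNat.ofNat k : Ex).eval s = k := rfl
@[simp] theorem eval_zero : (0 : Ex).eval s = 0 := rfl
@[simp] theorem eval_one : (1 : Ex).eval s = 1 := rfl
@[simp] theorem eval_add : (a + b).eval s = a.eval s + b.eval s := rfl
@[simp] theorem eval_sub : (a - b).eval s = a.eval s - b.eval s := rfl
@[simp] theorem eval_mul : (a * b).eval s = a.eval s * b.eval s := rfl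
@[simp] theorem eval_div : (a / b).eval s = a.eval s / b.eval s := rfl
@[simp] theorem safe_var : (Ex.var x).Safe M s ↔ True := Iff.rfl
@[simp] theorem safe_get : (Ex.get c a).Safe M s ↔ a.Safe M s ∧ a.eval s < M.idx c := Iff.rfl
@[simp] theorem safe_zero : (0 : Ex).Safe M s ↔ True := by
  change 0 ≤ M.W ↔ True; simp
@[simp] theorem safe_one : (1 : Ex).Safe M s ↔ 1 ≤ M.W := Iff.rfl
@[simp] theorem safe_add :
    (a + b).Safe M s ↔ a.Safe M s ∧ b.Safe M s ∧ a.eval s + b.eval s ≤ M.W := Iff.rfl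
@[simp] theorem safe_sub : (a - b).Safe M s ↔ a.Safe M s ∧ b.Safe M s := by
  change (_ ∧ _ ∧ True) ↔ _; simp
@[simp] theorem safe_mul :
    (a * b).Safe M s ↔ a.Safe M s ∧ b.Safe M s ∧ a.eval s * b.eval s ≤ M.W := Iff.rfl
@[simp] theorem safe_div : (a / b).Safe M s ↔ a.Safe M s ∧ b.Safe M s := by
  change (_ ∧ _ ∧ True) ↔ _; simp
@[simp] theorem cost_var : (Ex.var x).cost = 2 := rfl
@[simp] theorem cost_get : (Ex.get c a).cost = a.cost + 6 := rfl
@[simp] theorem cost_zero : (0 : Ex).cost = 1 := rfl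
@[simp] theorem cost_one : (1 : Ex).cost = 1 := rfl
@[simp] theorem cost_add : (a + b).cost = a.cost + b.cost + 1 := rfl
@[simp] theorem cost_sub : (a - b).cost = a.cost + b.cost + 1 := rfl
@[simp] theorem cost_mul : (a * b).cost = a.cost + b.cost + 1 := rfl
@[simp] theorem cost_div : (a / b).cost = a.cost + b.cost + 1 := rfl

end EvalLemmas

@[simp] theorem Lim.idx_inp (M : Lim) : M.idx .inp = M.B := rfl
theorem Lim.idx_of_ne (M : Lim) {c : Arr} (h : c ≠ .inp) : M.idx c = M.L := by
  cases c <;> first | rfl | exact absurd rfl h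

end Loop

namespace Loop

/-! ### Compilation to the word RAM -/

/-- Position of an array in the interleaved layout. -/
def Arr.pos (a : Arr) : ℕ := a.ctorIdx

/-- The number of interleaved arrays. -/
def stride : ℕ := 32

theorem Arr.pos_lt (a : Arr) : a.pos < stride := by cases a <;> decide

theorem Arr.pos_inj {a c : Arr} (h : a.pos = c.pos) : a = c := by
  revert h; cases a <;> cases c <;> decide

/-- Variables occupy the odd registers and temporaries the positive even ones. Register `0` remains
free for the length of the input, where the interleaved arrays begin. -/
def vreg (x : Var) : ℕ := 2 * x.ctorIdx + 1

theorem vreg_inj {x y : Var} (h : vreg x = vreg y) : x = y := by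
  have h' : x.ctorIdx = y.ctorIdx := by simp only [vreg] at h; omega
  revert h'; cases x <;> first
    | (cases y <;> first | (intro _; rfl) | (intro h'; exact absurd h' (by decide)))

def tmp (t : ℕ) : ℕ := 2 * t + 2

open RAM (Prog Instr Exec State Event)

def move (x y t : ℕ) : Prog := .seq (.instr (.const t 0)) (.instr (.arith .plus x y t))

/-- Replaces the index in `tmp t` by the address of the array entry. -/
def Arr.addr (a : Arr) (t : ℕ) : Prog :=
  match a with
  | .inp => .skip
  | a => .seq (.instr (.const (tmp (t + 1)) stride)) <|
      .seq (.instr (.arith .times (tmp t) (tmp t) (tmp (t + 1)))) <|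
      .seq (.instr (.arith .plus (tmp t) (tmp t) 0)) <|
      .seq (.instr (.const (tmp (t + 1)) a.pos)) <|
      .instr (.arith .plus (tmp t) (tmp t) (tmp (t + 1)))

/-- The temporaries serve as a stack: code compiled at `t` leaves its value in `tmp t` and does not
touch the temporaries below. -/
def Ex.compile : Ex → ℕ → Prog
  | .lit c, t => .instr (.const (tmp t) c)
  | .var x, t => .seq (.instr (.const (tmp t) 0)) (.instr (.arith .plus (tmp t) (vreg x) (tmp t)))
  | .op o a b, t => .seq (a.compile t) <| .seq (b.compile (t + 1)) <|
      .instr (.arith o (tmp t) (tmp t) (tmp (t + 1)))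
  | .get a i, t => .seq (i.compile t) <| .seq (a.addr t) <| .instr (.load (tmp t) (tmp t))

/-- A loop keeps its counter and upper bound in `tmp t` and `tmp (t + 1)`, out of reach of the body,
which is compiled at `t + 2`. -/
def Cmd.compile : Cmd → ℕ → Prog
  | .skip, _ => .skip
  | .set x e, t => .seq (e.compile t) (move (vreg x) (tmp t) (tmp (t + 1)))
  | .put a i e, t => .seq (i.compile t) <| .seq (a.addr t) <| .seq (e.compile (t + 1)) <|
      .instr (.store (tmp t) (tmp (t + 1)))
  | .emit e, t => .seq (e.compile t) (.instr (.emit (tmp t)))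
  | .endSet, _ => .instr .endSet
  | .seq p q, t => .seq (p.compile t) (q.compile t)
  | .ite (.lt a b) p q, t => .seq (a.compile t) <| .seq (b.compile (t + 1)) <|
      .ite (.lt (tmp t) (tmp (t + 1))) (p.compile t) (q.compile t)
  | .ite (.eq a b) p q, t => .seq (a.compile t) <| .seq (b.compile (t + 1)) <|
      .ite (.eq (tmp t) (tmp (t + 1))) (p.compile t) (q.compile t)
  | .loop i lo hi body, t => .seq (lo.compile t) <| .seq (hi.compile (t + 1)) <|
      .while (.lt (tmp t) (tmp (t + 1))) <|
        .seq (move (vreg i) (tmp t) (tmp (t + 2))) <| .seq (body.compile (t + 2)) <|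
        .seq (.instr (.const (tmp (t + 2)) 1))
          (.instr (.arith .plus (tmp t) (tmp t) (tmp (t + 2))))

/-- Only the input array is used. -/
def Ex.OnlyInp : Ex → Bool
  | .lit _ => true
  | .var _ => true
  | .op _ a b => a.OnlyInp && b.OnlyInp
  | .get a i => a = .inp && i.OnlyInp

def Cond.OnlyInp : Cond → Bool
  | .lt a b => a.OnlyInp && b.OnlyInp
  | .eq a b => a.OnlyInp && b.OnlyInp

/-- Such code never consults register `0`, hence may run before the length of the input is known.
`put` is excluded because it always addresses an interleaved array. -/
def Cmd.OnlyInp : Cmd → Bool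
  | .skip => true
  | .set _ e => e.OnlyInp
  | .put _ _ _ => false
  | .emit e => e.OnlyInp
  | .endSet => true
  | .seq p q => p.OnlyInp && q.OnlyInp
  | .ite c p q => c.OnlyInp && p.OnlyInp && q.OnlyInp
  | .loop _ lo hi body => lo.OnlyInp && hi.OnlyInp && body.OnlyInp

/-- `p` runs from `R` in time at most `k` within the first `Sp` cells and with words at most `W`,
and its output and its final state satisfy `Q`. -/
def Runs (Sp W : ℕ) (p : Prog) (R : State) (k : ℕ) (Q : List (Option ℕ) → State → Prop) : Prop :=
  ∃ tr R', Exec p R tr R' ∧ tr.length ≤ k ∧ RAM.UsesSpace Sp tr ∧ RAM.WordsAtMost W tr ∧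
    Q (RAM.output tr) R'

section Runs
variable {Sp W : ℕ} {p q : Prog} {R : State} {k l : ℕ} {P Q : List (Option ℕ) → State → Prop}

theorem usesSpace_append {tr tr' : List Event} :
    RAM.UsesSpace Sp (tr ++ tr') ↔ RAM.UsesSpace Sp tr ∧ RAM.UsesSpace Sp tr' := by
  simp [RAM.UsesSpace, or_imp, forall_and]

theorem wordsAtMost_append {tr tr' : List Event} :
    RAM.WordsAtMost W (tr ++ tr') ↔ RAM.WordsAtMost W tr ∧ RAM.WordsAtMost W tr' := by
  simp [RAM.WordsAtMost, or_imp, forall_and]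

theorem usesSpace_test {tr : List Event} :
    RAM.UsesSpace Sp (.test :: tr) ↔ RAM.UsesSpace Sp tr := by
  simp [RAM.UsesSpace]

theorem wordsAtMost_test {tr : List Event} :
    RAM.WordsAtMost W (.test :: tr) ↔ RAM.WordsAtMost W tr := by
  simp [RAM.WordsAtMost]

theorem output_append (tr tr' : List Event) :
    RAM.output (tr ++ tr') = RAM.output tr ++ RAM.output tr' := by
  simp [RAM.output]

theorem output_test (tr : List Event) : RAM.output (.test :: tr) = RAM.output tr := rfl

theorem Runs.seq (hp : Runs Sp W p R k P)
    (hq : ∀ o R', P o R' → Runs Sp W q R' l fun o' => Q (o ++ o')) :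
    Runs Sp W (.seq p q) R (k + l) Q := by
  obtain ⟨tr, R', h1, h2, h3, h4, h6⟩ := hp
  obtain ⟨tr', R'', g1, g2, g3, g4, g6⟩ := hq _ R' h6
  refine ⟨_, _, h1.seq g1, by simp; omega, usesSpace_append.2 ⟨h3, g3⟩,
    wordsAtMost_append.2 ⟨h4, g4⟩, ?_⟩
  rwa [output_append]

theorem Runs.mono (hp : Runs Sp W p R k P) (hk : k ≤ l) (hQ : ∀ o R', P o R' → Q o R') :
    Runs Sp W p R l Q := by
  obtain ⟨tr, R', h1, h2, h3, h4, h6⟩ := hp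
  exact ⟨tr, R', h1, h2.trans hk, h3, h4, hQ _ _ h6⟩

/-- Sequencing after a program that writes no output. -/
theorem Runs.seq_silent {P : State → Prop} (hp : Runs Sp W p R k fun o R' => o = [] ∧ P R')
    (hq : ∀ R', P R' → Runs Sp W q R' l Q) : Runs Sp W (.seq p q) R (k + l) Q :=
  hp.seq fun o R' h => (hq R' h.2).mono le_rfl fun o' R'' h' => by rw [h.1]; exact h'

theorem Runs.instr {i : Instr} (hs : RAM.UsesSpace Sp [i.event R])
    (hw : RAM.WordsAtMost W [i.event R]) (hQ : Q (RAM.output [i.event R]) (i.next R)) :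
    Runs Sp W (.instr i) R 1 Q :=
  ⟨_, _, .instr i R, le_rfl, hs, hw, hQ⟩

theorem Runs.const {r c : ℕ} (hc : c ≤ W)
    (hQ : Q [] { R with reg := Function.update R.reg r c }) :
    Runs Sp W (.instr (.const r c)) R 1 Q :=
  Runs.instr (by simp [RAM.UsesSpace, Instr.event]) (by simpa [RAM.WordsAtMost, Instr.event]) hQ

theorem Runs.const_seq {r c : ℕ} (hc : c ≤ W)
    (hq : Runs Sp W q { R with reg := Function.update R.reg r c } l Q) :
    Runs Sp W (.seq (.instr (.const r c)) q) R (1 + l) Q :=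
  Runs.seq_silent (P := fun R' => R' = _) (Runs.const hc ⟨rfl, rfl⟩) (by rintro _ rfl; exact hq)

theorem Runs.arith {op : RAM.ArithOp} {r a b : ℕ} (hc : op.eval (R.reg a) (R.reg b) ≤ W)
    (hQ : Q [] { R with reg := Function.update R.reg r (op.eval (R.reg a) (R.reg b)) }) :
    Runs Sp W (.instr (.arith op r a b)) R 1 Q :=
  Runs.instr (by simp [RAM.UsesSpace, Instr.event]) (by simpa [RAM.WordsAtMost, Instr.event]) hQ

theorem Runs.arith_seq {op : RAM.ArithOp} {r a b : ℕ} (hc : op.eval (R.reg a) (R.reg b) ≤ W)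
    (hq : Runs Sp W q
      { R with reg := Function.update R.reg r (op.eval (R.reg a) (R.reg b)) } l Q) :
    Runs Sp W (.seq (.instr (.arith op r a b)) q) R (1 + l) Q :=
  Runs.seq_silent (P := fun R' => R' = _) (Runs.arith hc ⟨rfl, rfl⟩) (by rintro _ rfl; exact hq)

theorem Runs.test {t : RAM.Test} (h : (t.Holds R → Runs Sp W p R k Q))
    (h' : (¬ t.Holds R → Runs Sp W q R k Q)) :
    Runs Sp W (.ite t p q) R (k + 1) Q := by
  by_cases ht : t.Holds R
  · obtain ⟨tr, R', h1, h2, h3, h4, h6⟩ := h ht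
    exact ⟨_, _, .iteTrue ht h1, by simpa, usesSpace_test.2 h3, wordsAtMost_test.2 h4, h6⟩
  · obtain ⟨tr, R', h1, h2, h3, h4, h6⟩ := h' ht
    exact ⟨_, _, .iteFalse ht h1, by simpa, usesSpace_test.2 h3, wordsAtMost_test.2 h4, h6⟩

theorem Runs.whileFalse {t : RAM.Test} (ht : ¬ t.Holds R) (hQ : Q [] R) :
    Runs Sp W (.while t p) R 1 Q :=
  ⟨_, _, .whileFalse ht, le_rfl, usesSpace_test.2 (by simp [RAM.UsesSpace]),
    wordsAtMost_test.2 (by simp [RAM.WordsAtMost]), hQ⟩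

theorem Runs.whileTrue {t : RAM.Test} (ht : t.Holds R) (hp : Runs Sp W p R k P)
    (hq : ∀ o R', P o R' → Runs Sp W (.while t p) R' l fun o' => Q (o ++ o')) :
    Runs Sp W (.while t p) R (1 + k + l) Q := by
  obtain ⟨tr, R', h1, h2, h3, h4, h6⟩ := hp
  obtain ⟨tr', R'', g1, g2, g3, g4, g6⟩ := hq _ R' h6
  refine ⟨_, _, .whileTrue ht h1 g1, by simp; omega, usesSpace_test.2 (usesSpace_append.2 ⟨h3, g3⟩),
    wordsAtMost_test.2 (wordsAtMost_append.2 ⟨h4, g4⟩), ?_⟩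
  rwa [output_test, output_append]

end Runs

/-- All words in the variables and arrays are at most `W`. -/
def St.Bdd (W : ℕ) (s : St) : Prop := (∀ x, s.v x ≤ W) ∧ ∀ a i, s.a a i ≤ W

/-- The RAM state `R` represents the state `s`. -/
structure Sim (M : Lim) (s : St) (R : State) : Prop where
  v : ∀ x, R.reg (vreg x) = s.v x
  inp : ∀ i < M.B, R.mem i = s.a .inp i
  a : ∀ a, a ≠ .inp → ∀ i, R.mem (M.B + stride * i + a.pos) = s.a a i

/-- The bounds leave room for addresses and constants. -/
structure Lim.Good (M : Lim) : Prop where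
  space : M.B + stride * M.L ≤ M.W
  stride : stride ≤ M.W

/-- The number of memory cells used. -/
def Lim.Sp (M : Lim) : ℕ := M.B + Loop.stride * M.L

theorem vreg_ne_tmp (x : Var) (t : ℕ) : vreg x ≠ tmp t := by simp only [vreg, tmp]; omega
theorem vreg_ne_zero (x : Var) : vreg x ≠ 0 := by simp only [vreg]; omega
theorem tmp_ne_zero (t : ℕ) : tmp t ≠ 0 := by simp only [tmp]; omega
theorem tmp_inj {t t' : ℕ} : tmp t = tmp t' ↔ t = t' := by simp only [tmp]; omega

/-- `R'` differs from `R` only in temporaries `t, t + 1, …`. -/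
structure Agree (t : ℕ) (R R' : State) : Prop where
  mem : R'.mem = R.mem
  reg : ∀ r, (∀ t' ≥ t, r ≠ tmp t') → R'.reg r = R.reg r

section Agree
variable {t t' : ℕ} {R R' R'' : State}

theorem Agree.sim (h : Agree t R R') {M : Lim} {s : St} (hs : Sim M s R) : Sim M s R' :=
  ⟨fun x => by rw [h.reg _ fun _ _ => vreg_ne_tmp _ _, hs.v], by rw [h.mem]; exact hs.inp,
    by rw [h.mem]; exact hs.a⟩

theorem Agree.zero (h : Agree t R R') : R'.reg 0 = R.reg 0 :=
  h.reg _ fun _ _ => (tmp_ne_zero _).symm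

theorem Agree.reg_tmp (h : Agree t R R') (ht : t' < t) : R'.reg (tmp t') = R.reg (tmp t') :=
  h.reg _ fun t'' h'' => by rw [Ne, tmp_inj]; omega

theorem Agree.trans (h : Agree t R R') (h' : Agree t' R' R'') (ht : t ≤ t') : Agree t R R'' :=
  ⟨h'.mem.trans h.mem, fun r hr => (h'.reg r fun u hu => hr u (ht.trans hu)).trans (h.reg r hr)⟩

theorem Agree.refl (t : ℕ) (R : State) : Agree t R R := ⟨rfl, fun _ _ => rfl⟩

theorem Agree.update (ht : t ≤ t') (c : ℕ) :
    Agree t R { R with reg := Function.update R.reg (tmp t') c } :=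
  ⟨rfl, fun _ hr => Function.update_of_ne (hr t' ht) _ _⟩

end Agree

theorem stride_mul_lt {i L : ℕ} (h : i < L) (a : Arr) : stride * i + a.pos < stride * L :=
  calc stride * i + a.pos < stride * i + stride := Nat.add_lt_add_left a.pos_lt _
    _ = stride * (i + 1) := rfl
    _ ≤ stride * L := Nat.mul_le_mul_left _ h

theorem runs_addr {M : Lim} (hM : M.Good) {a : Arr} {i t : ℕ} {R : State}
    (h0 : R.reg 0 = M.B ∨ a = .inp) (hi : i < M.idx a) (ht : R.reg (tmp t) = i) :
    Runs M.Sp M.W (a.addr t) R 5 fun o R' => o = [] ∧ Agree t R R' ∧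
      R'.reg (tmp t) = if a = .inp then i else M.B + stride * i + a.pos := by
  by_cases ha : a = .inp
  · subst ha
    exact ⟨[], R, .skip R, by simp, by simp [RAM.UsesSpace], by simp [RAM.WordsAtMost], rfl,
      Agree.refl _ _, by simpa using ht⟩
  have h0 := h0.resolve_right ha
  rw [M.idx_of_ne ha] at hi
  have e : a.addr t = .seq (.instr (.const (tmp (t + 1)) stride)) (
      .seq (.instr (.arith .times (tmp t) (tmp t) (tmp (t + 1)))) <|
      .seq (.instr (.arith .plus (tmp t) (tmp t) 0)) <|
      .seq (.instr (.const (tmp (t + 1)) a.pos)) <|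
      .instr (.arith .plus (tmp t) (tmp t) (tmp (t + 1)))) := by
    cases a <;> first | rfl | exact absurd rfl ha
  have hs := hM.space
  have hp := a.pos_lt
  have hst := hM.stride
  have hmul := stride_mul_lt hi a
  have n1 : tmp t ≠ tmp (t + 1) := by rw [Ne, tmp_inj]; omega
  have n2 : 0 ≠ tmp t := (tmp_ne_zero t).symm
  have n3 : 0 ≠ tmp (t + 1) := (tmp_ne_zero _).symm
  rw [e]
  change Runs _ _ _ _ (1 + (1 + (1 + (1 + 1)))) _
  refine Runs.const_seq hst (Runs.arith_seq ?_ (Runs.arith_seq ?_ (Runs.const_seq (by omega)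
    (Runs.arith ?_ ⟨rfl, ⟨rfl, fun r hr => ?_⟩, ?_⟩))))
  · simp [RAM.ArithOp.eval, ht, n1, mul_comm i]; omega
  · simp [RAM.ArithOp.eval, ht, n1, n2, n3, mul_comm i, h0]; omega
  · simp [RAM.ArithOp.eval, ht, n1, n2, n3, mul_comm i, h0]; omega
  · have h1 := hr t le_rfl
    have h2 := hr (t + 1) (by omega)
    simp [h1, h2]
  · simp [RAM.ArithOp.eval, ht, n1, n2, n3, mul_comm i, h0, ha]; omega

theorem Ex.eval_le {M : Lim} {s : St} (hb : s.Bdd M.W) (e : Ex) (hs : e.Safe M s) :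
    e.eval s ≤ M.W := by
  induction e with
  | lit c => exact hs
  | var x => exact hb.1 x
  | op o a b iha ihb =>
    cases o
    · exact hs.2.2
    · exact (Nat.sub_le _ _).trans (iha hs.1)
    · exact hs.2.2
    · exact (Nat.div_le_self _ _).trans (iha hs.1)
  | get a i ih => exact hb.2 _ _

theorem runs_ex {M : Lim} (hM : M.Good) {s : St} (hb : s.Bdd M.W) (e : Ex) (hs : e.Safe M s)
    (t : ℕ) {R : State} (hR : Sim M s R) (h0 : R.reg 0 = M.B ∨ e.OnlyInp = true) :
    Runs M.Sp M.W (e.compile t) R e.cost fun o R' => o = [] ∧ Agree t R R' ∧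
      R'.reg (tmp t) = e.eval s := by
  have hv := e.eval_le hb hs
  induction e generalizing t R with
  | lit c => exact Runs.const hs ⟨rfl, Agree.update le_rfl _, by simp [Ex.eval]⟩
  | var x =>
    have n1 := vreg_ne_tmp x t
    refine Runs.const_seq (l := 1) (Nat.zero_le _) (Runs.arith
      (by simpa [RAM.ArithOp.eval, n1, hR.v] using hv)
      ⟨rfl, (Agree.update le_rfl _).trans (Agree.update le_rfl _) le_rfl, ?_⟩)
    simp [RAM.ArithOp.eval, n1, hR.v, Ex.eval]
  | op o a b iha ihb =>
    simp only [Ex.OnlyInp, Bool.and_eq_true] at h0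
    refine Runs.mono (Runs.seq_silent (iha hs.1 t hR (h0.imp_right And.left) (a.eval_le hb hs.1))
      fun R1 h1 => Runs.seq_silent (ihb hs.2.1 (t + 1) (h1.1.sim hR)
        (by rw [h1.1.zero]; exact h0.imp_right And.right) (b.eval_le hb hs.2.1)) fun R2 h2 => ?_)
        (Nat.le_of_eq (Nat.add_assoc _ _ 1).symm) (fun _ _ h => h)
    have e1 : R2.reg (tmp t) = a.eval s := by rw [h2.1.reg_tmp (Nat.lt_succ_self t), h1.2]
    refine Runs.arith (by rw [e1, h2.2]; exact hv)
      ⟨rfl, (h1.1.trans h2.1 (Nat.le_succ _)).trans (Agree.update le_rfl _) le_rfl, ?_⟩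
    simp [e1, h2.2, Ex.eval]
  | get a i ih =>
    simp only [Ex.OnlyInp, Bool.and_eq_true, decide_eq_true_eq] at h0
    refine Runs.mono (Runs.seq_silent
      (ih hs.1 t hR (h0.imp_right And.right) (i.eval_le hb hs.1)) fun R1 h1 =>
      Runs.seq_silent (runs_addr hM (by rw [h1.1.zero]; exact h0.imp_right And.left)
        hs.2 h1.2) fun R2 h2 => ?_) (k := i.cost + (5 + 1)) le_rfl (fun _ _ h => h)
    have hag := h1.1.trans h2.1 le_rfl
    have hsim := hag.sim hR
    have hval : R2.mem (R2.reg (tmp t)) = s.a a (i.eval s) := by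
      rw [h2.2]; split
      · next h => subst h; exact hsim.inp _ hs.2
      · next h => exact hsim.a a h _
    refine Runs.instr ?_ ?_ ⟨rfl, hag.trans (Agree.update le_rfl _) le_rfl, ?_⟩
    · have h3 := hs.2
      simp only [RAM.UsesSpace, Instr.event, List.mem_singleton, forall_eq, h2.2, Lim.Sp]
      split
      · next h => subst h; exact Nat.lt_add_right _ h3
      · next h =>
        rw [M.idx_of_ne h] at h3
        have := stride_mul_lt h3 a
        omega
    · simp only [RAM.WordsAtMost, Instr.event, List.mem_singleton, forall_eq, hval]
      exact hv
    · simp [Ex.eval, hval, Instr.next]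

theorem St.Bdd.setV {W : ℕ} {s : St} (h : s.Bdd W) (x : Var) {k : ℕ} (hk : k ≤ W) :
    (s.setV x k).Bdd W := by
  refine ⟨fun y => ?_, h.2⟩
  by_cases hy : y = x
  · subst hy; simpa
  · simpa [hy] using h.1 y

theorem St.Bdd.setA {W : ℕ} {s : St} (h : s.Bdd W) (a : Arr) (i : ℕ) {k : ℕ} (hk : k ≤ W) :
    (s.setA a i k).Bdd W := by
  refine ⟨h.1, fun c j => ?_⟩
  by_cases hc : c = a
  · subst hc
    by_cases hj : j = i
    · subst hj; simpa
    · simpa [hj] using h.2 c j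
  · simpa [hc] using h.2 c j

theorem Cmd.bdd_run {M : Lim} (c : Cmd) {s : St} (hb : s.Bdd M.W) (hs : c.Safe M s) :
    (c.run s).Bdd M.W := by
  induction c generalizing s with
  | skip => exact hb
  | set x e => exact hb.setV x (e.eval_le hb hs)
  | put a i e => exact hb.setA a _ (e.eval_le hb hs.2.2.1)
  | emit e => exact hb
  | endSet => exact hb
  | seq p q hp hq => exact hq (hp hb hs.1) hs.2
  | ite c p q hp hq =>
    have hs' := hs.2
    rw [Cmd.run]
    split at hs'
    · next h => rw [if_pos h]; exact hp hb hs'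
    · next h => rw [if_neg h]; exact hq hb hs'
  | loop i lo hi body ih =>
    rw [Cmd.run_loop]
    have key : ∀ k ≤ hi.eval s - lo.eval s, (body.iter i (lo.eval s) s k).Bdd M.W := by
      intro k hk
      induction k with
      | zero => exact hb
      | succ k ihk =>
        have := hi.eval_le hb hs.2.1
        exact ih ((ihk (by omega)).setV i (by omega)) (hs.2.2 k (by omega))
    exact key _ le_rfl

theorem Sim.setV {M : Lim} {s : St} {R : State} (h : Sim M s R) (x : Var) (k : ℕ) :
    Sim M (s.setV x k) { R with reg := Function.update R.reg (vreg x) k } := by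
  refine ⟨fun y => ?_, h.inp, h.a⟩
  by_cases hy : y = x
  · subst hy; simp
  · have : vreg y ≠ vreg x := fun h => hy (vreg_inj h)
    simpa [hy, this] using h.v y

/-- Division of the offset by `stride` recovers index and array. With interleaving, addresses depend
on the input length alone and not on the lengths of the other arrays, which the compiler does not
know. -/
theorem addr_inj {B i j : ℕ} {a c : Arr} (h : B + stride * i + a.pos = B + stride * j + c.pos) :
    i = j ∧ a = c := by
  have ha := a.pos_lt
  have hc := c.pos_lt
  simp only [stride] at h ha hc
  exact ⟨by omega, Arr.pos_inj (by omega)⟩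

theorem Sim.setA {M : Lim} {s : St} {R : State} (h : Sim M s R) {a : Arr} (ha : a ≠ .inp)
    (i k : ℕ) :
    Sim M (s.setA a i k) { R with mem := Function.update R.mem (M.B + stride * i + a.pos) k } := by
  refine ⟨h.v, fun j hj => ?_, fun c hc j => ?_⟩
  · have : j ≠ M.B + stride * i + a.pos := by omega
    simpa [ha.symm, this] using h.inp j hj
  · by_cases hca : c = a
    · subst hca
      by_cases hj : j = i
      · subst hj; simp
      · have : M.B + stride * j + c.pos ≠ M.B + stride * i + c.pos := fun h => hj (addr_inj h).1
        simp only [St.setA_a_self, Function.update_of_ne this, Function.update_of_ne hj]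
        exact h.a c hc j
    · have : M.B + stride * j + c.pos ≠ M.B + stride * i + a.pos := fun h => hca (addr_inj h).2
      simp only [St.setA_a_ne _ _ _ _ _ hca, Function.update_of_ne this]
      exact h.a c hc j

theorem Sim.addOut {M : Lim} {s : St} {R : State} (h : Sim M s R) (o : Option ℕ) :
    Sim M (s.addOut o) R := ⟨h.v, h.inp, h.a⟩

/-- What the compiled code guarantees about the final RAM state. -/
structure Post (M : Lim) (t : ℕ) (R : State) (s' : St) (R' : State) : Prop where
  sim : Sim M s' R'
  zero : R'.reg 0 = R.reg 0
  tmp : ∀ t' < t, R'.reg (Loop.tmp t') = R.reg (Loop.tmp t')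

theorem Post.trans {M : Lim} {t t' : ℕ} {R R' R'' : State} {s' s'' : St} (h : Post M t R s' R')
    (h' : Post M t' R' s'' R'') (ht : t ≤ t') : Post M t R s'' R'' :=
  ⟨h'.sim, h'.zero.trans h.zero, fun u hu => (h'.tmp u (by omega)).trans (h.tmp u hu)⟩

theorem Agree.post {M : Lim} {t : ℕ} {R R' : State} {s : St} (h : Agree t R R') (hs : Sim M s R) :
    Post M t R s R' := ⟨h.sim hs, h.zero, fun _ hu => h.reg_tmp hu⟩

theorem runs_move {M : Lim} {x : Var} {y t : ℕ} {s : St} {R : State} (hR : Sim M s R)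
    (hy : R.reg (tmp y) ≤ M.W) (hyt : y < t) :
    Runs M.Sp M.W (move (vreg x) (tmp y) (tmp t)) R 2 fun o R' => o = [] ∧
      Post M t R (s.setV x (R.reg (tmp y))) R' := by
  have ht : tmp y ≠ tmp t := by rw [Ne, tmp_inj]; omega
  have hag : Agree t R { R with reg := Function.update R.reg (tmp t) 0 } := Agree.update le_rfl 0
  refine Runs.const_seq (l := 1) (Nat.zero_le _) (Runs.arith ?_ ⟨rfl, ?_⟩)
  · simpa [RAM.ArithOp.eval, ht] using hy
  · simp only [RAM.ArithOp.eval, Function.update_of_ne ht, Function.update_self, add_zero]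
    refine ⟨(hag.sim hR).setV x (R.reg (tmp y)), ?_, fun u hu => ?_⟩
    · simpa only [Function.update_of_ne (vreg_ne_zero x).symm] using hag.zero
    · simpa only [Function.update_of_ne (vreg_ne_tmp x u).symm] using hag.reg_tmp hu

/-- `c` compiled and run from a representation of `s` yields a representation of `c.run s`. -/
def Correct (M : Lim) (c : Cmd) : Prop :=
  ∀ (s : St) (t : ℕ) (R : State), s.Bdd M.W → c.Safe M s → Sim M s R →
    (R.reg 0 = M.B ∨ c.OnlyInp = true) →
    Runs M.Sp M.W (c.compile t) R (c.cost s) fun o R' =>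
      (c.run s).out = s.out ++ o ∧ Post M t R (c.run s) R'

theorem correct_set {M : Lim} (hM : M.Good) (x : Var) (e : Ex) : Correct M (.set x e) := by
  intro s t R hb hs hR h0
  refine Runs.seq_silent (runs_ex hM hb e hs t hR h0) fun R1 h1 =>
    (runs_move (h1.1.sim hR) (by rw [h1.2]; exact e.eval_le hb hs) (Nat.lt_succ_self t)).mono
      le_rfl fun o R' h => ?_
  rw [h1.2] at h
  exact ⟨by simp [Cmd.run, h.1], (h1.1.post hR).trans h.2 (Nat.le_succ t)⟩

theorem correct_put {M : Lim} (hM : M.Good) (a : Arr) (i e : Ex) : Correct M (.put a i e) := by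
  intro s t R hb hs hR h0
  obtain ⟨ha, hi, he, hlt⟩ := hs
  have h0 : R.reg 0 = M.B := h0.resolve_right (by simp [Cmd.OnlyInp])
  refine Runs.mono (Runs.seq_silent
    (runs_ex hM hb i hi t hR (Or.inl h0)) fun R1 h1 => Runs.seq_silent
    (runs_addr hM (Or.inl (h1.1.zero.trans h0)) (by rwa [M.idx_of_ne ha]) h1.2)
    fun R2 h2 => Runs.seq_silent
    (runs_ex hM hb e he (t + 1) ((h1.1.trans h2.1 le_rfl).sim hR)
      (Or.inl ((h1.1.trans h2.1 le_rfl).zero.trans h0))) fun R3 h3 => ?_)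
    (k := i.cost + (5 + (e.cost + 1))) (by simp only [Cmd.cost]; omega) (fun _ _ h => h)
  have hag := (h1.1.trans h2.1 le_rfl).trans h3.1 (Nat.le_succ t)
  have e1 : R3.reg (tmp t) = M.B + stride * i.eval s + a.pos := by
    rw [h3.1.reg_tmp (Nat.lt_succ_self t), h2.2, if_neg ha]
  refine Runs.instr ?_ ?_ ⟨(List.append_nil _).symm, ?_⟩
  · have hmul := stride_mul_lt hlt a
    simp only [RAM.UsesSpace, Instr.event, List.mem_singleton, forall_eq, e1, Lim.Sp]
    omega
  · simpa only [RAM.WordsAtMost, Instr.event, List.mem_singleton, forall_eq, h3.2] using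
      e.eval_le hb he
  · rw [Instr.next, e1, h3.2]
    exact ⟨(hag.sim hR).setA ha _ _, hag.zero, fun u hu => hag.reg_tmp hu⟩

theorem correct_emit {M : Lim} (hM : M.Good) (e : Ex) : Correct M (.emit e) := by
  intro s t R hb hs hR h0
  refine Runs.seq_silent (runs_ex hM hb e hs t hR h0) fun R1 h1 => Runs.instr ?_ ?_ ⟨?_, ?_⟩
  · simp [RAM.UsesSpace, Instr.event]
  · simpa [RAM.WordsAtMost, Instr.event, h1.2] using e.eval_le hb hs
  · simp [RAM.output, Instr.event, Event.symbol, h1.2, Cmd.run]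
  · exact ⟨(h1.1.sim hR).addOut _, h1.1.zero, fun u hu => h1.1.reg_tmp hu⟩

theorem runs_test {M : Lim} (hM : M.Good) {s : St} {a b : Ex} {p q : Prog} {t k : ℕ} {R : State}
    {Q : List (Option ℕ) → State → Prop} (T : ℕ → ℕ → RAM.Test) (hb : s.Bdd M.W)
    (ha : a.Safe M s) (hb' : b.Safe M s) (hR : Sim M s R) (h0 : R.reg 0 = M.B ∨ a.OnlyInp = true)
    (h0' : R.reg 0 = M.B ∨ b.OnlyInp = true)
    (hp : ∀ R', Agree t R R' → R'.reg (tmp t) = a.eval s → R'.reg (tmp (t + 1)) = b.eval s →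
      Runs M.Sp M.W (.ite (T (tmp t) (tmp (t + 1))) p q) R' k Q) :
    Runs M.Sp M.W (.seq (a.compile t) <| .seq (b.compile (t + 1)) <|
      .ite (T (tmp t) (tmp (t + 1))) p q) R (a.cost + (b.cost + k)) Q :=
  Runs.seq_silent (runs_ex hM hb a ha t hR h0) fun R1 h1 =>
    Runs.seq_silent (runs_ex hM hb b hb' (t + 1) (h1.1.sim hR)
      (by rw [h1.1.zero]; exact h0')) fun R2 h2 =>
  hp R2 (h1.1.trans h2.1 (Nat.le_succ t))
    (by rw [h2.1.reg_tmp (Nat.lt_succ_self t), h1.2]) h2.2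

theorem correct_ite {M : Lim} (hM : M.Good) (c : Cond) {p q : Cmd} (hp : Correct M p)
    (hq : Correct M q) : Correct M (.ite c p q) := by
  intro s t R hb hs hR h0
  simp only [Cmd.OnlyInp, Bool.and_eq_true] at h0
  have h1 : c.Holds s → ∀ R', Agree t R R' → Runs M.Sp M.W (p.compile t) R'
      ((Cmd.ite c p q).cost s - c.cost) fun o R'' =>
        ((Cmd.ite c p q).run s).out = s.out ++ o ∧ Post M t R ((Cmd.ite c p q).run s) R'' := by
    intro hc R' hag
    have hs' := hs.2
    simp only [Cmd.run, Cmd.cost, hc, if_true, Nat.add_sub_cancel_left] at hs' ⊢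
    exact (hp s t R' hb hs' (hag.sim hR) (by rw [hag.zero]; exact h0.imp_right fun h => h.1.2)).mono
      le_rfl fun o R'' h => ⟨h.1, (hag.post hR).trans h.2 le_rfl⟩
  have h2 : ¬ c.Holds s → ∀ R', Agree t R R' → Runs M.Sp M.W (q.compile t) R'
      ((Cmd.ite c p q).cost s - c.cost) fun o R'' =>
        ((Cmd.ite c p q).run s).out = s.out ++ o ∧ Post M t R ((Cmd.ite c p q).run s) R'' := by
    intro hc R' hag
    have hs' := hs.2
    simp only [Cmd.run, Cmd.cost, hc, if_false, Nat.add_sub_cancel_left] at hs' ⊢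
    exact (hq s t R' hb hs' (hag.sim hR) (by rw [hag.zero]; exact h0.imp_right fun h => h.2)).mono
      le_rfl fun o R'' h => ⟨h.1, (hag.post hR).trans h.2 le_rfl⟩
  cases c with
  | lt a b =>
    simp only [Cond.OnlyInp, Bool.and_eq_true] at h0
    refine (runs_test hM .lt hb hs.1.1 hs.1.2 hR (h0.imp_right fun h => h.1.1.1)
      (h0.imp_right fun h => h.1.1.2) fun R' hag ea eb =>
      Runs.test (fun ht => h1 ?_ R' hag) (fun ht => h2 ?_ R' hag)).mono
      (by simp only [Cmd.cost, Cond.cost]; omega) (fun _ _ h => h)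
    · simpa [RAM.Test.Holds, ea, eb, Cond.Holds] using ht
    · simpa [RAM.Test.Holds, ea, eb, Cond.Holds] using ht
  | eq a b =>
    simp only [Cond.OnlyInp, Bool.and_eq_true] at h0
    refine (runs_test hM .eq hb hs.1.1 hs.1.2 hR (h0.imp_right fun h => h.1.1.1)
      (h0.imp_right fun h => h.1.1.2) fun R' hag ea eb =>
      Runs.test (fun ht => h1 ?_ R' hag) (fun ht => h2 ?_ R' hag)).mono
      (by simp only [Cmd.cost, Cond.cost]; omega) (fun _ _ h => h)
    · simpa [RAM.Test.Holds, ea, eb, Cond.Holds] using ht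
    · simpa [RAM.Test.Holds, ea, eb, Cond.Holds] using ht

theorem correct_loop {M : Lim} (hM : M.Good) (i : Var) (lo hi : Ex) {body : Cmd}
    (hbody : Correct M body) : Correct M (.loop i lo hi body) := by
  intro s t R hb hs hR h0
  have hsl := hs
  obtain ⟨hlo, hhi, hs⟩ := hs
  simp only [Cmd.OnlyInp, Bool.and_eq_true] at h0
  have hhv := hi.eval_le hb hhi
  have hM1 : 1 ≤ M.W := le_trans (by decide) hM.stride
  rw [Cmd.run_loop]
  have hbd : ∀ k ≤ hi.eval s - lo.eval s, (body.iter i (lo.eval s) s k).Bdd M.W := by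
    intro k hk
    have hlv := lo.eval_le hb hlo
    have := Cmd.bdd_run (.loop i (.lit (lo.eval s)) (.lit (lo.eval s + k)) body) hb
      (M := M) ⟨hlv, by simp only [Ex.Safe]; omega,
        fun j hj => hs j (by simp only [Ex.eval] at hj; omega)⟩
    rw [Cmd.run_loop] at this
    simpa only [Ex.eval, Nat.add_sub_cancel_left] using this
  generalize hl : lo.eval s = l at *
  generalize hh : hi.eval s = h at *
  set w : Prog := .while (.lt (tmp t) (tmp (t + 1))) <|
        .seq (move (vreg i) (tmp t) (tmp (t + 2))) <| .seq (body.compile (t + 2)) <|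
        .seq (.instr (.const (tmp (t + 2)) 1))
          (.instr (.arith .plus (tmp t) (tmp t) (tmp (t + 2)))) with hw
  -- Induction on the number `m` of rounds still to run, from the state before round `k`.
  have key : ∀ m k, k + m = h - l → ∀ R', Post M t R (body.iter i l s k) R' →
      R'.reg (tmp t) = l + k → R'.reg (tmp (t + 1)) = h →
      Runs M.Sp M.W w R' (1 + ∑ k' ∈ Finset.range m, (5 + body.cost
          ((body.iter i l s (k + k')).setV i (l + (k + k')))))
        fun o R'' => (body.iter i l s (h - l)).out = (body.iter i l s k).out ++ o ∧
          Post M t R (body.iter i l s (h - l)) R'' := by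
    intro m
    induction m with
    | zero =>
      intro k hk R' hP e1 e2
      obtain rfl : k = h - l := by omega
      exact Runs.mono (Runs.whileFalse (by simp [RAM.Test.Holds, e1, e2]; omega)
        (Q := fun o R'' => o = [] ∧ R'' = R') ⟨rfl, rfl⟩) (by simp)
        fun o R'' h => by rw [h.1, h.2]; exact ⟨by simp, hP⟩
    | succ m ih =>
      intro k hk R' hP e1 e2
      rw [Finset.sum_range_succ']
      refine Runs.mono (k := 1 + (2 + (body.cost ((body.iter i l s k).setV i (l + k)) + (1 + 1))) +
        _) (Runs.whileTrue (P := fun o R'' => (body.iter i l s (k + 1)).out =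
          (body.iter i l s k).out ++ o ∧ Post M t R (body.iter i l s (k + 1)) R'' ∧
          R''.reg (tmp t) = l + (k + 1) ∧ R''.reg (tmp (t + 1)) = h)
          (by simp only [RAM.Test.Holds, e1, e2]; omega) ?_
          fun o R'' h3 => (ih (k + 1) (by omega) R'' h3.2.1 h3.2.2.1 h3.2.2.2).mono le_rfl
            fun o' R3 h4 => ⟨by rw [h4.1, h3.1, List.append_assoc], h4.2⟩) ?_ fun _ _ h => h
      · refine Runs.seq_silent (runs_move hP.sim (by rw [e1]; omega) (by omega)) fun R1 hP1 => ?_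
        rw [e1] at hP1
        refine Runs.seq (hbody _ (t + 2) R1 ((hbd k (by omega)).setV i (by omega))
          (hs k (by omega)) hP1.sim (by rw [hP1.zero, hP.zero]; exact h0.imp_right fun h => h.2))
          fun o R2 h2 => ?_
        obtain ⟨ho, hP2⟩ := h2
        have hP3 := (hP.trans hP1 (by omega)).trans hP2 (by omega)
        have e3 : R2.reg (tmp t) = l + k := by
          rw [hP2.tmp t (by omega), hP1.tmp t (by omega), e1]
        have e4 : R2.reg (tmp (t + 1)) = h := by
          rw [hP2.tmp (t + 1) (by omega), hP1.tmp (t + 1) (by omega), e2]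
        have n1 : tmp t ≠ tmp (t + 2) := by rw [Ne, tmp_inj]; omega
        have n2 : tmp (t + 1) ≠ tmp (t + 2) := by rw [Ne, tmp_inj]; omega
        have n3 : tmp (t + 1) ≠ tmp t := by rw [Ne, tmp_inj]; omega
        refine Runs.const_seq hM1 (Runs.arith ?_ ⟨?_, ?_, ?_, ?_⟩)
        · simp [RAM.ArithOp.eval, n1, e3]; omega
        · rw [List.append_nil]; exact ho
        · exact hP3.trans ((((Agree.update (by omega) 1 : Agree t R2 _)).trans
            (Agree.update le_rfl _) le_rfl).post hP2.sim) le_rfl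
        · simp [RAM.ArithOp.eval, n1, e3, add_assoc]
        · simp [n2, n3, e4]
      · have : ∀ x, k + 1 + x = k + (x + 1) := fun x => by omega
        simp only [this, add_zero]
        omega
  refine Runs.mono (Runs.seq_silent (runs_ex hM hb lo hlo t hR (h0.imp_right fun h => h.1.1))
    fun R1 h1 => Runs.seq_silent (runs_ex hM hb hi hhi (t + 1) (h1.1.sim hR)
      (by rw [h1.1.zero]; exact h0.imp_right fun h => h.1.2)) fun R2 h2 =>
    key (h - l) 0 (by omega) R2 ((h1.1.trans h2.1 (Nat.le_succ t)).post hR)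
      (by rw [h2.1.reg_tmp (Nat.lt_succ_self t), h1.2, hl, add_zero]) (by rw [h2.2, hh]))
    ?_ fun _ _ h => h
  simp only [Cmd.cost, hl, hh, zero_add]
  omega

/-- After this the machine can be forgotten: bounds on cost, words and addresses are proved for
commands only. -/
theorem correct {M : Lim} (hM : M.Good) (c : Cmd) : Correct M c := by
  induction c with
  | skip =>
    intro s t R hb hs hR h0
    exact ⟨[], R, .skip R, by simp, by simp [RAM.UsesSpace],
      by simp [RAM.WordsAtMost], by simp [Cmd.run, RAM.output], hR, rfl, fun _ _ => rfl⟩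
  | set x e => exact correct_set hM x e
  | put a i e => exact correct_put hM a i e
  | emit e => exact correct_emit hM e
  | endSet =>
    intro s t R hb hs hR h0
    exact Runs.instr (by simp [RAM.UsesSpace, Instr.event])
      (by simp [RAM.WordsAtMost, Instr.event]) ⟨rfl, hR.addOut _, rfl, fun _ _ => rfl⟩
  | seq p q hp hq =>
    intro s t R hb hs hR h0
    simp only [Cmd.OnlyInp, Bool.and_eq_true] at h0
    refine Runs.seq (hp s t R hb hs.1 hR (h0.imp_right And.left)) fun o R' h =>
      (hq (p.run s) t R' (p.bdd_run hb hs.1) hs.2 h.2.sim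
        (by rw [h.2.zero]; exact h0.imp_right And.right)).mono le_rfl fun o' R'' h' =>
        ⟨by rw [Cmd.run, h'.1, h.1, List.append_assoc], h.2.trans h'.2 le_rfl⟩
  | ite c p q hp hq => exact correct_ite hM c hp hq
  | loop i lo hi body hb => exact correct_loop hM i lo hi hb

end Loop

/-! ## The tree of maximal independent sets of initial segments -/

namespace Mis

open Classical in
section
variable (adj : ℕ → ℕ → Prop)

/-- `S` is a maximal independent set of the graph induced on `0, …, i - 1`. -/
structure IsMis (i : ℕ) (S : Finset ℕ) : Prop where
  lt : ∀ u ∈ S, u < i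
  indep : ∀ u ∈ S, ∀ w ∈ S, ¬ adj u w
  max : ∀ u < i, u ∉ S → ∃ w ∈ S, adj u w

/-- `i` has no neighbour in `S`. -/
def Free (S : Finset ℕ) (i : ℕ) : Prop := ∀ w ∈ S, ¬ adj i w

/-- `S` without the neighbours of `i`. -/
noncomputable def drop (S : Finset ℕ) (i : ℕ) : Finset ℕ := S.filter fun w => ¬ adj i w

/-- Every vertex dominated by `S`, but not without the neighbours of `i`, is a neighbour of `i`
and has a smaller neighbour in `S`. -/
def Valid (S : Finset ℕ) (i : ℕ) : Prop :=
  ∀ u < i, (∀ w ∈ S, adj u w → adj i w) → (∃ w ∈ S, adj u w) →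
    adj i u ∧ ∃ w ∈ S, adj u w ∧ w < u

/-- The children of `S` in the tree. -/
noncomputable def kids (i : ℕ) (S : Finset ℕ) : List (Finset ℕ) :=
  if Free adj S i then [insert i S]
  else S :: if Valid adj S i then [insert i (drop adj S i)] else []

/-- The descendants of `S` at distance `m`, in depth-first order. -/
noncomputable def leaves : ℕ → ℕ → Finset ℕ → List (Finset ℕ)
  | 0, _, S => [S]
  | m + 1, i, S => (kids adj i S).flatMap (leaves m (i + 1))

end

open Classical

variable {adj : ℕ → ℕ → Prop} (hsymm : ∀ u w, adj u w → adj w u) (hirr : ∀ u, ¬ adj u u)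
include hsymm hirr

/-- Only the maximality of the second child is in doubt. A vertex not adjacent to `i` whose
neighbours in `S` were all dropped would contradict the first half of `Valid`. -/
theorem kids_isMis {i : ℕ} {S T : Finset ℕ} (hS : IsMis adj i S) (hT : T ∈ kids adj i S) :
    IsMis adj (i + 1) T := by
  unfold kids at hT
  split at hT
  · next hf =>
    rw [List.mem_singleton] at hT
    subst hT
    refine ⟨?_, ?_, ?_⟩
    · intro u hu
      rcases Finset.mem_insert.1 hu with rfl | hu
      · omega
      · have := hS.lt u hu; omega
    · intro u hu w hw
      rcases Finset.mem_insert.1 hu with rfl | hu' <;> rcases Finset.mem_insert.1 hw with rfl | hw'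
      · exact hirr _
      · exact hf w hw'
      · exact fun h => hf u hu' (hsymm _ _ h)
      · exact hS.indep u hu' w hw'
    · intro u hu hn
      rw [Finset.mem_insert, not_or] at hn
      obtain ⟨w, hw, h⟩ := hS.max u (by omega) hn.2
      exact ⟨w, Finset.mem_insert_of_mem hw, h⟩
  · next hf =>
    rw [List.mem_cons] at hT
    rcases hT with rfl | hT
    · refine ⟨fun u hu => (hS.lt u hu).trans (Nat.lt_succ_self i), hS.indep, fun u hu hn => ?_⟩
      rcases Nat.lt_succ_iff_lt_or_eq.1 hu with h | rfl
      · exact hS.max u h hn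
      · simpa [Free] using hf
    · split at hT
      · next hv =>
        rw [List.mem_singleton] at hT
        subst hT
        refine ⟨?_, ?_, ?_⟩
        · intro u hu
          rcases Finset.mem_insert.1 hu with rfl | hu
          · omega
          · have := hS.lt u (Finset.mem_filter.1 hu).1; omega
        · intro u hu w hw
          rcases Finset.mem_insert.1 hu with rfl | hu <;>
            rcases Finset.mem_insert.1 hw with rfl | hw
          · exact hirr _
          · exact (Finset.mem_filter.1 hw).2
          · exact fun h => (Finset.mem_filter.1 hu).2 (hsymm _ _ h)
          · exact hS.indep u (Finset.mem_filter.1 hu).1 w (Finset.mem_filter.1 hw).1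
        · intro u hu hn
          rw [Finset.mem_insert, not_or] at hn
          by_cases hiu : adj i u
          · exact ⟨i, Finset.mem_insert_self _ _, hsymm _ _ hiu⟩
          have huS : u ∉ S := fun h => hn.2 (Finset.mem_filter.2 ⟨h, hiu⟩)
          have hui : u < i := by omega
          by_contra hcon
          refine hiu (hv u hui (fun w hw huw => ?_) (hS.max u hui huS)).1
          by_contra hiw
          exact hcon ⟨w, Finset.mem_insert_of_mem (Finset.mem_filter.2 ⟨hw, hiw⟩), huw⟩
      · simp at hT

/-- `S` is the greedy completion of `R` to a maximal independent set. -/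
structure Greedy (adj : ℕ → ℕ → Prop) (i : ℕ) (R S : Finset ℕ) : Prop where
  mis : IsMis adj i S
  sub : R ⊆ S
  first : ∀ u < i, u ∉ S → Free adj R u → ∃ w ∈ S, adj u w ∧ w < u

omit hsymm hirr in
-- Membership of `u` is determined by the smaller vertices. If `u` were in `S` but not in `S'`, then
-- it would be free of `R ⊆ S`, hence have a smaller neighbour in `S'`; by induction this neighbour
-- lies in `S`, against independence.
theorem Greedy.subset {i : ℕ} {R S S' : Finset ℕ} (h : Greedy adj i R S)
    (h' : Greedy adj i R S') (u : ℕ) : u ∈ S ↔ u ∈ S' := by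
  induction u using Nat.strong_induction_on with
  | _ u ih =>
    by_cases hu : u < i
    · have key : ∀ {S S' : Finset ℕ}, Greedy adj i R S → Greedy adj i R S' →
          (∀ w < u, w ∈ S ↔ w ∈ S') → u ∈ S → u ∈ S' := by
        intro S S' h h' ih hS
        by_contra hS'
        obtain ⟨w, hw, huw, hlt⟩ := h'.first u hu hS' fun w hw => h.mis.indep u hS w (h.sub hw)
        exact h.mis.indep u hS w ((ih w hlt).2 hw) huw
      exact ⟨key h h' ih, key h' h fun w hw => (ih w hw).symm⟩
    · exact ⟨fun h1 => absurd (h.mis.lt u h1) hu, fun h1 => absurd (h'.mis.lt u h1) hu⟩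

omit hsymm hirr in
theorem Greedy.unique {i : ℕ} {R S S' : Finset ℕ} (h : Greedy adj i R S)
    (h' : Greedy adj i R S') : S = S' := Finset.ext fun u => h.subset h' u

theorem Greedy.exists {i : ℕ} {R : Finset ℕ} (hR : ∀ u ∈ R, u < i)
    (hind : ∀ u ∈ R, ∀ w ∈ R, ¬ adj u w) : ∃ S, Greedy adj i R S := by
  -- The vertices are offered to `R` in increasing order, and those below `j` have been considered.
  -- A rejected vertex that is free of `R` was blocked by a vertex added before it, which is
  -- therefore smaller.
  have key : ∀ j ≤ i, ∃ S, R ⊆ S ∧ (∀ u ∈ S, u < i) ∧ (∀ u ∈ S, ∀ w ∈ S, ¬ adj u w) ∧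
      (∀ u ∈ S, u ∉ R → u < j) ∧ (∀ u < j, u ∉ S → ∃ w ∈ S, adj u w) ∧
      ∀ u < j, u ∉ S → Free adj R u → ∃ w ∈ S, adj u w ∧ w < u := by
    intro j hj
    induction j with
    | zero => exact ⟨R, Finset.Subset.refl _, hR, hind, by simp, by simp, by simp⟩
    | succ j ih =>
      obtain ⟨S, h1, h2, h3, h4, h5, h6⟩ := ih (by omega)
      by_cases hf : Free adj S j
      · refine ⟨insert j S, h1.trans (Finset.subset_insert _ _), ?_, ?_, ?_, ?_, ?_⟩
        · intro u hu
          rcases Finset.mem_insert.1 hu with rfl | hu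
          · omega
          · exact h2 u hu
        · intro u hu w hw
          rcases Finset.mem_insert.1 hu with rfl | hu' <;>
            rcases Finset.mem_insert.1 hw with rfl | hw'
          · exact hirr _
          · exact hf w hw'
          · exact fun h => hf u hu' (hsymm _ _ h)
          · exact h3 u hu' w hw'
        · intro u hu huR
          rcases Finset.mem_insert.1 hu with rfl | hu
          · omega
          · have := h4 u hu huR; omega
        · intro u hu hn
          rw [Finset.mem_insert, not_or] at hn
          obtain ⟨w, hw, h⟩ := h5 u (by omega) hn.2
          exact ⟨w, Finset.mem_insert_of_mem hw, h⟩
        · intro u hu hn hfr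
          rw [Finset.mem_insert, not_or] at hn
          obtain ⟨w, hw, h⟩ := h6 u (by omega) hn.2 hfr
          exact ⟨w, Finset.mem_insert_of_mem hw, h⟩
      · obtain ⟨w, hw, hjw⟩ : ∃ w ∈ S, adj j w := by simpa [Free] using hf
        refine ⟨S, h1, h2, h3, fun u hu huR => ?_, fun u hu hn => ?_, fun u hu hn hfr => ?_⟩
        · have := h4 u hu huR; omega
        · rcases Nat.lt_succ_iff_lt_or_eq.1 hu with h | rfl
          · exact h5 u h hn
          · exact ⟨w, hw, hjw⟩
        · rcases Nat.lt_succ_iff_lt_or_eq.1 hu with h | rfl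
          · exact h6 u h hn hfr
          · exact ⟨w, hw, hjw, h4 w hw fun hwR => hfr w hwR hjw⟩
  obtain ⟨S, h1, h2, h3, -, h5, h6⟩ := key i le_rfl
  exact ⟨S, ⟨h2, h3, h5⟩, h1, h6⟩

omit hirr in
-- A member of `S` outside `T` and not adjacent to `i` would, by maximality of `T`, have a neighbour
-- in `T` other than `i`; this neighbour also lies in `S`, which is independent.
theorem Greedy.eq_insert_drop {i : ℕ} {S T : Finset ℕ} (hT : IsMis adj (i + 1) T) (hiT : i ∈ T)
    (h : Greedy adj i (T.erase i) S) : T = insert i (drop adj S i) := by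
  refine Finset.ext fun u => ?_
  rw [Finset.mem_insert, drop, Finset.mem_filter]
  constructor
  · intro hu
    by_cases hui : u = i
    · exact Or.inl hui
    · exact Or.inr ⟨h.sub (Finset.mem_erase.2 ⟨hui, hu⟩), hT.indep i hiT u hu⟩
  · rintro (rfl | ⟨hu, hiu⟩)
    · exact hiT
    · by_contra hn
      obtain ⟨w, hw, huw⟩ := hT.max u ((h.mis.lt u hu).trans (Nat.lt_succ_self _)) hn
      by_cases hwi : w = i
      · subst hwi
        exact hiu (hsymm _ _ huw)
      · exact h.mis.indep u hu w (h.sub (Finset.mem_erase.2 ⟨hwi, hw⟩)) huw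

omit hirr in
-- The right-hand side recognises the parent from `T` alone: given `i ∈ T` it is the greedy
-- completion, of which there is exactly one. The second half of `Valid` is the greedy condition for
-- `S` over `drop adj S i`.
theorem mem_kids_iff {i : ℕ} {S T : Finset ℕ} (hS : IsMis adj i S) (hT : IsMis adj (i + 1) T) :
    T ∈ kids adj i S ↔ if i ∈ T then Greedy adj i (T.erase i) S else T = S := by
  have hiS : i ∉ S := fun h => lt_irrefl _ (hS.lt i h)
  have hid : i ∉ drop adj S i := fun h => hiS (Finset.mem_filter.1 h).1
  unfold kids
  by_cases hiT : i ∈ T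
  · rw [if_pos hiT]
    by_cases hf : Free adj S i
    · have hdrop : drop adj S i = S := Finset.filter_true_of_mem hf
      rw [if_pos hf, List.mem_singleton]
      constructor
      · rintro rfl
        rw [Finset.erase_insert hiS]
        refine ⟨hS, Finset.Subset.refl _, fun u hu hn hfr => ?_⟩
        obtain ⟨w, hw, h⟩ := hS.max u hu hn
        exact absurd h (hfr w hw)
      · intro h
        rw [h.eq_insert_drop hsymm hT hiT, hdrop]
    · rw [if_neg hf, List.mem_cons]
      constructor
      · rintro (rfl | h)
        · exact absurd hiT hiS
        split at h
        · next hv =>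
          rw [List.mem_singleton] at h
          subst h
          rw [Finset.erase_insert hid]
          refine ⟨hS, Finset.filter_subset _ _, fun u hu hn hfr => ?_⟩
          refine (hv u hu (fun w hw huw => ?_) (hS.max u hu hn)).2
          by_contra hiw
          exact hfr w (Finset.mem_filter.2 ⟨hw, hiw⟩) huw
        · simp at h
      · intro h
        have hR : ∀ w ∈ T.erase i, ¬ adj i w := fun w hw =>
          hT.indep i hiT w (Finset.mem_erase.1 hw).2
        -- A vertex dominated by `S` only through neighbours of `i` is not dominated by `T` without
        -- `i`; since `T` is maximal, it is adjacent to `i` itself.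
        have hv : Valid adj S i := by
          rintro u hu h1 ⟨w, hw, huw⟩
          have huS : u ∉ S := fun hu' => hS.indep u hu' w hw huw
          refine ⟨?_, h.first u hu huS fun x hx hux => hR x hx (h1 x (h.sub hx) hux)⟩
          have huT : u ∉ T := fun hu' => huS (h.sub (Finset.mem_erase.2 ⟨hu.ne, hu'⟩))
          obtain ⟨x, hx, hux⟩ := hT.max u (hu.trans (Nat.lt_succ_self _)) huT
          by_cases hxi : x = i
          · subst hxi; exact hsymm _ _ hux
          · have hx' := Finset.mem_erase.2 ⟨hxi, hx⟩
            exact absurd (h1 x (h.sub hx') hux) (hR x hx')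
        rw [if_pos hv, List.mem_singleton]
        exact Or.inr (h.eq_insert_drop hsymm hT hiT)
  · rw [if_neg hiT]
    have hne : ∀ R : Finset ℕ, T ≠ insert i R := fun R h => hiT (h ▸ Finset.mem_insert_self i R)
    by_cases hf : Free adj S i
    · rw [if_pos hf, List.mem_singleton]
      refine ⟨fun h => absurd h (hne _), ?_⟩
      rintro rfl
      obtain ⟨w, hw, h⟩ := hT.max i (Nat.lt_succ_self i) hiT
      exact absurd h (hf w hw)
    · rw [if_neg hf, List.mem_cons]
      refine ⟨?_, Or.inl⟩
      rintro (h | h)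
      · exact h
      · split at h
        · exact absurd (List.mem_singleton.1 h) (hne _)
        · simp at h

theorem exists_parent {i : ℕ} {T : Finset ℕ} (hT : IsMis adj (i + 1) T) :
    ∃ S, IsMis adj i S ∧ T ∈ kids adj i S := by
  by_cases hiT : i ∈ T
  · obtain ⟨S, hS⟩ := Greedy.exists (i := i) (R := T.erase i) hsymm hirr
      (fun u hu => by
        have h1 := hT.lt u (Finset.mem_erase.1 hu).2
        have h2 := (Finset.mem_erase.1 hu).1
        omega)
      fun u hu w hw => hT.indep u (Finset.mem_erase.1 hu).2 w (Finset.mem_erase.1 hw).2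
    exact ⟨S, hS.mis, (mem_kids_iff hsymm hS.mis hT).2 (by rwa [if_pos hiT])⟩
  · have hT' : IsMis adj i T := by
      refine ⟨fun u hu => ?_, hT.indep, fun u hu => hT.max u (hu.trans (Nat.lt_succ_self _))⟩
      have h1 := hT.lt u hu
      have h2 : u ≠ i := fun h => hiT (h ▸ hu)
      omega
    exact ⟨T, hT', (mem_kids_iff hsymm hT' hT).2 (by rw [if_neg hiT])⟩

omit hirr in
theorem kids_disjoint {i : ℕ} {S S' T : Finset ℕ} (hS : IsMis adj i S) (hS' : IsMis adj i S')
    (hT : IsMis adj (i + 1) T) (h : T ∈ kids adj i S) (h' : T ∈ kids adj i S') : S = S' := by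
  rw [mem_kids_iff hsymm hS hT] at h
  rw [mem_kids_iff hsymm hS' hT] at h'
  split at h
  · next hi => rw [if_pos hi] at h'; exact h.unique h'
  · next hi => rw [if_neg hi] at h'; exact h.symm.trans h'

omit hsymm hirr in
theorem kids_nodup {i : ℕ} {S : Finset ℕ} (hS : IsMis adj i S) : (kids adj i S).Nodup := by
  have hiS : i ∉ S := fun h => lt_irrefl _ (hS.lt i h)
  unfold kids
  split
  · simp
  · split
    · simp only [List.nodup_cons, List.mem_singleton, List.not_mem_nil, not_false_iff,
        List.nodup_nil, and_true]
      exact fun h => hiS (h ▸ Finset.mem_insert_self i _)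
    · simp

/-- `l` lists the maximal independent sets of the graph induced on `0, …, i - 1`. -/
def Lists (adj : ℕ → ℕ → Prop) (i : ℕ) (l : List (Finset ℕ)) : Prop :=
  l.Nodup ∧ ∀ S, S ∈ l ↔ IsMis adj i S

/-- Uniqueness of the parent keeps the lists of children disjoint; its existence makes them cover
the next level. -/
theorem Lists.flatMap_kids {i : ℕ} {l : List (Finset ℕ)} (hl : Lists adj i l) :
    Lists adj (i + 1) (l.flatMap (kids adj i)) := by
  refine ⟨List.nodup_flatMap.2 ⟨fun S hS => kids_nodup ((hl.2 S).1 hS), ?_⟩, fun T => ?_⟩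
  · refine List.Pairwise.imp_of_mem ?_ hl.1
    intro S S' hS hS' hne T h h'
    exact hne (kids_disjoint hsymm ((hl.2 S).1 hS) ((hl.2 S').1 hS')
      (kids_isMis hsymm hirr ((hl.2 S).1 hS) h) h h')
  · rw [List.mem_flatMap]
    constructor
    · rintro ⟨S, hS, h⟩
      exact kids_isMis hsymm hirr ((hl.2 S).1 hS) h
    · intro hT
      obtain ⟨S, hS, h⟩ := exists_parent hsymm hirr hT
      exact ⟨S, (hl.2 S).2 hS, h⟩

theorem Lists.flatMap_leaves {i : ℕ} {l : List (Finset ℕ)} (hl : Lists adj i l) (m : ℕ) :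
    Lists adj (i + m) (l.flatMap (leaves adj m i)) := by
  induction m generalizing i l with
  | zero => simpa [leaves] using hl
  | succ m ih =>
    have := ih (hl.flatMap_kids hsymm hirr)
    rw [List.flatMap_assoc] at this
    rwa [add_assoc, add_comm 1 m] at this

theorem lists_leaves (n : ℕ) : Lists adj n (leaves adj n 0 ∅) := by
  have h0 : Lists adj 0 [∅] := by
    refine ⟨by simp, fun S => ?_⟩
    rw [List.mem_singleton]
    constructor
    · rintro rfl
      exact ⟨by simp, by simp, by simp⟩
    · exact fun h => Finset.eq_empty_of_forall_notMem fun u hu => by simpa using h.lt u hu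
  simpa using h0.flatMap_leaves hsymm hirr n

/-! ### Traversal -/

omit hsymm hirr

/-- The first child of `S`. -/
noncomputable def first (adj : ℕ → ℕ → Prop) (S : Finset ℕ) (i : ℕ) : Finset ℕ :=
  if Free adj S i then insert i S else S

/-- `P` is the path of the tree from the root to level `l`. -/
structure IsPath (adj : ℕ → ℕ → Prop) (l : ℕ) (P : ℕ → Finset ℕ) : Prop where
  zero : P 0 = ∅
  succ : ∀ i < l, P (i + 1) ∈ kids adj i (P i)

/-- The leaves below the second child of `P i`, provided that `P` continues with the first. -/
noncomputable def pend (adj : ℕ → ℕ → Prop) (n : ℕ) (P : ℕ → Finset ℕ) (i : ℕ) :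
    List (Finset ℕ) :=
  if i ∉ P (i + 1) ∧ Valid adj (P i) i then
    leaves adj (n - (i + 1)) (i + 1) (insert i (drop adj (P i) i)) else []

/-- The leaves still to be visited after the path `P` up to level `l`. -/
noncomputable def todo (adj : ℕ → ℕ → Prop) (n : ℕ) (P : ℕ → Finset ℕ) : ℕ → List (Finset ℕ)
  | 0 => []
  | i + 1 => pend adj n P i ++ todo adj n P i

theorem todo_congr {n l : ℕ} {P P' : ℕ → Finset ℕ} (h : ∀ i ≤ l, P i = P' i) :
    todo adj n P l = todo adj n P' l := by
  induction l with
  | zero => rfl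
  | succ l ih =>
    rw [todo, todo, ih fun i hi => h i (by omega), pend, pend, h l (by omega), h (l + 1) le_rfl]

section
include hsymm hirr

theorem IsPath.isMis {l : ℕ} {P : ℕ → Finset ℕ} (hP : IsPath adj l P) {i : ℕ} (hi : i ≤ l) :
    IsMis adj i (P i) := by
  induction i with
  | zero => rw [hP.zero]; exact ⟨by simp, by simp, by simp⟩
  | succ i ih => exact kids_isMis hsymm hirr (ih (by omega)) (hP.succ i (by omega))

/-- The leaves below the node at level `l`, then those still to be visited, in terms of the first
child. -/
theorem leaves_append_todo {n l : ℕ} {P : ℕ → Finset ℕ} (hl : l < n)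
    (hP : IsPath adj l P) (h1 : P (l + 1) = first adj (P l) l) :
    leaves adj (n - l) l (P l) ++ todo adj n P l =
      leaves adj (n - (l + 1)) (l + 1) (P (l + 1)) ++ todo adj n P (l + 1) := by
  have hiS : l ∉ P l := fun h => lt_irrefl _ ((hP.isMis hsymm hirr le_rfl).lt l h)
  obtain ⟨m, hm⟩ : ∃ m, n - l = m + 1 := ⟨n - l - 1, by omega⟩
  have hm' : n - (l + 1) = m := by omega
  rw [hm, leaves, todo, pend, hm', h1, first, kids]
  by_cases hf : Free adj (P l) l
  · simp [hf]
  · by_cases hv : Valid adj (P l) l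
    · simp [hf, hv, hiS]
    · simp [hf, hv]

end

theorem first_mem_kids (S : Finset ℕ) (i : ℕ) : first adj S i ∈ kids adj i S := by
  unfold first kids
  split <;> simp

end Mis

/-! ## The program -/

namespace Loop

section Program
open Var

/-- Runs `body` with `u` going through the first `len` entries of the adjacency list of `w`,
`x` being the position of the entry. -/
def each (x u : Var) (w len : Ex) (body : Cmd) : Cmd :=
  .loop x (.get .ST w) (.get .ST w + len) (.set u (.get .NB x) ;; body)

/-- Runs `body` with `v`, `w` going through the arcs, `e` being the position in the input. -/
def edges (pre body : Cmd) : Cmd :=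
  .set p 1 ;; .loop v 0 n (.set d (.get .inp p) ;; pre ;;
    .loop e (p + 1) (p + (d + 1)) (.set w (.get .inp e) ;; body) ;; .set p (p + (d + 1)))

/-- Adds the vertex `fw` to the current set if `f = 1`, and removes it if `f = 0`. -/
def flip : Cmd :=
  each fx fu fw (.get .LN fw)
    -- The neighbour leaves the table before the change and enters it again afterwards. Only
    -- vertices with `DEF = 0` are in the table, and for these alone the truncated `1 - DEF` equals
    -- one.
    (.put .T (.get .CODE fu) (.get .T (.get .CODE fu) - (1 - .get .DEF fu)) ;;
      .set g (.get .WT fx) ;;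
      -- Case distinctions as arithmetic: weight zero changes `DEF`, positive weight changes `CODE`,
      -- with the sign given by `f`.
      .put .DEF fu (.get .DEF fu + f * (1 - g) - (1 - f) * (1 - g)) ;;
      .put .CODE fu (.get .CODE fu + f * g - (1 - f) * g) ;;
      -- The truncated expression `1 - (fw + 1 - fu)` is one exactly when `fw < fu`.
      .put .LOW fu (.get .LOW fu + f * (1 - (fw + 1 - fu)) - (1 - f) * (1 - (fw + 1 - fu))) ;;
      .put .T (.get .CODE fu) (.get .T (.get .CODE fu) + (1 - .get .DEF fu))) ;;
  .put .INS fw f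

/-- A vertex not yet reached carries an extra one in `DEF`. This keeps it out of the table and lets
it fail the test in `okCmd`. -/
def activate : Cmd :=
  .put .DEF i (.get .DEF i - 1) ;;
  .put .T (.get .CODE i) (.get .T (.get .CODE i) + (1 - .get .DEF i))

def deactivate : Cmd :=
  .put .T (.get .CODE i) (.get .T (.get .CODE i) - (1 - .get .DEF i)) ;;
  .put .DEF i (.get .DEF i + 1)

/-- Whether all neighbours of `ow` in the current set are marked. -/
def okCmd : Cmd :=
  .set okf 1 ;;
  -- `DC` counts the marked neighbours of weight zero in the set. Equality means that all of them
  -- are marked and that `ow` is active; only the out-neighbours remain, to find unmarked heavy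
  -- ones.
  .ite (.eq (.get .DC ow) (.get .DEF ow))
    (each x3 z ow (.get .OD ow) <|
      .ite (.eq (.get .INS z) 0) .skip <| .ite (.eq (.get .IX z) 0) .skip <|
      .ite (.eq (.get .MK z) 0) (.set okf 0) .skip)
    (.set okf 0)

/-- Besides marking the neighbours of `i`, this collects in `QA` the indices of the heavy ones in
the set. Entry `0` of `QA` stays zero and stands for an absent digit. -/
def markCmd : Cmd :=
  .set q 0 ;; each x1 w1 i (.get .LN i) (.put .MK w1 1 ;;
    .ite (.eq (.get .INS w1) 0) .skip (.ite (.eq (.get .IX w1) 0) .skip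
      (.set q (q + 1) ;; .put .QA q (.get .IX w1))))

def countCmd : Cmd :=
  each x1 w1 i (.get .LN i) (.ite (.eq (.get .INS w1) 1)
    (each x2 u2 w1 (.get .SL w1) (.put .DC u2 (.get .DC u2 + 1))) .skip)

def goodCmd : Cmd :=
  .set Y 0 ;; each x1 w1 i (.get .LN i) (.ite (.eq (.get .LOW w1) 0) .skip
    (.set ow w1 ;; okCmd ;; .set Y (Y + okf)))

/-- First class of lost vertices. Clearing `DC` upon the first visit ensures that a vertex reached
from several sides is counted once, and leaves the array clean. -/
def touchedCmd : Cmd :=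
  .set X 0 ;; each x1 w1 i (.get .LN i) (.ite (.eq (.get .INS w1) 1)
    (each x2 u2 w1 (.get .SL w1) (.ite (.eq (.get .DC u2) 0) .skip
      (.set ow u2 ;; okCmd ;; .set X (X + okf) ;; .put .DC u2 0))) .skip)

/-- Second class of lost vertices. The number `c` runs through the nonzero `K`-digit numerals in
base `q + 1`; replacing each digit by its entry in `QA` gives a code `s` in base `b`. -/
def tableCmd : Cmd :=
  .set pw 1 ;; .loop t 0 K (.set pw (pw * (q + 1))) ;;
  .loop c 1 pw (.set y c ;; .set s 0 ;; .set g 1 ;;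
    -- The argument of `QA` is `y` modulo `q + 1`, since the machine has no remainder instruction.
    .loop t 0 K (.set s (s + .get .QA (y - y / (q + 1) * (q + 1)) * g) ;;
      .set y (y / (q + 1)) ;; .set g (g * b)) ;;
    .set X (X + .get .T s))

def unmarkCmd : Cmd := each x1 w1 i (.get .LN i) (.put .MK w1 0)

/-- Afterwards `X = Y` if and only if the current node has a second child. -/
def testCmd : Cmd := markCmd ;; countCmd ;; goodCmd ;; touchedCmd ;; tableCmd ;; unmarkCmd

def forward : Cmd :=
  .loop i lvl n (activate ;; .ite (.lt 0 (.get .DEF i + .get .CODE i)) .skip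
    (.set fw i ;; .set f 1 ;; flip))

def emitCmd : Cmd := .loop v 0 n (.ite (.eq (.get .INS v) 1) (.emit v) .skip) ;; .endSet

/-- The vertices dropped when `i` was added are recognised by `REM = i + 1`; zero is reserved for
vertices not removed. -/
def undoCmd : Cmd :=
  .set fw i ;; .set f 0 ;; flip ;; .set f 1 ;;
  each x1 w1 i (.get .LN i) (.ite (.eq (.get .REM w1) (i + 1))
    (.set fw w1 ;; flip ;; .put .REM w1 0) .skip) ;;
  deactivate

/-- Loops cannot be left early, so rounds after `found` is set are idle. A level whose vertex is in
the set has no unvisited child, the child containing it being the last. -/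
def backward : Cmd :=
  .set found 0 ;; .loop a1 0 n (.ite (.eq found 1) .skip (.set i (n - 1 - a1) ;;
    .ite (.eq (.get .INS i) 1) undoCmd
      (deactivate ;; testCmd ;; .ite (.eq X Y) (.set found 1) .skip)))

def branch : Cmd :=
  .set f 0 ;; each x1 w1 i (.get .LN i) (.ite (.eq (.get .INS w1) 1)
    (.set fw w1 ;; flip ;; .put .REM w1 (i + 1)) .skip) ;;
  activate ;; .set fw i ;; .set f 1 ;; flip ;; .set lvl (i + 1)

/-- Completes the current set, writes it, and goes to the next branch of the tree. -/
def round : Cmd :=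
  forward ;; emitCmd ;; backward ;; .ite (.eq found 1) branch .skip ;; .set alive found

/-- The final value of `p` is the length of the input. Only `inp` is read, so register `0` is not
needed yet. -/
def prepare₀ : Cmd :=
  .set n (.get .inp 0) ;; .set p 1 ;; .set K 1 ;;
  .loop v 0 n (.set d (.get .inp p) ;; .ite (.lt K d) (.set K d) .skip ;; .set p (p + (d + 1)))

def degCmd : Cmd := edges (.put .OD v d) (.put .ID w (.get .ID w + 1))

/-- As `r ≤ r ^ K`, at most `n` increments are needed, and a loop of `n` rounds suffices. -/
def rootCmd : Cmd :=
  .set r 1 ;; .loop t 0 n (.set pw 1 ;; .loop e 0 K (.set pw (pw * r)) ;;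
    .ite (.lt pw n) (.set r (r + 1)) .skip)

def heavyCmd : Cmd :=
  .set b 1 ;; .loop w 0 n (.ite (.lt (.get .ID w * r) n) .skip
    (.put .IX w b ;; .set b (b + 1)))

def offsetCmd : Cmd :=
  .set acc 0 ;; .loop w 0 n (.put .ST w acc ;; .put .PS w acc ;;
    .put .LN w (.get .OD w + .get .ID w) ;;
    .ite (.eq (.get .IX w) 0) (.put .SL w (.get .LN w)) (.put .SL w (.get .OD w)) ;;
    .set acc (acc + .get .LN w))

/-- All out-neighbours are written before any in-neighbour, so they form a prefix of each list: the
one scanned in `okCmd` and, for a heavy vertex, the short list. -/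
def outsCmd : Cmd := edges .skip (.put .NB (.get .PS v) w ;; .put .PS v (.get .PS v + 1))

def insCmd : Cmd :=
  edges (.set g 1) (.put .NB (.get .PS w) v ;; .put .WT (.get .PS w) (.get .IX w * g) ;;
    .put .PS w (.get .PS w + 1) ;; .set g (g * b))

def initCmd : Cmd := .loop i 0 n (.put .DEF i 1) ;; .set alive 1

def prepare₁ : Cmd :=
  degCmd ;; rootCmd ;; heavyCmd ;; offsetCmd ;; outsCmd ;; insCmd ;; initCmd

open RAM (Prog) in
/-- The whole program; register `0` receives the length of the input. -/
def mainProg : Prog :=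
  .seq (prepare₀.compile 0) <| .seq (move 0 (vreg p) (tmp 0)) <| .seq (prepare₁.compile 0) <|
    .while (.lt (vreg zero) (vreg alive)) (round.compile 0)

end Program

/-! ### The graph data in memory -/

/-- An oriented graph given by lists of out-neighbours, together with the parameters of the
data structure: `K` bounds the out-degrees, and `ix w`, if not `0`, is the index of the heavy
vertex `w`; indices are less than `b`. -/
structure Dat : Type where
  n : ℕ
  K : ℕ
  b : ℕ
  O : ℕ → List ℕ
  ix : ℕ → ℕ

namespace Dat
variable (D : Dat)

def adj (u w : ℕ) : Prop := w ∈ D.O u ∨ u ∈ D.O w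

def ins (w : ℕ) : List ℕ := (List.range D.n).filter fun v => w ∈ D.O v

/-- The adjacency list of `w`. -/
def nb (w : ℕ) : List ℕ := D.O w ++ D.ins w

/-- The contribution of `w` to the code of its neighbour `u`. -/
def wt (w u : ℕ) : ℕ := if w ∈ D.O u then D.ix w * D.b ^ (D.O u).idxOf w else 0

/-- The number of neighbours `u` of `w` with `wt w u = 0`, which come first in `nb w`. -/
def sl (w : ℕ) : ℕ := if D.ix w = 0 then (D.nb w).length else (D.O w).length

/-- The start of the adjacency list of `w`. -/
def st (w : ℕ) : ℕ := ∑ w' ∈ Finset.range w, (D.nb w').length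

structure Good : Prop where
  lt : ∀ u, ∀ w ∈ D.O u, w < D.n ∧ u < D.n
  nodup : ∀ u, (D.O u).Nodup
  asymm : ∀ u, ∀ w ∈ D.O u, u ∉ D.O w
  len : ∀ u, (D.O u).length ≤ D.K
  ix_lt : ∀ w, D.ix w < D.b
  ix_inj : ∀ w w', D.ix w ≠ 0 → D.ix w = D.ix w' → w = w'
  K_pos : 1 ≤ D.K

end Dat

section DatLemmas
variable {D : Dat}

theorem Dat.adj_symm {u w : ℕ} (h : D.adj u w) : D.adj w u := Or.symm h

theorem Dat.Good.adj_irrefl (hD : D.Good) (u : ℕ) : ¬ D.adj u u := fun h =>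
  hD.asymm u u (h.elim id id) (h.elim id id)

theorem Dat.Good.adj_lt (hD : D.Good) {u w : ℕ} (h : D.adj u w) : u < D.n ∧ w < D.n := by
  rcases h with h | h
  · exact (hD.lt _ _ h).symm
  · exact hD.lt _ _ h

theorem Dat.Good.mem_nb (hD : D.Good) {u w : ℕ} : u ∈ D.nb w ↔ D.adj w u := by
  simp only [Dat.nb, Dat.ins, List.mem_append, List.mem_filter, List.mem_range, decide_eq_true_eq,
    Dat.adj]
  exact ⟨fun h => h.imp_right And.right, fun h => h.imp_right fun h => ⟨(hD.lt _ _ h).2, h⟩⟩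

theorem Dat.Good.nb_nodup (hD : D.Good) (w : ℕ) : (D.nb w).Nodup := by
  refine List.Nodup.append (hD.nodup w) (List.nodup_range.filter _) fun u h1 h2 => ?_
  simp only [Dat.ins, List.mem_filter, decide_eq_true_eq] at h2
  exact hD.asymm w u h1 h2.2

theorem Dat.Good.b_pos (hD : D.Good) : 0 < D.b := (Nat.zero_le _).trans_lt (hD.ix_lt 0)

theorem Dat.Good.nb_length_le (hD : D.Good) (w : ℕ) : (D.nb w).length ≤ D.n := by
  have h : (D.nb w).toFinset ⊆ Finset.range D.n := fun u hu => by
    rw [List.mem_toFinset, hD.mem_nb] at hu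
    exact Finset.mem_range.2 (hD.adj_lt hu).2
  have := Finset.card_le_card h
  rwa [List.toFinset_card_of_nodup (hD.nb_nodup w), Finset.card_range] at this

theorem Dat.Good.wt_eq_zero (hD : D.Good) {w u : ℕ} :
    D.wt w u = 0 ↔ w ∉ D.O u ∨ D.ix w = 0 := by
  have := pow_pos hD.b_pos ((D.O u).idxOf w)
  unfold Dat.wt
  split
  · next h => rw [mul_eq_zero, or_iff_left this.ne']; simp [h]
  · next h => simp [h]

/-- A light vertex has weight zero everywhere. A heavy one has nonzero weight exactly at its
in-neighbours, and these come last in its list. -/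
theorem Dat.Good.mem_take_sl (hD : D.Good) {w u : ℕ} :
    u ∈ (D.nb w).take (D.sl w) ↔ D.adj w u ∧ D.wt w u = 0 := by
  rw [hD.wt_eq_zero, ← hD.mem_nb, Dat.sl]
  split
  · next h => simp [h]
  · next h =>
    simp only [Dat.nb, List.take_left', h, or_false, List.mem_append]
    constructor
    · exact fun h => ⟨Or.inl h, hD.asymm _ _ h⟩
    · rintro ⟨h1 | h1, h2⟩
      · exact h1
      · simp only [Dat.ins, List.mem_filter, decide_eq_true_eq] at h1
        exact absurd h1.2 h2

theorem Dat.sl_le (w : ℕ) : D.sl w ≤ (D.nb w).length := by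
  unfold Dat.sl; split
  · exact le_rfl
  · simp [Dat.nb]

theorem Dat.st_add_lt {w t : ℕ} (hw : w < D.n) (ht : t < (D.nb w).length) :
    D.st w + t < D.st D.n := by
  have h1 : D.st (w + 1) ≤ D.st D.n := Finset.sum_le_sum_of_subset (Finset.range_subset_range.2 hw)
  have h2 : D.st (w + 1) = D.st w + (D.nb w).length := Finset.sum_range_succ _ _
  omega

end DatLemmas

/-- The memory holds the data `D`. -/
structure Static (D : Dat) (s : St) : Prop where
  vz : s.v .zero = 0
  vn : s.v .n = D.n
  vK : s.v .K = D.K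
  vb : s.v .b = D.b
  ST : ∀ w < D.n, s.a .ST w = D.st w
  LN : ∀ w < D.n, s.a .LN w = (D.nb w).length
  SL : ∀ w < D.n, s.a .SL w = D.sl w
  OD : ∀ w < D.n, s.a .OD w = (D.O w).length
  IX : ∀ w < D.n, s.a .IX w = D.ix w
  NB : ∀ w < D.n, ∀ t (h : t < (D.nb w).length), s.a .NB (D.st w + t) = (D.nb w)[t]
  WT : ∀ w < D.n, ∀ t (h : t < (D.nb w).length),
    s.a .WT (D.st w + t) = D.wt w (D.nb w)[t]

/-- The bounds leave room for the data `D`. -/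
structure Fits (M : Lim) (D : Dat) : Prop where
  n : D.n + 2 ≤ M.L
  st : D.st D.n ≤ M.L
  pow : D.b ^ D.K ≤ M.L
  W : 32 * M.L + 32 ≤ M.W

/-- `c` changes neither the static data nor the input. -/
def Cmd.keeps (c : Cmd) : Bool :=
  !(c.wv .zero || c.wv .n || c.wv .K || c.wv .b || c.wa .ST || c.wa .LN || c.wa .SL || c.wa .OD ||
    c.wa .IX || c.wa .NB || c.wa .WT)

theorem Static.frame {D : Dat} {c : Cmd} {s s' : St} (h : Static D s) (hF : Frame c s s')
    (hc : c.keeps = true) : Static D s' := by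
  simp only [Cmd.keeps, Bool.not_eq_true', Bool.or_eq_false_iff] at hc
  obtain ⟨⟨⟨⟨⟨⟨⟨⟨⟨⟨c1, c2⟩, c3⟩, c4⟩, c5⟩, c6⟩, c7⟩, c8⟩, c9⟩, c10⟩, c11⟩ := hc
  exact ⟨by rw [hF.v _ c1, h.vz], by rw [hF.v _ c2, h.vn], by rw [hF.v _ c3, h.vK],
    by rw [hF.v _ c4, h.vb], by rw [hF.a _ c5]; exact h.ST, by rw [hF.a _ c6]; exact h.LN,
    by rw [hF.a _ c7]; exact h.SL, by rw [hF.a _ c8]; exact h.OD, by rw [hF.a _ c9]; exact h.IX,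
    by rw [hF.a _ c10]; exact h.NB, by rw [hF.a _ c11]; exact h.WT⟩

/-- Straight-line changes outside the static data. -/
theorem Static.setV {D : Dat} {s : St} (h : Static D s) {x : Var} (k : ℕ)
    (hx : (Cmd.set x 0).keeps = true) : Static D (s.setV x k) :=
  h.frame (c := .set x (.lit k)) (Cmd.frame_run (.set x (.lit k)) s) hx

/-- The loop rule for adjacency lists, with an invariant indexed by the prefix already visited. The
cost of a round may depend on the entry, as needed for nested loops over the short lists of the
entries. -/
theorem wp_each {M : Lim} {D : Dat} (hF : Fits M D) {s : St} (hS : Static D s)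
    {x u : Var} {w len : Ex} {body : Cmd} {Q : ℕ → St → Prop} (w0 l0 : ℕ) (Inv : List ℕ → St → Prop)
    (kf : ℕ → ℕ) (hw : w.eval s = w0) (hl : len.eval s = l0) (hw0 : w0 < D.n)
    (hl0 : l0 ≤ (D.nb w0).length) (hws : w.Safe M s) (hls : len.Safe M s)
    (hkeep : (each x u w len body).keeps = true)
    (h0 : Inv [] s)
    (step : ∀ l y x0 s', (l ++ [y] <+: (D.nb w0).take l0) → y ∈ D.nb w0 → y < D.n → x0 < M.L →
      s.a .WT x0 = D.wt w0 y → Inv l s' → Frame (each x u w len body) s s' → Static D s' →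
      wp M body ((s'.setV x x0).setV u y) (fun k s'' => k ≤ kf y ∧ Inv (l ++ [y]) s''))
    (hD : D.Good)
    (hQ : ∀ k s', Frame (each x u w len body) s s' → Static D s' →
      k ≤ 2 * w.cost + len.cost + 14 + (((D.nb w0).take l0).map fun y => kf y + 15).sum →
      Inv ((D.nb w0).take l0) s' → Q k s') :
    wp M (each x u w len body) s Q := by
  have hST : (Ex.get .ST w).eval s = D.st w0 := by simp [hw, hS.ST w0 hw0]
  have hLn := hF.n
  have hLs := hF.st
  have hW := hF.W
  have hst : D.st w0 + (D.nb w0).length ≤ D.st D.n := by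
    have h1 : D.st (w0 + 1) ≤ D.st D.n :=
      Finset.sum_le_sum_of_subset (Finset.range_subset_range.2 hw0)
    have h2 : D.st (w0 + 1) = D.st w0 + (D.nb w0).length := Finset.sum_range_succ _ _
    omega
  have hsafe : (Ex.get .ST w).Safe M s := by
    simp only [safe_get, hw, hws, true_and, M.idx_of_ne (show Arr.ST ≠ .inp by decide)]; omega
  refine wp_loop (D.st w0) (D.st w0 + l0) (fun y s' => Inv ((D.nb w0).take (y - D.st w0)) s')
    (fun y => kf ((D.nb w0).getD (y - D.st w0) 0) + 10) hST (by rw [eval_add, hST, hl]) (by omega)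
    hsafe ?_ ?_ ?_ ?_
  · rw [safe_add, hST, hl]
    exact ⟨hsafe, hls, by omega⟩
  · simpa using h0
  · intro y s' h1 h2 hI hfr
    have hS' : Static D s' := hS.frame hfr hkeep
    obtain ⟨t, rfl⟩ := Nat.exists_eq_add_of_le h1
    have ht : t < l0 := by omega
    have ht' : t < (D.nb w0).length := by omega
    simp only [Nat.add_sub_cancel_left] at hI ⊢
    have hmem : (D.nb w0)[t] ∈ D.nb w0 := List.getElem_mem ht'
    have hlt := (hD.adj_lt (hD.mem_nb.1 hmem)).2
    rw [wp_seq, wp_set]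
    refine ⟨?_, ?_⟩
    · simp only [safe_get, safe_var, true_and, eval_var, St.setV_v_self,
        M.idx_of_ne (show Arr.NB ≠ .inp by decide)]
      omega
    · have e1 : (Ex.get .NB (.var x)).eval (s'.setV x (D.st w0 + t)) = (D.nb w0)[t] := by
        simp [hS'.NB w0 hw0 t ht']
      have e2 : (D.nb w0).take t ++ [(D.nb w0)[t]] = (D.nb w0).take (t + 1) := by
        rw [List.take_append_getElem]
      rw [e1]
      refine wp_mono (step _ _ _ s' ?_ hmem hlt (by omega) (hS.WT w0 hw0 t ht') hI hfr hS') ?_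
      · rw [e2]
        exact List.take_prefix_take_left (by omega)
      · rintro k s'' - ⟨hk, hI'⟩
        rw [e2] at hI'
        refine ⟨?_, ?_⟩
        · rw [List.getD_eq_getElem _ _ ht']
          simp only [cost_get, cost_var]; omega
        · rw [show D.st w0 + t + 1 - D.st w0 = t + 1 by omega]; exact hI'
  · intro k s' hfr hk hI
    have hS' : Static D s' := hS.frame hfr hkeep
    simp only [Nat.add_sub_cancel_left] at hI
    refine hQ k s' hfr hS' (hk.trans ?_) hI
    rw [Finset.sum_Ico_eq_sum_range]
    simp only [Nat.add_sub_cancel_left]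
    have : (((D.nb w0).take l0).map fun y => kf y + 15).sum =
        ∑ t ∈ Finset.range l0, (5 + (kf ((D.nb w0).getD t 0) + 10)) := by
      clear hl hk hI step hQ
      induction l0 with
      | zero => simp
      | succ l ih =>
        have hl : l < (D.nb w0).length := by omega
        rw [Finset.sum_range_succ, ← ih (by omega), List.take_add_one, List.getElem?_eq_getElem hl,
          List.getD_eq_getElem _ _ hl]
        simp only [List.map_append, List.sum_append, Option.toList_some, List.map_cons,
          List.map_nil, List.sum_cons, List.sum_nil]
        omega
    rw [this]
    simp only [cost_get, cost_add]
    omega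

end Loop

/-! ### The representation of the current set -/

namespace Loop

open Classical in
/-- The number of neighbours of `u` in `S` that do not contribute to the code of `u`. -/
noncomputable def Dat.defv (D : Dat) (S : Finset ℕ) (u : ℕ) : ℕ :=
  (S.filter fun w => D.adj u w ∧ D.wt w u = 0).card

/-- The code of `u`: it tells which heavy out-neighbours of `u` are in `S`. -/
def Dat.code (D : Dat) (S : Finset ℕ) (u : ℕ) : ℕ := ∑ w ∈ S, D.wt w u

open Classical in
/-- The number of smaller neighbours of `u` in `S`. -/
noncomputable def Dat.low (D : Dat) (S : Finset ℕ) (u : ℕ) : ℕ :=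
  (S.filter fun w => D.adj u w ∧ w < u).card

/-- The number of `u < n` with `d u = 0` and `c u = x`. -/
def cnt (n : ℕ) (d c : ℕ → ℕ) (x : ℕ) : ℕ := ((Finset.range n).filter fun u => d u = 0 ∧ c u = x).card

theorem cnt_le (n : ℕ) (d c : ℕ → ℕ) (x : ℕ) : cnt n d c x ≤ n :=
  (Finset.card_filter_le _ _).trans (by simp)

theorem cnt_update {n : ℕ} (d c : ℕ → ℕ) {u : ℕ} (hu : u < n) (a e x : ℕ) :
    cnt n (Function.update d u a) (Function.update c u e) x + (if d u = 0 ∧ c u = x then 1 else 0) =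
      cnt n d c x + (if a = 0 ∧ e = x then 1 else 0) := by
  unfold cnt
  rw [Finset.card_filter, Finset.card_filter]
  rw [← Finset.add_sum_erase _ _ (Finset.mem_range.2 hu),
    ← Finset.add_sum_erase _ (fun i => if d i = 0 ∧ c i = x then 1 else 0) (Finset.mem_range.2 hu)]
  have : ∀ i ∈ (Finset.range n).erase u,
      (if Function.update d u a i = 0 ∧ Function.update c u e i = x then 1 else 0) =
      if d i = 0 ∧ c i = x then 1 else 0 := by
    intro i hi
    have := (Finset.mem_erase.1 hi).1
    simp [this]
  rw [Finset.sum_congr rfl this]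
  simp only [Function.update_self]
  omega

/-- The two updates of the table when the data of `u` change. -/
theorem table_update {n : ℕ} {d c T : ℕ → ℕ} (hT : ∀ x, T x = cnt n d c x) {u : ℕ} (hu : u < n)
    (a e x : ℕ) :
    Function.update (Function.update T (c u) (T (c u) - (1 - d u))) e
      (Function.update T (c u) (T (c u) - (1 - d u)) e + (1 - a)) x =
    cnt n (Function.update d u a) (Function.update c u e) x := by
  have h := cnt_update d c hu a e x
  have h1 : d u = 0 → 1 ≤ cnt n d c (c u) := fun h0 =>
    Finset.card_pos.2 ⟨u, by simp [h0, hu]⟩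
  have g1 : ∀ z, Function.update T (c u) (T (c u) - (1 - d u)) z =
      T z - if d u = 0 ∧ c u = z then 1 else 0 := by
    intro z
    rw [Function.update_apply]
    by_cases hz : z = c u
    · subst hz
      by_cases hd : d u = 0
      · simp [hd]
      · simp [hd, Nat.sub_eq_zero_of_le (Nat.one_le_iff_ne_zero.2 hd)]
    · simp [hz, Ne.symm hz]
  generalize Function.update T (c u) (T (c u) - (1 - d u)) = T1 at g1 ⊢
  have g2 : Function.update T1 e (T1 e + (1 - a)) x =
      T1 x + if a = 0 ∧ e = x then 1 else 0 := by
    rw [Function.update_apply]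
    by_cases hz : x = e
    · subst hz
      by_cases ha : a = 0
      · simp [ha]
      · simp [ha, Nat.sub_eq_zero_of_le (Nat.one_le_iff_ne_zero.2 ha)]
    · simp [hz, Ne.symm hz]
  rw [g2, g1, hT]
  by_cases hz : d u = 0 ∧ c u = x
  · have := h1 hz.1
    rw [hz.2] at this
    simp only [hz, and_self, if_true] at h ⊢
    omega
  · simp only [hz, if_false] at h ⊢
    omega

open Classical in
/-- The arrays represent the set `S`, and the vertices below `l` are active. -/
structure Rep (D : Dat) (S : Finset ℕ) (l : ℕ) (s : St) : Prop where
  DEF : ∀ u < D.n, s.a .DEF u = D.defv S u + if u < l then 0 else 1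
  CODE : ∀ u < D.n, s.a .CODE u = D.code S u
  LOW : ∀ u < D.n, s.a .LOW u = D.low S u
  INS : ∀ u < D.n, s.a .INS u = if u ∈ S then 1 else 0
  T : ∀ x, s.a .T x = cnt D.n (s.a .DEF) (s.a .CODE) x

theorem Rep.frame {D : Dat} {S : Finset ℕ} {l : ℕ} {c : Cmd} {s s' : St} (h : Rep D S l s)
    (hF : Frame c s s')
    (hc : (c.wa .DEF || c.wa .CODE || c.wa .LOW || c.wa .INS || c.wa .T) = false) :
    Rep D S l s' := by
  simp only [Bool.or_eq_false_iff] at hc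
  obtain ⟨⟨⟨⟨c1, c2⟩, c3⟩, c4⟩, c5⟩ := hc
  exact ⟨by rw [hF.a _ c1]; exact h.DEF, by rw [hF.a _ c2]; exact h.CODE,
    by rw [hF.a _ c3]; exact h.LOW, by rw [hF.a _ c4]; exact h.INS,
    by rw [hF.a _ c1, hF.a _ c2, hF.a _ c5]; exact h.T⟩

theorem Rep.setV {D : Dat} {S : Finset ℕ} {l : ℕ} {s : St} (h : Rep D S l s) (x : Var) (k : ℕ) :
    Rep D S l (s.setV x k) :=
  ⟨h.DEF, h.CODE, h.LOW, h.INS, h.T⟩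

/-! ### Codes as numerals in base `b`. -/

section Codes
variable {D : Dat}

/-- The digits of the code. -/
def Dat.dig (D : Dat) (S : Finset ℕ) (u p : ℕ) : ℕ :=
  if h : p < (D.O u).length then if (D.O u)[p] ∈ S then D.ix (D.O u)[p] else 0 else 0

theorem sum_dig_lt {K b : ℕ} {f : ℕ → ℕ} (hf : ∀ p < K, f p < b) :
    ∑ p ∈ Finset.range K, f p * b ^ p < b ^ K := by
  induction K with
  | zero => simp
  | succ K ih =>
    rw [Finset.sum_range_succ, pow_succ']
    have h1 := ih fun p hp => hf p (by omega)
    have h2 : (f K + 1) * b ^ K ≤ b * b ^ K := Nat.mul_le_mul_right _ (hf K (by omega))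
    rw [add_mul, one_mul] at h2
    omega

/-- The out-neighbour at position `p` is the only vertex contributing to the `p`-th power of `b`. So
nothing is carried, and the code determines its digits. -/
theorem Dat.Good.code_eq (hD : D.Good) (S : Finset ℕ) (u : ℕ) :
    D.code S u = ∑ p ∈ Finset.range D.K, D.dig S u p * D.b ^ p := by
  unfold Dat.code
  refine Finset.sum_bij_ne_zero (fun w _ _ => (D.O u).idxOf w) ?_ ?_ ?_ ?_
  · intro w hw h
    have hwO : w ∈ D.O u := by by_contra hn; exact h (by rw [Dat.wt, if_neg hn])
    exact Finset.mem_range.2 ((List.idxOf_lt_length_iff.2 hwO).trans_le (hD.len u))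
  · intro w hw h w' hw' h' he
    have hwO : w ∈ D.O u := by by_contra hn; exact h (by rw [Dat.wt, if_neg hn])
    exact (List.idxOf_inj hwO).1 he
  · intro p hp h
    unfold Dat.dig at h
    split at h
    · next hp' =>
      split at h
      · next hS =>
        have e : (D.O u).idxOf (D.O u)[p] = p := (hD.nodup u).idxOf_getElem p hp'
        have hm : (D.O u)[p] ∈ D.O u := List.getElem_mem hp'
        exact ⟨_, hS, by rw [Dat.wt, if_pos hm, e]; exact h, e⟩
      · simp at h
    · simp at h
  · intro w hw h
    have hwO : w ∈ D.O u := by by_contra hn; exact h (by rw [Dat.wt, if_neg hn])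
    have hlt := List.idxOf_lt_length_iff.2 hwO
    rw [Dat.wt, if_pos hwO, Dat.dig, dif_pos hlt]
    simp only [List.getElem_idxOf, if_pos hw]

theorem Dat.Good.dig_lt (hD : D.Good) (S : Finset ℕ) (u p : ℕ) : D.dig S u p < D.b := by
  unfold Dat.dig
  split
  · split
    · exact hD.ix_lt _
    · exact hD.b_pos
  · exact hD.b_pos

theorem Dat.Good.code_lt (hD : D.Good) (S : Finset ℕ) (u : ℕ) : D.code S u < D.b ^ D.K := by
  rw [hD.code_eq]
  exact sum_dig_lt fun p _ => hD.dig_lt S u p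

theorem Dat.Good.wt_lt (hD : D.Good) (w u : ℕ) : D.wt w u < D.b ^ D.K := by
  have := hD.code_lt {w} u
  simpa [Dat.code] using this

end Codes

/-! ### Adding and removing a vertex -/

open Classical in
/-- `S` with `v` added if `f = 1`, and removed otherwise. -/
noncomputable def flipSet (f : ℕ) (v : ℕ) (S : Finset ℕ) : Finset ℕ :=
  if f = 1 then insert v S else S.erase v

/-- `f` says how the membership of `v` in `S` is to change. -/
def FlipOk (f v : ℕ) (S : Finset ℕ) : Prop := f = 1 ∧ v ∉ S ∨ f = 0 ∧ v ∈ S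

/-- Both directions of the change in one equation between sums, which avoids truncated subtraction.
-/
theorem card_filter_flip {f v : ℕ} {S : Finset ℕ} (hf : FlipOk f v S) (P : ℕ → Prop)
    [DecidablePred P] :
    ((flipSet f v S).filter P).card + (if P v then 1 - f else 0) =
      (S.filter P).card + if P v then f else 0 := by
  rcases hf with ⟨rfl, hv⟩ | ⟨rfl, hv⟩
  · have hv' : v ∉ S.filter P := fun h => hv (Finset.mem_filter.1 h).1
    rw [flipSet, if_pos rfl, Finset.filter_insert]
    split <;> simp_all
  · rw [flipSet, if_neg (by norm_num), Finset.filter_erase]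
    by_cases hP : P v
    · have hv' : v ∈ S.filter P := Finset.mem_filter.2 ⟨hv, hP⟩
      simp only [hP, if_true]
      rw [Finset.card_erase_add_one hv', add_zero]
    · have hv' : v ∉ S.filter P := fun h => hP (Finset.mem_filter.1 h).2
      simp [hP]

theorem code_flip {D : Dat} {f v : ℕ} {S : Finset ℕ} (hf : FlipOk f v S) (u : ℕ) :
    D.code (flipSet f v S) u + (1 - f) * D.wt v u = D.code S u + f * D.wt v u := by
  unfold Dat.code
  rcases hf with ⟨rfl, hv⟩ | ⟨rfl, hv⟩
  · rw [flipSet, if_pos rfl, Finset.sum_insert hv]; simp [add_comm]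
  · rw [flipSet, if_neg (by norm_num), ← Finset.add_sum_erase _ _ hv]; simp [add_comm]

theorem flipSet_lt {n f v : ℕ} {S : Finset ℕ} (hS : ∀ u ∈ S, u < n) (hv : v < n) :
    ∀ u ∈ flipSet f v S, u < n := by
  unfold flipSet
  split
  · intro u hu
    rcases Finset.mem_insert.1 hu with rfl | hu
    exacts [hv, hS u hu]
  · exact fun u hu => hS u (Finset.mem_of_mem_erase hu)

theorem card_le_of_lt {n : ℕ} {S : Finset ℕ} (hS : ∀ u ∈ S, u < n) : S.card ≤ n := by
  have := Finset.card_le_card (show S ⊆ Finset.range n from fun u hu => Finset.mem_range.2 (hS u hu))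
  simpa using this

section
open Classical
variable {D : Dat} {n : ℕ} {S : Finset ℕ}

theorem Dat.defv_le (hS : ∀ u ∈ S, u < n) (u : ℕ) : D.defv S u ≤ n :=
  (Finset.card_filter_le _ _).trans (card_le_of_lt hS)

theorem Dat.low_le (hS : ∀ u ∈ S, u < n) (u : ℕ) : D.low S u ≤ n :=
  (Finset.card_filter_le _ _).trans (card_le_of_lt hS)

end

/-- The cost of `flip` at a vertex of degree `d`. -/
def flipCost (d : ℕ) : ℕ := 250 * d + 50

/-- In the invariant, the visited neighbours of `v` have the data belonging to the new set, all
other vertices those of the old one. For vertices not adjacent to `v` the two agree. -/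
theorem wp_flip {M : Lim} {D : Dat} (hD : D.Good) (hF : Fits M D) {s : St} (hS : Static D s)
    {S : Finset ℕ} {l f v : ℕ} (hR : Rep D S l s) (hSn : ∀ u ∈ S, u < D.n) (hv : v < D.n)
    (hfw : s.v .fw = v) (hf : s.v .f = f) (hok : FlipOk f v S) :
    wp M flip s (fun k s' => k ≤ flipCost (D.nb v).length ∧ Rep D (flipSet f v S) l s') := by
  classical
  set S' := flipSet f v S with hS'
  have hSn' : ∀ u ∈ S', u < D.n := flipSet_lt hSn hv
  have hFn := hF.n
  have hFp := hF.pow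
  have hFW := hF.W
  have hf1 : f ≤ 1 := by rcases hok with h | h <;> omega
  rw [flip, wp_seq]
  refine wp_each hF hS v (D.nb v).length (fun l' s' =>
    (∀ u < D.n, s'.a .DEF u = D.defv (if u ∈ l' then S' else S) u + if u < l then 0 else 1) ∧
    (∀ u < D.n, s'.a .CODE u = D.code (if u ∈ l' then S' else S) u) ∧
    (∀ u < D.n, s'.a .LOW u = D.low (if u ∈ l' then S' else S) u) ∧
    ∀ x, s'.a .T x = cnt D.n (s'.a .DEF) (s'.a .CODE) x) (fun _ => 200)
    (by simp [hfw]) (by simp [hfw, hS.LN v hv]) hv le_rfl (by simp)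
    (by simp [hfw, Lim.idx]; omega) rfl ?_ ?_ hD ?_
  · simpa using ⟨hR.DEF, hR.CODE, hR.LOW, hR.T⟩
  · rintro l' y x0 s' hpre hy hyn hx0 hwt ⟨h1, h2, h3, h4⟩ hfr hS''
    have hyl : y ∉ l' := by
      have hnd := ((hD.nb_nodup v).sublist (List.take_sublist _ _)).sublist hpre.sublist
      rw [List.nodup_append] at hnd
      exact fun h => hnd.2.2 y h y (List.mem_singleton_self y) rfl
    have e1 := h1 y hyn
    have e2 := h2 y hyn
    have e3 := h3 y hyn
    rw [if_neg hyl] at e1 e2 e3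
    have efw : s'.v .fw = v := by rw [hfr.v .fw rfl, hfw]
    have ef : s'.v .f = f := by rw [hfr.v .f rfl, hf]
    have ewt : s'.a .WT x0 = D.wt v y := by rw [hfr.a .WT rfl, hwt]
    have b1 := Dat.defv_le (D := D) hSn y
    have b1' := Dat.defv_le (D := D) hSn' y
    have b2 := hD.code_lt S y
    have b2' := hD.code_lt S' y
    have b3 := Dat.low_le (D := D) hSn y
    have b4 := cnt_le D.n (s'.a .DEF) (s'.a .CODE)
    have b5 := hD.wt_lt v y
    have hadj : D.adj y v := Dat.adj_symm (hD.mem_nb.1 hy)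
    have c1 : D.defv S' y + (if D.adj y v ∧ D.wt v y = 0 then 1 - f else 0) =
      D.defv S y + if D.adj y v ∧ D.wt v y = 0 then f else 0 := card_filter_flip hok _
    have c2 : D.code S' y + _ = D.code S y + _ := code_flip (D := D) hok y
    have c3 : D.low S' y + (if D.adj y v ∧ v < y then 1 - f else 0) =
      D.low S y + if D.adj y v ∧ v < y then f else 0 := card_filter_flip hok _
    simp only [hadj, true_and] at c1 c3
    have d1 : s'.a .DEF y + f * (1 - D.wt v y) - (1 - f) * (1 - D.wt v y) =
        D.defv S' y + if y < l then 0 else 1 := by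
      rw [e1]
      rcases hok with ⟨rfl, -⟩ | ⟨rfl, -⟩ <;> by_cases hw : D.wt v y = 0 <;> simp [hw] at c1 ⊢ <;>
        omega
    have d2 : D.code S y + f * D.wt v y - (1 - f) * D.wt v y = D.code S' y := by omega
    have d3 : s'.a .LOW y + f * (1 - (v + 1 - y)) - (1 - f) * (1 - (v + 1 - y)) = D.low S' y := by
      rw [e3]
      by_cases hw : v < y
      · have : v + 1 - y = 0 := by omega
        rcases hok with ⟨rfl, -⟩ | ⟨rfl, -⟩ <;> simp [hw, this] at c3 ⊢ <;> omega
      · have : 1 - (v + 1 - y) = 0 := by omega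
        rcases hok with ⟨rfl, -⟩ | ⟨rfl, -⟩ <;> simp [hw, this] at c3 ⊢ <;> omega
    have f1 : f * (1 - D.wt v y) ≤ 1 := (Nat.mul_le_mul hf1 (Nat.sub_le 1 _)).trans (by norm_num)
    have f1' : (1 - f) * (1 - D.wt v y) ≤ 1 :=
      (Nat.mul_le_mul (Nat.sub_le 1 f) (Nat.sub_le 1 _)).trans (by norm_num)
    have f2 : f * D.wt v y ≤ D.wt v y := (Nat.mul_le_mul_right _ hf1).trans (by simp)
    have f2' : (1 - f) * D.wt v y ≤ D.wt v y :=
      (Nat.mul_le_mul_right _ (Nat.sub_le 1 f)).trans (by simp)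
    have f3 : f * (1 - (v + 1 - y)) ≤ 1 :=
      (Nat.mul_le_mul hf1 (Nat.sub_le 1 _)).trans (by norm_num)
    have f3' : (1 - f) * (1 - (v + 1 - y)) ≤ 1 :=
      (Nat.mul_le_mul (Nat.sub_le 1 f) (Nat.sub_le 1 _)).trans (by norm_num)
    have hT := table_update h4 hyn (D.defv S' y + if y < l then 0 else 1) (D.code S' y)
    have hact : (if y < l then 0 else 1) ≤ 1 := by split <;> omega
    simp [Lim.idx, efw, ef, ewt, d1, d2, d3, e2]
    rw [e2] at hT
    have hTb := hT (D.code S' y)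
    rw [Function.update_self] at hTb
    have hTn := cnt_le D.n (Function.update (s'.a .DEF) y (D.defv S' y + if y < l then 0 else 1))
      (Function.update (s'.a .CODE) y (D.code S' y)) (D.code S' y)
    have key : ∀ (a : ℕ → ℕ) (F : Finset ℕ → ℕ → ℕ), (∀ u < D.n, a u = F (if u ∈ l' then S' else S) u) →
        ∀ u < D.n, Function.update a y (F S' y) u = F (if u ∈ l' ∨ u = y then S' else S) u := by
      intro a F ha u hu
      by_cases hy : u = y
      · subst hy; simp
      · simp [hy, ha u hu]
    and_intros
    all_goals first
      | omega
      | exact key _ (fun T u => D.defv T u + if u < l then 0 else 1) h1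
      | exact key _ (fun T u => D.code T u) h2
      | exact key _ (fun T u => D.low T u) h3
  · rintro k s' hfr hS1 hk ⟨h1, h2, h3, h4⟩
    have efw : s'.v .fw = v := by rw [hfr.v .fw rfl, hfw]
    have ef : s'.v .f = f := by rw [hfr.v .f rfl, hf]
    simp only [List.take_length] at h1 h2 h3 hk
    have hna : ∀ u, ¬ u ∈ D.nb v → ¬ D.adj u v := fun u hu h => hu (hD.mem_nb.2 (Dat.adj_symm h))
    have key : ∀ u, D.defv (if u ∈ D.nb v then S' else S) u = D.defv S' u ∧
        D.code (if u ∈ D.nb v then S' else S) u = D.code S' u ∧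
        D.low (if u ∈ D.nb v then S' else S) u = D.low S' u := by
      intro u
      by_cases hu : u ∈ D.nb v
      · simp [hu]
      · have hadj := hna u hu
        have c1 : D.defv S' u + (if D.adj u v ∧ D.wt v u = 0 then 1 - f else 0) =
          D.defv S u + if D.adj u v ∧ D.wt v u = 0 then f else 0 := card_filter_flip hok _
        have c2 : D.code S' u + _ = D.code S u + _ := code_flip (D := D) hok u
        have c3 : D.low S' u + (if D.adj u v ∧ v < u then 1 - f else 0) =
          D.low S u + if D.adj u v ∧ v < u then f else 0 := card_filter_flip hok _
        have hw : D.wt v u = 0 := hD.wt_eq_zero.2 (Or.inl fun h => hadj (Or.inl h))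
        simp only [hadj, false_and, if_false, hw, mul_zero, add_zero] at c1 c2 c3
        simp only [if_neg hu]
        exact ⟨c1.symm, c2.symm, c3.symm⟩
    rw [wp_put]
    refine ⟨⟨by decide, trivial, trivial, ?_⟩, ?_, ?_⟩
    · simp only [eval_var, efw]; omega
    · simp only [List.map_const', List.sum_replicate, smul_eq_mul, cost_var, cost_get] at hk ⊢
      simp only [flipCost]
      omega
    · refine ⟨fun u hu => ?_, fun u hu => ?_, fun u hu => ?_, fun u hu => ?_, ?_⟩
      · simp [h1 u hu, (key u).1]
      · simp [h2 u hu, (key u).2.1]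
      · simp [h3 u hu, (key u).2.2]
      · simp only [eval_var, efw, ef, St.setA_a_self, hfr.a .INS rfl]
        rw [hS', flipSet]
        by_cases huv : u = v
        · subst huv
          rcases hok with ⟨rfl, -⟩ | ⟨rfl, -⟩ <;> simp
        · rw [Function.update_of_ne huv, hR.INS u hu]
          rcases hok with ⟨rfl, -⟩ | ⟨rfl, -⟩ <;> simp [huv]
      · simpa using h4

theorem Rep.bounds {D : Dat} {S : Finset ℕ} {l : ℕ} {s : St} (hR : Rep D S l s)
    (hSn : ∀ u ∈ S, u < D.n) (u : ℕ) (hu : u < D.n) :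
    s.a .DEF u ≤ D.n + 1 ∧ s.a .LOW u ≤ D.n := by
  have b1 := Dat.defv_le (D := D) hSn u
  rw [hR.DEF u hu, hR.LOW u hu]
  exact ⟨by split <;> omega, Dat.low_le hSn u⟩

theorem wp_activate {M : Lim} {D : Dat} (hD : D.Good) (hF : Fits M D) {s : St}
    {S : Finset ℕ} {l : ℕ} (hR : Rep D S l s) (hl : l < D.n) (hi : s.v .i = l) :
    wp M activate s (fun k s' => k ≤ 60 ∧ Rep D S (l + 1) s') := by
  have hFn := hF.n
  have hFp := hF.pow
  have hFW := hF.W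
  have e1 := hR.DEF l hl
  have e2 := hR.CODE l hl
  have b2 := hD.code_lt S l
  have hT := table_update hR.T hl (D.defv S l) (D.code S l)
  -- An inactive vertex is not in the table, so the removal in `table_update` has no effect and only
  -- the insertion remains.
  have h0 : 1 - s.a .DEF l = 0 := by rw [e1]; simp
  have h1 : s.a .DEF l - 1 = D.defv S l := by rw [e1]; simp
  simp only [h0, Nat.sub_zero, Function.update_eq_self, e2] at hT
  have hTb := hT (D.code S l)
  rw [Function.update_self] at hTb
  have hTn := cnt_le D.n (Function.update (s.a .DEF) l (D.defv S l))
      (Function.update (s.a .CODE) l (D.code S l)) (D.code S l)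
  have hc : Function.update (s.a .CODE) l (D.code S l) = s.a .CODE := by
    rw [← e2, Function.update_eq_self]
  rw [hc] at hT
  simp [activate, Lim.idx, hi, h1, e2]
  refine ⟨by omega, by omega, ?_⟩
  refine ⟨fun u hu => ?_, ?_, ?_, ?_, ?_⟩
  · by_cases hul : u = l
    · subst hul; simp
    · simp only [St.setA_a_ne, St.setA_a_self, ne_eq, reduceCtorEq, not_false_eq_true,
        Function.update_of_ne hul, hR.DEF u hu]
      have : u < l ↔ u < l + 1 := by omega
      simp only [this]
  · simpa using hR.CODE
  · simpa using hR.LOW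
  · simpa using hR.INS
  · simpa using hT

theorem wp_deactivate {M : Lim} {D : Dat} (hD : D.Good) (hF : Fits M D) {s : St}
    {S : Finset ℕ} {l : ℕ} (hR : Rep D S (l + 1) s) (hSn : ∀ u ∈ S, u < D.n) (hl : l < D.n)
    (hi : s.v .i = l) :
    wp M deactivate s (fun k s' => k ≤ 60 ∧ Rep D S l s') := by
  have hFn := hF.n
  have hFp := hF.pow
  have hFW := hF.W
  have e1 := hR.DEF l hl
  have e2 := hR.CODE l hl
  have b1 := (hR.bounds hSn l hl).1
  have b2 := hD.code_lt S l
  have hT := table_update hR.T hl (s.a .DEF l + 1) (D.code S l)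
  have hc : Function.update (s.a .CODE) l (D.code S l) = s.a .CODE := by
    rw [← e2, Function.update_eq_self]
  rw [hc, e2, Nat.sub_eq_zero_of_le (Nat.le_add_left 1 _), add_zero] at hT
  simp only [Function.update_eq_self] at hT
  simp [deactivate, Lim.idx, hi, e2]
  refine ⟨by omega, by omega, ?_⟩
  refine ⟨fun u hu => ?_, ?_, ?_, ?_, ?_⟩
  · by_cases hul : u = l
    · subst hul
      simp only [St.setA_a_self, Function.update_self, e1, St.setA_a_ne, ne_eq, reduceCtorEq,
        not_false_eq_true]
      simp
    · simp only [St.setA_a_ne, St.setA_a_self, ne_eq, reduceCtorEq, not_false_eq_true,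
        Function.update_of_ne hul, hR.DEF u hu]
      have : u < l ↔ u < l + 1 := by omega
      simp only [this]
  · simpa using hR.CODE
  · simpa using hR.LOW
  · simpa using hR.INS
  · simpa using hT

end Loop

namespace Loop

/-! ### Digits -/

theorem sum_div_mod {B K : ℕ} (e : ℕ → ℕ) (he : ∀ p < K, e p < B) {t : ℕ} (ht : t < K) :
    (∑ p ∈ Finset.range K, e p * B ^ p) / B ^ t % B = e t := by
  induction K generalizing e t with
  | zero => omega
  | succ K ih =>
    have hB : 0 < B := (Nat.zero_le _).trans_lt (he 0 (Nat.succ_pos K))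
    have h1 : ∑ p ∈ Finset.range (K + 1), e p * B ^ p =
        e 0 + B * ∑ p ∈ Finset.range K, e (p + 1) * B ^ p := by
      rw [Finset.sum_range_succ', Finset.mul_sum, pow_zero, mul_one, add_comm]
      congr 1
      exact Finset.sum_congr rfl fun p _ => by ring
    rw [h1]
    cases t with
    | zero => rw [pow_zero, Nat.div_one, Nat.add_mul_mod_self_left, Nat.mod_eq_of_lt (he 0 ht)]
    | succ t =>
      rw [pow_succ', ← Nat.div_div_eq_div_mul, Nat.add_mul_div_left _ _ hB,
        Nat.div_eq_of_lt (he 0 (Nat.succ_pos K)), zero_add]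
      exact ih (fun p => e (p + 1)) (fun p hp => he (p + 1) (by omega)) (by omega)

theorem eq_sum_div_mod {B K c : ℕ} (hc : c < B ^ K) :
    c = ∑ p ∈ Finset.range K, c / B ^ p % B * B ^ p := by
  induction K generalizing c with
  | zero => simp at hc ⊢; exact hc
  | succ K ih =>
    have h1 : c / B < B ^ K := by
      refine Nat.div_lt_of_lt_mul ?_
      rwa [← pow_succ']
    rw [Finset.sum_range_succ']
    have h2 : ∑ p ∈ Finset.range K, c / B ^ (p + 1) % B * B ^ (p + 1) = B * (c / B) := by
      conv_rhs => rw [ih h1, Finset.mul_sum]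
      refine Finset.sum_congr rfl fun p _ => ?_
      rw [pow_succ', ← Nat.div_div_eq_div_mul]; ring
    rw [h2, pow_zero, Nat.div_one, mul_one, Nat.div_add_mod]

/-- The value in base `b` of the digits obtained from those of `c` in base `B` through `A`. -/
def enc (A : ℕ → ℕ) (K B b c : ℕ) : ℕ := ∑ p ∈ Finset.range K, A (c / B ^ p % B) * b ^ p

section Enc
variable {A : ℕ → ℕ} {K B b : ℕ}

theorem enc_lt (hB : 0 < B) (hA : ∀ t < B, A t < b) (c : ℕ) : enc A K B b c < b ^ K :=
  sum_dig_lt fun _ _ => hA _ (Nat.mod_lt _ hB)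

/-- The value in base `b` determines the images of the digits, hence the digits, since `A` is
injective on them. -/
theorem enc_inj (hB : 0 < B) (hA : ∀ t < B, A t < b) (hinj : ∀ t < B, ∀ t' < B, A t = A t' → t = t')
    {c c' : ℕ} (hc : c < B ^ K) (hc' : c' < B ^ K) (h : enc A K B b c = enc A K B b c') : c = c' := by
  rw [eq_sum_div_mod hc, eq_sum_div_mod hc']
  refine Finset.sum_congr rfl fun p hp => ?_
  have hp := Finset.mem_range.1 hp
  have hlt : ∀ c, ∀ p < K, A (c / B ^ p % B) < b := fun c p _ => hA _ (Nat.mod_lt _ hB)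
  have h1 := sum_div_mod (fun p => A (c / B ^ p % B)) (hlt c) hp
  have h2 := sum_div_mod (fun p => A (c' / B ^ p % B)) (hlt c') hp
  change enc A K B b c / b ^ p % b = _ at h1
  change enc A K B b c' / b ^ p % b = _ at h2
  rw [h, h2] at h1
  rw [hinj _ (Nat.mod_lt _ hB) _ (Nat.mod_lt _ hB) h1.symm]

/-- Replacing digits is a bijection onto the numerals with all digits in the image of `A`. As `A 0 =
0`, leaving out `c = 0` means leaving out the value zero. -/
theorem exists_enc_iff (hB : 0 < B) (hA : ∀ t < B, A t < b) (hA0 : A 0 = 0)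
    (hinj : ∀ t < B, ∀ t' < B, A t = A t' → t = t') (f : ℕ → ℕ) (hf : ∀ p < K, f p < b) :
    (∃ c ∈ Finset.Ico 1 (B ^ K), enc A K B b c = ∑ p ∈ Finset.range K, f p * b ^ p) ↔
      (∑ p ∈ Finset.range K, f p * b ^ p ≠ 0) ∧ ∀ p < K, ∃ t < B, A t = f p := by
  have h00 : enc A K B b 0 = 0 := by simp [enc, hA0]
  have hBK : 0 < B ^ K := pow_pos hB K
  constructor
  · rintro ⟨c, hc, h⟩
    rw [Finset.mem_Ico] at hc
    refine ⟨fun h0 => ?_, fun p hp => ⟨_, Nat.mod_lt (c / B ^ p) hB, ?_⟩⟩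
    · have := enc_inj hB hA hinj hc.2 hBK (by rw [h, h0, h00])
      omega
    · have h1 := sum_div_mod (fun p => A (c / B ^ p % B))
        (fun p _ => hA _ (Nat.mod_lt _ hB)) hp (K := K) (B := b)
      have h2 := sum_div_mod f hf hp
      change enc A K B b c / b ^ p % b = _ at h1
      rw [h, h2] at h1
      exact h1.symm
  · rintro ⟨h0, h⟩
    choose! e he1 he2 using h
    have h1 : ∀ p < K, (∑ p ∈ Finset.range K, e p * B ^ p) / B ^ p % B = e p := fun p hp =>
      sum_div_mod e he1 hp
    have h2 : enc A K B b (∑ p ∈ Finset.range K, e p * B ^ p) =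
        ∑ p ∈ Finset.range K, f p * b ^ p := by
      refine Finset.sum_congr rfl fun p hp => ?_
      rw [h1 p (Finset.mem_range.1 hp), he2 p (Finset.mem_range.1 hp)]
    refine ⟨_, Finset.mem_Ico.2 ⟨?_, sum_dig_lt he1⟩, h2⟩
    rw [Nat.one_le_iff_ne_zero]
    intro h3
    rw [h3, h00] at h2
    exact h0 h2.symm

end Enc

/-- Different codes have disjoint classes of vertices, so adding table entries counts a union. -/
theorem sum_cnt_eq {n : ℕ} (d c : ℕ → ℕ) (F : Finset ℕ) (g : ℕ → ℕ)
    (hg : ∀ x ∈ F, ∀ y ∈ F, g x = g y → x = y) :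
    ∑ x ∈ F, cnt n d c (g x) =
      ((Finset.range n).filter fun u => d u = 0 ∧ ∃ x ∈ F, g x = c u).card := by
  classical
  rw [← Finset.sum_image (g := g) (f := cnt n d c) hg]
  unfold cnt
  rw [← Finset.card_biUnion]
  · congr 1
    ext u
    simp only [Finset.mem_biUnion, Finset.mem_image, Finset.mem_filter, Finset.mem_range]
    constructor
    · rintro ⟨_, ⟨x, hx, rfl⟩, hu, h1, h2⟩
      exact ⟨hu, h1, x, hx, h2.symm⟩
    · rintro ⟨hu, h1, x, hx, h2⟩
      exact ⟨_, ⟨x, hx, rfl⟩, hu, h1, h2.symm⟩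
  · intro x _ y _ hxy
    refine Finset.disjoint_left.2 fun u hu hu' => hxy ?_
    rw [← (Finset.mem_filter.1 hu).2.2, (Finset.mem_filter.1 hu').2.2]

/-! ### The test for a second child -/

section Sets
variable (D : Dat) (S : Finset ℕ) (j : ℕ)

/-- All neighbours of `u` in `S` are neighbours of `j`. -/
def Dat.Sub (u : ℕ) : Prop := ∀ w ∈ S, D.adj u w → D.adj j w

/-- The heavy out-neighbours of `u` in `S` are neighbours of `j`. -/
def Dat.Heavy (u : ℕ) : Prop := ∀ w ∈ D.O u, w ∈ S → D.ix w ≠ 0 → D.adj j w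

open Classical in
/-- The number of neighbours of `u` in `S` that do not contribute to its code and are neighbours
of `j`. -/
noncomputable def Dat.common (u : ℕ) : ℕ :=
  (S.filter fun w => D.adj j w ∧ D.adj u w ∧ D.wt w u = 0).card

variable {D S j}

theorem Dat.common_eq_defv {u : ℕ} : D.common S j u = D.defv S u ↔
    ∀ w ∈ S, D.adj u w → D.wt w u = 0 → D.adj j w := by
  classical
  have hsub : (S.filter fun w => D.adj j w ∧ D.adj u w ∧ D.wt w u = 0) ⊆
      S.filter fun w => D.adj u w ∧ D.wt w u = 0 := fun w hw => by
    simp only [Finset.mem_filter] at hw ⊢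
    exact ⟨hw.1, hw.2.2⟩
  constructor
  · intro h w hw h1 h2
    have := Finset.eq_of_subset_of_card_le hsub h.ge
    have hm : w ∈ S.filter fun w => D.adj u w ∧ D.wt w u = 0 := by simp [hw, h1, h2]
    rw [← this] at hm
    exact (Finset.mem_filter.1 hm).2.1
  · intro h
    unfold Dat.common Dat.defv
    congr 1
    refine Finset.filter_congr fun w hw => ?_
    exact ⟨fun h' => h'.2, fun h' => ⟨h w hw h'.1 h'.2, h'⟩⟩

theorem Dat.common_le (u : ℕ) : D.common S j u ≤ D.defv S u := by
  classical
  refine Finset.card_le_card fun w hw => ?_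
  simp only [Finset.mem_filter] at hw ⊢
  exact ⟨hw.1, hw.2.2⟩

/-- Neighbours of weight zero are compared by number, heavy out-neighbours one by one or through the
code; there are no others. -/
theorem Dat.Good.sub_iff (hD : D.Good) {u : ℕ} :
    D.Sub S j u ↔ D.common S j u = D.defv S u ∧ D.Heavy S j u := by
  rw [Dat.common_eq_defv]
  constructor
  · exact fun h => ⟨fun w hw h1 _ => h w hw h1, fun w hw h1 _ => h w h1 (Or.inl hw)⟩
  · rintro ⟨h1, h2⟩ w hw h
    by_cases hwt : D.wt w u = 0
    · exact h1 w hw h hwt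
    · rw [hD.wt_eq_zero, not_or, not_not] at hwt
      exact h2 w hwt.1 hw hwt.2

/-- For `u ≥ j` the left-hand equation fails, because `common` never exceeds `defv`. The extra one
of inactive vertices thus replaces a comparison of `u` with `j`. -/
theorem Dat.Good.ok_iff (hD : D.Good) {u : ℕ} :
    (D.common S j u = D.defv S u + (if u < j then 0 else 1) ∧ D.Heavy S j u) ↔
      u < j ∧ D.Sub S j u := by
  have := Dat.common_le (D := D) (S := S) (j := j) u
  rw [hD.sub_iff]
  split
  · next h => simp [h]
  · next h => simp only [h, false_and, iff_false, not_and]; intro; omega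

open Classical in
/-- The vertices that would lose their last neighbour in the current set. -/
noncomputable def Dat.lost (D : Dat) (S : Finset ℕ) (j : ℕ) : Finset ℕ :=
  (Finset.range D.n).filter fun u => (u < j ∧ D.Sub S j u) ∧ ∃ w ∈ S, D.adj u w

open Classical in
-- The classes are separated by `common`: if it is nonzero, the vertex is met on a short list; if it
-- is zero, then so is `d`, and the neighbours in `S` are seen only in the code. In the second class
-- `d u = 0` already forces `u < j`.
theorem Dat.Good.card_lost (hD : D.Good) {d : ℕ → ℕ}
    (hd : ∀ u < D.n, d u = D.defv S u + if u < j then 0 else 1) :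
    (D.lost S j).card =
      ((Finset.range D.n).filter fun u => D.common S j u ≠ 0 ∧ u < j ∧ D.Sub S j u).card +
      ((Finset.range D.n).filter fun u => d u = 0 ∧ D.code S u ≠ 0 ∧ D.Heavy S j u).card := by
  rw [← Finset.card_union_of_disjoint]
  · congr 1
    ext u
    simp only [Dat.lost, Finset.mem_filter, Finset.mem_union, Finset.mem_range]
    have hcode : D.code S u ≠ 0 ↔ ∃ w ∈ S, D.wt w u ≠ 0 := by
      rw [Dat.code, Ne, Finset.sum_eq_zero_iff]; push Not; rfl
    have hwt : ∀ w, D.wt w u ≠ 0 → D.adj u w := fun w h => by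
      rw [Ne, hD.wt_eq_zero, not_or, not_not] at h
      exact Or.inl h.1
    constructor
    · rintro ⟨hu, ⟨huj, hsub⟩, w, hw, huw⟩
      have h1 := hD.sub_iff.1 hsub
      by_cases h0 : D.common S j u = 0
      · right
        rw [h0] at h1
        refine ⟨hu, by rw [hd u hu, ← h1.1, if_pos huj], ?_, h1.2⟩
        rw [hcode]
        refine ⟨w, hw, fun hz => ?_⟩
        have h2 := h1.1.symm
        rw [Dat.defv, Finset.card_eq_zero, Finset.filter_eq_empty_iff] at h2
        exact h2 hw ⟨huw, hz⟩
      · exact Or.inl ⟨hu, h0, huj, hsub⟩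
    · rintro (⟨hu, h0, huj, hsub⟩ | ⟨hu, h0, hc, hh⟩)
      · refine ⟨hu, ⟨huj, hsub⟩, ?_⟩
        obtain ⟨w, hw⟩ := Finset.card_pos.1 (Nat.pos_of_ne_zero h0)
        rw [Finset.mem_filter] at hw
        exact ⟨w, hw.1, hw.2.2.1⟩
      · rw [hd u hu] at h0
        have huj : u < j := by by_contra h; simp [h] at h0
        rw [if_pos huj, add_zero] at h0
        obtain ⟨w, hw, hz⟩ := hcode.1 hc
        refine ⟨hu, ⟨huj, hD.sub_iff.2 ⟨?_, hh⟩⟩, w, hw, hwt w hz⟩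
        have := Dat.common_le (D := D) (S := S) (j := j) u
        omega
  · refine Finset.disjoint_left.2 fun u hu hu' => ?_
    simp only [Finset.mem_filter, Finset.mem_range] at hu hu'
    have h1 := Dat.common_le (D := D) (S := S) (j := j) u
    have h2 := hd u hu.1
    omega

open Classical in
-- The vertices counted on the right are among the lost ones, so equal cardinality means that every
-- lost vertex satisfies the two demands of `Valid`.
theorem Dat.valid_iff (hj : j < D.n) : Mis.Valid D.adj S j ↔ (D.lost S j).card =
    ((Finset.range D.n).filter fun u => D.adj j u ∧ D.low S u ≠ 0 ∧ u < j ∧ D.Sub S j u).card := by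
  have hlow : ∀ u, D.low S u ≠ 0 ↔ ∃ w ∈ S, D.adj u w ∧ w < u := fun u => by
    rw [Dat.low, Ne, Finset.card_eq_zero, Finset.filter_eq_empty_iff]
    push Not; rfl
  have hsub : ((Finset.range D.n).filter fun u =>
      D.adj j u ∧ D.low S u ≠ 0 ∧ u < j ∧ D.Sub S j u) ⊆ D.lost S j := fun u hu => by
    simp only [Dat.lost, Finset.mem_filter] at hu ⊢
    obtain ⟨w, hw, h, -⟩ := (hlow u).1 hu.2.2.1
    exact ⟨hu.1, hu.2.2.2, w, hw, h⟩
  constructor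
  · intro hv
    congr 1
    refine Finset.Subset.antisymm (fun u hu => ?_) hsub
    simp only [Dat.lost, Finset.mem_filter] at hu ⊢
    have := hv u hu.2.1.1 hu.2.1.2 hu.2.2
    exact ⟨hu.1, this.1, (hlow u).2 this.2, hu.2.1⟩
  · intro h u hu h1 h2
    have heq := Finset.eq_of_subset_of_card_le hsub h.le
    have hm : u ∈ D.lost S j := by
      simp only [Dat.lost, Finset.mem_filter, Finset.mem_range]
      exact ⟨hu.trans hj, ⟨hu, h1⟩, h2⟩
    rw [← heq] at hm
    simp only [Finset.mem_filter] at hm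
    exact ⟨hm.2.1, (hlow u).1 hm.2.2.1⟩

end Sets

end Loop

/-! ### The test for a second child: marks, digits and counters. -/

namespace Loop

/-- The marks are the neighbours of `j`. -/
def Marked (D : Dat) (j : ℕ) (s : St) : Prop :=
  (∀ w, D.adj j w → s.a .MK w = 1) ∧ ∀ w, ¬ D.adj j w → s.a .MK w = 0

theorem nodup_of_prefix {D : Dat} (hD : D.Good) {w y k : ℕ} {l : List ℕ}
    (h : l ++ [y] <+: (D.nb w).take k) : y ∉ l := by
  have hnd := ((hD.nb_nodup w).sublist (List.take_sublist _ _)).sublist h.sublist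
  rw [List.nodup_append] at hnd
  exact fun h' => hnd.2.2 y h' y (List.mem_singleton_self y) rfl

theorem Dat.Good.take_O {D : Dat} (u : ℕ) : (D.nb u).take (D.O u).length = D.O u := by
  simp [Dat.nb]

def okCost (K : ℕ) : ℕ := 60 * K + 60

open Classical in
theorem wp_ok {M : Lim} {D : Dat} (hD : D.Good) (hF : Fits M D) {s : St} (hS : Static D s)
    {S : Finset ℕ} {j u : ℕ} (hR : Rep D S j s) (hM : Marked D j s) (hu : u < D.n)
    (how : s.v .ow = u) :
    wp M okCmd s (fun k s' => k ≤ okCost D.K ∧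
      s'.v .okf = if s.a .DC u = s.a .DEF u ∧ D.Heavy S j u then 1 else 0) := by
  have hFn := hF.n
  have hFW := hF.W
  rw [okCmd, wp_seq, wp_set]
  refine ⟨by simp; omega, ?_⟩
  rw [wp_ite_eq]
  refine ⟨by simp [how, Lim.idx]; omega, fun h => ?_, fun h => ?_⟩
  · simp only [eval_get, eval_var, St.setV_a, ne_eq, reduceCtorEq, not_false_eq_true,
      St.setV_v_ne, how] at h
    refine wp_each hF (hS.setV _ rfl) u (D.O u).length (fun l s' =>
      s'.v .okf = if ∀ w ∈ l, w ∈ S → D.ix w ≠ 0 → D.adj j w then 1 else 0) (fun _ => 36)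
      (by simp [how]) (by simp [how, hS.OD u hu]) hu (by simp [Dat.nb]) (by simp)
      (by simp [how, Lim.idx]; omega) rfl (by simp) ?_ hD ?_
    · intro l y x0 s' hpre hy hyn hx0 hwt hI hfr hS'
      have eI : s'.a .INS y = if y ∈ S then 1 else 0 := by
        rw [hfr.a .INS rfl]; exact hR.INS y hyn
      have eX : s'.a .IX y = D.ix y := hS'.IX y hyn
      have eM : s'.a .MK = s.a .MK := by rw [hfr.a .MK rfl]; rfl
      have hp : (∀ w ∈ l ++ [y], w ∈ S → D.ix w ≠ 0 → D.adj j w) ↔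
          (∀ w ∈ l, w ∈ S → D.ix w ≠ 0 → D.adj j w) ∧ (y ∈ S → D.ix y ≠ 0 → D.adj j y) := by
        simp [or_imp, forall_and]
      simp only [hp]
      have hyL : y < M.L := by omega
      by_cases hyS : y ∈ S
      · rw [if_pos hyS] at eI
        by_cases hix : D.ix y = 0
        · simp [Lim.idx, eI, eX, hix, hyL, hI]
        · by_cases hadj : D.adj j y
          · simp [Lim.idx, eI, eX, hix, hyL, hI, eM, hM.1 y hadj, hadj]
          · simp [Lim.idx, eI, eX, hix, hyL, eM, hM.2 y hadj, hadj, hyS]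
      · rw [if_neg hyS] at eI
        simp [Lim.idx, eI, hyL, hI, hyS]
    · intro k s' hfr hS' hk hI
      rw [Dat.Good.take_O] at hk hI
      have hlen := hD.len u
      refine ⟨?_, ?_⟩
      · simp only [List.map_const', List.sum_replicate, smul_eq_mul, cost_var, cost_get,
          cost_one] at hk ⊢
        simp only [okCost]
        omega
      · rw [hI]
        refine if_congr ?_ rfl rfl
        simp only [h, true_and]; rfl
  · simp only [eval_get, eval_var, St.setV_a, ne_eq, reduceCtorEq, not_false_eq_true,
      St.setV_v_ne, how] at h
    simp [h, okCost]

open Classical in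
/-- The digits collected in `QA`. -/
structure Digits (D : Dat) (S : Finset ℕ) (l : List ℕ) (s : St) : Prop where
  zero : s.a .QA 0 = 0
  inj : ∀ t ≤ s.v .q, ∀ t' ≤ s.v .q, s.a .QA t = s.a .QA t' → t = t'
  mem : ∀ x, (∃ t ≤ s.v .q, s.a .QA t = x) ↔ x = 0 ∨ ∃ w ∈ l, w ∈ S ∧ D.ix w ≠ 0 ∧ D.ix w = x

theorem wp_mark {M : Lim} {D : Dat} (hD : D.Good) (hF : Fits M D) {s : St} (hS : Static D s)
    {S : Finset ℕ} {j : ℕ} (hR : Rep D S j s) (hM : ∀ w, s.a .MK w = 0) (hQ : s.a .QA 0 = 0)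
    (hj : j < D.n) (hi : s.v .i = j) :
    wp M markCmd s (fun k s' => k ≤ 80 * (D.nb j).length + 60 ∧ Marked D j s' ∧
      Digits D S (D.nb j) s' ∧ s'.v .q ≤ (D.nb j).length) := by
  have hFn := hF.n
  have hFW := hF.W
  rw [markCmd, wp_seq, wp_set]
  refine ⟨by simp, ?_⟩
  refine wp_each hF (hS.setV _ rfl) j (D.nb j).length (fun l s' =>
      ((∀ w ∈ l, s'.a .MK w = 1) ∧ ∀ w, w ∉ l → s'.a .MK w = 0) ∧ Digits D S l s' ∧
      s'.v .q ≤ l.length) (fun _ => 60)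
      (by simp [hi]) (by simp [hi, hS.LN j hj]) hj le_rfl (by simp)
      (by simp [hi, Lim.idx]; omega) rfl ?_ ?_ hD ?_
  · refine ⟨⟨by simp, by simpa using hM⟩, ⟨by simpa using hQ, by simp, fun x => ?_⟩, by simp⟩
    simp [hQ, eq_comm]
  · rintro l y x0 s' hpre hy hyn hx0 hwt ⟨⟨h1, h2⟩, h3, h4⟩ hfr hS'
    have hyl := nodup_of_prefix hD hpre
    have hlen : l.length + 1 ≤ (D.nb j).length := by
      have := hpre.length_le
      simpa using this
    have hln := hD.nb_length_le j
    have eI : s'.a .INS y = if y ∈ S then 1 else 0 := by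
        rw [hfr.a .INS rfl]; exact hR.INS y hyn
    have eX : s'.a .IX y = D.ix y := hS'.IX y hyn
    have hyL : y < M.L := by omega
    have hW1 : 1 ≤ M.W := by omega
    have hmk : (∀ w, w ∈ l ∨ w = y → Function.update (s'.a .MK) y 1 w = 1) ∧
        ∀ w, w ∉ l → ¬ w = y → Function.update (s'.a .MK) y 1 w = 0 := by
      refine ⟨fun w hw => ?_, fun w hw hwy => ?_⟩
      · by_cases hwy : w = y
        · subst hwy; simp
        · rw [Function.update_of_ne hwy]; exact h1 w (hw.resolve_right hwy)
      · rw [Function.update_of_ne hwy]; exact h2 w hw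
    have same : (y ∈ S → D.ix y = 0) → ∀ s'' : St, s''.a .QA = s'.a .QA → s''.v .q = s'.v .q →
        Digits D S (l ++ [y]) s'' := by
      intro hn s'' e1 e2
      refine ⟨by rw [e1]; exact h3.zero, by rw [e1, e2]; exact h3.inj, fun x => ?_⟩
      rw [e1, e2, h3.mem x]
      refine or_congr_right ⟨fun ⟨w, hw, h⟩ => ⟨w, by simp [hw], h⟩, fun ⟨w, hw, h⟩ => ⟨w, ?_, h⟩⟩
      rw [List.mem_append, List.mem_singleton] at hw
      refine hw.resolve_right fun hwy => ?_
      subst hwy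
      exact h.2.1 (hn h.1)
    by_cases hyS : y ∈ S
    · rw [if_pos hyS] at eI
      by_cases hix : D.ix y = 0
      · simp [Lim.idx, eI, eX, hix, hyL, hW1]
        exact ⟨hmk, same (fun _ => hix) _ rfl rfl, by omega⟩
      · have hq : s'.v .q < M.W := by omega
        have hq' : s'.v .q + 1 < M.L := by omega
        simp [Lim.idx, eI, eX, hix, hyL, hW1, hq, hq', h4]
        refine ⟨hmk, ?_⟩
        have hupd : ∀ t ≤ s'.v .q, Function.update (s'.a .QA) (s'.v .q + 1) (D.ix y) t =
            s'.a .QA t := fun t ht => Function.update_of_ne (by omega) _ _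
        -- The index of `y` is nonzero and belongs to no other vertex, and `y` occurs only once in
        -- the list, so the digit is new.
        have hnew : ∀ t ≤ s'.v .q, s'.a .QA t ≠ D.ix y := by
          intro t ht h
          rcases (h3.mem (D.ix y)).1 ⟨t, ht, h⟩ with h0 | ⟨w, hw, -, hw0, hwx⟩
          · exact hix h0
          · exact hyl (hD.ix_inj _ _ hw0 hwx ▸ hw)
        refine ⟨?_, ?_, fun x => ?_⟩
        · simp only [St.setA_a_self, St.setV_a, St.setA_a_ne, ne_eq, reduceCtorEq, not_false_eq_true]
          rw [hupd 0 (Nat.zero_le _)]; exact h3.zero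
        · simp only [St.setA_v, St.setV_v_self, St.setA_a_self, St.setV_a, St.setA_a_ne, ne_eq,
            reduceCtorEq, not_false_eq_true]
          intro t ht t' ht' h
          rcases Nat.le_succ_iff.1 ht with ht | rfl <;> rcases Nat.le_succ_iff.1 ht' with ht' | rfl
          · rw [hupd t ht, hupd t' ht'] at h; exact h3.inj t ht t' ht' h
          · rw [hupd t ht, Function.update_self] at h; exact absurd h (hnew t ht)
          · rw [hupd t' ht', Function.update_self] at h; exact absurd h.symm (hnew t' ht')
          · rfl
        · simp only [St.setA_v, St.setV_v_self, St.setA_a_self, St.setV_a, St.setA_a_ne, ne_eq,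
            reduceCtorEq, not_false_eq_true]
          have e1 : (∃ t ≤ s'.v .q + 1, Function.update (s'.a .QA) (s'.v .q + 1) (D.ix y) t = x) ↔
              (∃ t ≤ s'.v .q, s'.a .QA t = x) ∨ D.ix y = x := by
            constructor
            · rintro ⟨t, ht, h⟩
              rcases Nat.le_succ_iff.1 ht with ht | rfl
              · exact Or.inl ⟨t, ht, by rwa [hupd t ht] at h⟩
              · exact Or.inr (by rwa [Function.update_self] at h)
            · rintro (⟨t, ht, h⟩ | h)
              · exact ⟨t, by omega, by rwa [hupd t ht]⟩
              · exact ⟨_, le_rfl, by rwa [Function.update_self]⟩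
          rw [e1, h3.mem x, or_assoc]
          refine or_congr_right ?_
          constructor
          · rintro (⟨w, hw, h⟩ | h)
            · exact ⟨w, by simp [hw], h⟩
            · exact ⟨y, by simp, hyS, hix, h⟩
          · rintro ⟨w, hw, h⟩
            rw [List.mem_append, List.mem_singleton] at hw
            rcases hw with hw | rfl
            · exact Or.inl ⟨w, hw, h⟩
            · exact Or.inr h.2.2
    · rw [if_neg hyS] at eI
      simp [Lim.idx, eI, hyL, hW1]
      exact ⟨hmk, same (fun h => absurd h hyS) _ rfl rfl, by omega⟩
  · rintro k s' hfr hS' hk ⟨⟨h1, h2⟩, h3, h4⟩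
    simp only [List.take_length] at hk h1 h2 h3 h4
    refine ⟨?_, ⟨fun w hw => h1 w (hD.mem_nb.2 hw), fun w hw => h2 w fun h => hw (hD.mem_nb.1 h)⟩,
      h3, h4⟩
    simp only [List.map_const', List.sum_replicate, smul_eq_mul, cost_var, cost_get,
      cost_zero] at hk ⊢
    omega

theorem wp_unmark {M : Lim} {D : Dat} (hD : D.Good) (hF : Fits M D) {s : St} (hS : Static D s)
    {j : ℕ} (hM : Marked D j s) (hj : j < D.n) (hi : s.v .i = j) :
    wp M unmarkCmd s (fun k s' => k ≤ 80 * (D.nb j).length + 60 ∧ ∀ w, s'.a .MK w = 0) := by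
  have hFn := hF.n
  have hFW := hF.W
  refine wp_each hF hS j (D.nb j).length (fun l s' =>
      ∀ w, w ∈ l ∨ ¬ D.adj j w → s'.a .MK w = 0) (fun _ => 60)
      (by simp [hi]) (by simp [hi, hS.LN j hj]) hj le_rfl (by simp)
      (by simp [hi, Lim.idx]; omega) rfl (by simpa using hM.2) ?_ hD ?_
  · intro l y x0 s' hpre hy hyn hx0 hwt hI hfr hS'
    have hyL : y < M.L := by omega
    simp [hyL]
    intro w hw
    by_cases hwy : w = y
    · subst hwy; simp
    · rw [Function.update_of_ne hwy]
      refine hI w ?_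
      tauto
  · intro k s' hfr hS' hk hI
    simp only [List.take_length] at hk hI
    refine ⟨?_, fun w => hI w ?_⟩
    · simp only [List.map_const', List.sum_replicate, smul_eq_mul, cost_var, cost_get] at hk ⊢
      omega
    · rw [hD.mem_nb]; exact em _

/-- The total length of the short adjacency lists of the neighbours of `j`. -/
def Dat.shortSum (D : Dat) (j : ℕ) : ℕ := ((D.nb j).map D.sl).sum

open Classical in
theorem wp_count {M : Lim} {D : Dat} (hD : D.Good) (hF : Fits M D) {s : St} (hS : Static D s)
    {S : Finset ℕ} {j : ℕ} (hR : Rep D S j s) (hC : ∀ u, s.a .DC u = 0)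
    (hj : j < D.n) (hi : s.v .i = j) :
    wp M countCmd s (fun k s' => k ≤ 60 * (D.nb j).length + 60 * D.shortSum j + 60 ∧
      (∀ u < D.n, s'.a .DC u = D.common S j u) ∧ ∀ u, D.n ≤ u → s'.a .DC u = 0) := by
  have hFn := hF.n
  have hFW := hF.W
  -- The value of `common` restricted to the neighbours of `j` already visited.
  let F : List ℕ → ℕ → ℕ := fun l u =>
    (l.toFinset.filter fun w => w ∈ S ∧ D.adj u w ∧ D.wt w u = 0).card
  have hFle : ∀ l : List ℕ, ∀ u, F l u ≤ l.length := fun l u =>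
    (Finset.card_filter_le _ _).trans (List.toFinset_card_le l)
  have hFadd : ∀ (l : List ℕ) (y : ℕ), y ∉ l → ∀ u,
      F (l ++ [y]) u = F l u + if y ∈ S ∧ D.adj u y ∧ D.wt y u = 0 then 1 else 0 := by
    intro l y hy u
    have : (l ++ [y]).toFinset = insert y l.toFinset := by ext; simp
    have hy' : y ∉ l.toFinset.filter fun w => w ∈ S ∧ D.adj u w ∧ D.wt w u = 0 := by
      simp [hy]
    simp only [F, this, Finset.filter_insert]
    split
    · rw [Finset.card_insert_of_notMem hy']
    · rfl
  refine wp_each hF hS j (D.nb j).length (fun l s' =>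
      (∀ u < D.n, s'.a .DC u = F l u) ∧ ∀ u, D.n ≤ u → s'.a .DC u = 0)
      (fun w => 45 + 35 * D.sl w)
      (by simp [hi]) (by simp [hi, hS.LN j hj]) hj le_rfl (by simp)
      (by simp [hi, Lim.idx]; omega) rfl ⟨by simp [F, hC], fun u _ => hC u⟩ ?_ hD ?_
  · rintro l y x0 s' hpre hy hyn hx0 hwt ⟨hI, hI0⟩ hfr hS'
    have hyl := nodup_of_prefix hD hpre
    have hyL : y < M.L := by omega
    have hlen : l.length + 1 ≤ (D.nb j).length := by simpa using hpre.length_le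
    have hln := hD.nb_length_le j
    have eI : s'.a .INS y = if y ∈ S then 1 else 0 := by
        rw [hfr.a .INS rfl]; exact hR.INS y hyn
    rw [wp_ite_eq]
    refine ⟨by simp [Lim.idx, hyL]; omega, fun h => ?_, fun h => ?_⟩
    · have hyS : y ∈ S := by
        by_contra hn
        rw [if_neg hn] at eI
        simp [eI] at h
      refine wp_each hF ((hS'.setV _ rfl).setV _ rfl) y (D.sl y) (fun l2 s2 =>
        (∀ u < D.n, s2.a .DC u = F l u + if u ∈ l2 then 1 else 0) ∧ ∀ u, D.n ≤ u → s2.a .DC u = 0)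
        (fun _ => 20)
        (by simp) (by simp [hS'.SL y hyn]) hyn (Dat.sl_le y) (by simp)
        (by simp [Lim.idx, hyL]) rfl ⟨by simpa using hI, by simpa using hI0⟩ ?_ hD ?_
      · rintro l2 u x1 s2 hpre2 hu hun hx1 hwt2 ⟨hI2, hI20⟩ hfr2 hS2
        have hul := nodup_of_prefix hD hpre2
        have huL : u < M.L := by omega
        have e1 := hI2 u hun
        rw [if_neg hul] at e1
        have e2 : s2.a .DC u + 1 ≤ M.W := by have := hFle l u; omega
        have hW1 : 1 ≤ M.W := by omega
        simp [Lim.idx, huL, e2, hW1]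
        refine ⟨fun u' hu' => ?_, fun u' hu' => ?_⟩
        · by_cases he : u' = u
          · subst he; simp [e1]
          · simp [he, hI2 u' hu']
        · have he : u' ≠ u := by omega
          simp [he, hI20 u' hu']
      · rintro k s2 hfr2 hS2 hk ⟨hI2, hI20⟩
        refine ⟨?_, fun u hu => ?_, hI20⟩
        · have hsl := Dat.sl_le (D := D) y
          simp only [List.map_const', List.sum_replicate, smul_eq_mul, cost_var, cost_get,
            cost_one, List.length_take, min_eq_left hsl] at hk ⊢
          omega
        · rw [hI2 u hu, hFadd l y hyl]
          simp only [hD.mem_take_sl, hyS, true_and]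
          congr 1
          simp only [show D.adj y u ↔ D.adj u y from ⟨Dat.adj_symm, Dat.adj_symm⟩]
    · have hyS : y ∉ S := by
        intro hn
        rw [if_pos hn] at eI
        simp [eI] at h
      simp
      refine ⟨by omega, fun u hu => ?_, hI0⟩
      rw [hFadd l y hyl, hI u hu]; simp [hyS]
  · rintro k s' hfr hS' hk ⟨hI, hI0⟩
    simp only [List.take_length] at hk hI
    refine ⟨?_, fun u hu => ?_, hI0⟩
    · have : ((D.nb j).map fun y => 45 + 35 * D.sl y + 15).sum =
          60 * (D.nb j).length + 35 * D.shortSum j := by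
        unfold Dat.shortSum
        clear hk hI
        induction D.nb j with
        | nil => simp
        | cons a l ih => simp only [List.map_cons, List.sum_cons, List.length_cons, ih]; ring
      rw [this] at hk
      simp only [cost_var, cost_get] at hk
      omega
    · rw [hI u hu]
      simp only [F, Dat.common]
      congr 1
      ext w
      simp only [Finset.mem_filter, List.mem_toFinset, hD.mem_nb]
      tauto

end Loop

/-! ### The test for a second child: counting good and lost vertices. -/

namespace Loop

open Classical in
theorem wp_ok' {M : Lim} {D : Dat} (hD : D.Good) (hF : Fits M D) {s : St} (hS : Static D s)
    {S : Finset ℕ} {j u : ℕ} (hR : Rep D S j s) (hM : Marked D j s) (hu : u < D.n)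
    (how : s.v .ow = u) (hC : s.a .DC u = D.common S j u) :
    wp M okCmd s (fun k s' => k ≤ okCost D.K ∧
      s'.v .okf = if u < j ∧ D.Sub S j u then 1 else 0) := by
  refine wp_mono (wp_ok hD hF hS hR hM hu how) ?_
  rintro k s' - ⟨h1, h2⟩
  refine ⟨h1, ?_⟩
  rw [h2, hC, hR.DEF u hu]
  exact if_congr hD.ok_iff rfl rfl

theorem Marked.frame {D : Dat} {j : ℕ} {c : Cmd} {s s' : St} (h : Marked D j s)
    (hF : Frame c s s') (hc : c.wa .MK = false) : Marked D j s' := by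
  unfold Marked; rw [hF.a _ hc]; exact h

theorem Marked.setV {D : Dat} {j : ℕ} {s : St} (h : Marked D j s) (x : Var) (k : ℕ) :
    Marked D j (s.setV x k) := h

theorem toFinset_append_singleton {l : List ℕ} {y : ℕ} :
    (l ++ [y]).toFinset = insert y l.toFinset := by ext; simp

theorem card_filter_insert {P : ℕ → Prop} [DecidablePred P] {l : Finset ℕ} {y : ℕ} (hy : y ∉ l) :
    ((insert y l).filter P).card = (l.filter P).card + if P y then 1 else 0 := by
  rw [Finset.filter_insert]
  split
  · rw [Finset.card_insert_of_notMem (by simp [hy])]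
  · rfl

theorem card_filter_congr {F : Finset ℕ} {P Q : ℕ → Prop} {_ : DecidablePred P} {_ : DecidablePred Q}
    (h : ∀ u ∈ F, P u ↔ Q u) : (F.filter P).card = (F.filter Q).card := by
  congr 1
  ext u
  simp only [Finset.mem_filter]
  exact and_congr_right fun hu => h u hu

theorem card_filter_range_le {n : ℕ} {P : ℕ → Prop} {_ : DecidablePred P} :
    ((Finset.range n).filter P).card ≤ n :=
  (Finset.card_filter_le _ _).trans (by simp)

theorem card_filter_new {F : Finset ℕ} {P Q : ℕ → Prop} {_ : DecidablePred P} {_ : DecidablePred Q}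
    {u : ℕ} (hu : u ∈ F) (hP : ¬ P u) (h : ∀ v ∈ F, v ≠ u → (Q v ↔ P v)) {R : Prop} [Decidable R]
    (hQ : Q u ↔ R) : (F.filter Q).card = (F.filter P).card + if R then 1 else 0 := by
  split
  · next hR =>
    rw [← Finset.card_insert_of_notMem (a := u) (by simp [hP])]
    congr 1
    ext v
    by_cases hv : v = u
    · subst hv; simp [hu, hQ, hR]
    · simp only [Finset.mem_filter, Finset.mem_insert, hv, false_or]
      exact and_congr_right fun hF => h v hF hv
  · next hR =>
    refine card_filter_congr fun v hv => ?_
    by_cases he : v = u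
    · subst he; simp [hP, hQ, hR]
    · exact h v hv he

open Classical in
theorem wp_good {M : Lim} {D : Dat} (hD : D.Good) (hF : Fits M D) {s : St} (hS : Static D s)
    {S : Finset ℕ} {j : ℕ} (hR : Rep D S j s) (hM : Marked D j s)
    (hC : ∀ u < D.n, s.a .DC u = D.common S j u) (hj : j < D.n) (hi : s.v .i = j) :
    wp M goodCmd s (fun k s' => k ≤ (okCost D.K + 60) * (D.nb j).length + 60 ∧
      s'.v .Y = ((Finset.range D.n).filter fun u =>
        D.adj j u ∧ D.low S u ≠ 0 ∧ u < j ∧ D.Sub S j u).card) := by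
  have hFn := hF.n
  have hFW := hF.W
  rw [goodCmd, wp_seq, wp_set]
  refine ⟨by simp, ?_⟩
  refine wp_each hF (hS.setV _ rfl) j (D.nb j).length (fun l s' =>
      s'.v .Y = (l.toFinset.filter fun u => D.low S u ≠ 0 ∧ u < j ∧ D.Sub S j u).card)
      (fun _ => okCost D.K + 40)
      (by simp [hi]) (by simp [hi, hS.LN j hj]) hj le_rfl (by simp)
      (by simp [hi, Lim.idx]; omega) rfl (by simp) ?_ hD ?_
  · intro l y x0 s' hpre hy hyn hx0 hwt hI hfr hS'
    have hyl := nodup_of_prefix hD hpre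
    have hyL : y < M.L := by omega
    have hR' : Rep D S j s' := (hR.setV _ _).frame hfr rfl
    have eL := hR'.LOW y hyn
    have hlen : l.length + 1 ≤ (D.nb j).length := by simpa using hpre.length_le
    have hln := hD.nb_length_le j
    have hYb : s'.v .Y ≤ l.length := by
      rw [hI]; exact (Finset.card_filter_le _ _).trans (List.toFinset_card_le l)
    rw [toFinset_append_singleton, card_filter_insert (by simpa using hyl)]
    rw [wp_ite_eq]
    refine ⟨by simp [Lim.idx, hyL], fun h => ?_, fun h => ?_⟩
    · simp only [eval_get, eval_var, St.setV_v_self, St.setV_a, eval_zero, eL] at h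
      simp [h, hI, okCost]
    · simp only [eval_get, eval_var, St.setV_v_self, St.setV_a, eval_zero, eL] at h
      rw [wp_seq, wp_set]
      refine ⟨by simp, ?_⟩
      rw [wp_seq]
      have hC' : s'.a .DC y = D.common S j y := by
        rw [hfr.a .DC rfl]; exact hC y hyn
      refine wp_mono (wp_ok' hD hF (((hS'.setV _ rfl).setV _ rfl).setV _ rfl)
        (((hR'.setV _ _).setV _ _).setV _ _) (((hM.setV .Y 0).frame hfr rfl : Marked D j s')) hyn
        (by simp) (by simpa using hC')) ?_
      rintro k s2 hfr2 ⟨hk, hok⟩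
      have eY : s2.v .Y = s'.v .Y := by rw [hfr2.v .Y rfl]; simp
      rw [wp_set]
      have hok1 : s2.v .okf ≤ 1 := by rw [hok]; split <;> omega
      refine ⟨by simp [eY]; omega, ?_, ?_⟩
      · simp; omega
      · simp [eY, hok, hI, h]
  · intro k s' hfr hS' hk hI
    simp only [List.take_length] at hk hI
    refine ⟨?_, ?_⟩
    · simp only [List.map_const', List.sum_replicate, smul_eq_mul, cost_var, cost_get,
        cost_zero] at hk ⊢
      have : (okCost D.K + 60) * (D.nb j).length = (D.nb j).length * (okCost D.K + 40 + 15) +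
        5 * (D.nb j).length := by ring
      omega
    · rw [hI]
      congr 1
      ext u
      simp only [Finset.mem_filter, List.mem_toFinset, hD.mem_nb, Finset.mem_range]
      exact ⟨fun h => ⟨(hD.adj_lt h.1).2, h⟩, fun h => h.2⟩

open Classical in
/-- The vertices in `Z` have been looked at, and their counters have been cleared. -/
structure Cleared (D : Dat) (S : Finset ℕ) (j : ℕ) (Z : ℕ → Prop) (s : St) : Prop where
  DC : ∀ u < D.n, s.a .DC u = if Z u then 0 else D.common S j u
  out : ∀ u, D.n ≤ u → s.a .DC u = 0
  X : s.v .X = ((Finset.range D.n).filter fun u =>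
    Z u ∧ D.common S j u ≠ 0 ∧ u < j ∧ D.Sub S j u).card

theorem Cleared.congr {D : Dat} {S : Finset ℕ} {j : ℕ} {Z Z' : ℕ → Prop} {s : St}
    (h : Cleared D S j Z s) (hZ : ∀ u, Z' u ↔ Z u) : Cleared D S j Z' s := by
  have : Z' = Z := funext fun u => propext (hZ u)
  rwa [this]

theorem Cleared.X_le {D : Dat} {S : Finset ℕ} {j : ℕ} {Z : ℕ → Prop} {s : St}
    (h : Cleared D S j Z s) : s.v .X ≤ D.n := by
  classical
  rw [h.X]; exact (Finset.card_filter_le _ _).trans (by simp)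

open Classical in
theorem wp_touched {M : Lim} {D : Dat} (hD : D.Good) (hF : Fits M D) {s : St} (hS : Static D s)
    {S : Finset ℕ} {j : ℕ} (hR : Rep D S j s) (hM : Marked D j s)
    (hC : ∀ u < D.n, s.a .DC u = D.common S j u) (hC0 : ∀ u, D.n ≤ u → s.a .DC u = 0)
    (hj : j < D.n) (hi : s.v .i = j) :
    wp M touchedCmd s (fun k s' =>
      k ≤ 80 * (D.nb j).length + (okCost D.K + 80) * D.shortSum j + 60 ∧
      (∀ u, s'.a .DC u = 0) ∧
      s'.v .X = ((Finset.range D.n).filter fun u =>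
        D.common S j u ≠ 0 ∧ u < j ∧ D.Sub S j u).card) := by
  have hFn := hF.n
  have hFW := hF.W
  rw [touchedCmd, wp_seq, wp_set]
  refine ⟨by simp, ?_⟩
  -- The vertices met so far: those on the short lists of the visited members of the set.
  let Z : List ℕ → ℕ → Prop := fun l u => ∃ w ∈ l, w ∈ S ∧ u ∈ (D.nb w).take (D.sl w)
  refine wp_each hF (hS.setV _ rfl) j (D.nb j).length (fun l s' => Cleared D S j (Z l) s')
      (fun w => 60 + (okCost D.K + 70) * D.sl w)
      (by simp [hi]) (by simp [hi, hS.LN j hj]) hj le_rfl (by simp)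
      (by simp [hi, Lim.idx]; omega) rfl ⟨by simpa [Z] using hC, by simpa using hC0, by simp [Z]⟩
      ?_ hD ?_
  · intro l y x0 s' hpre hy hyn hx0 hwt hI hfr hS'
    have hyL : y < M.L := by omega
    have hR' : Rep D S j s' := (hR.setV _ _).frame hfr rfl
    have hM' : Marked D j s' := (hM.setV .X 0).frame hfr rfl
    have eI := hR'.INS y hyn
    rw [wp_ite_eq]
    refine ⟨by simp [Lim.idx, hyL]; omega, fun h => ?_, fun h => ?_⟩
    · have hyS : y ∈ S := by
        by_contra hn
        rw [if_neg hn] at eI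
        simp [eI] at h
      refine wp_each hF ((hS'.setV _ rfl).setV _ rfl) y (D.sl y)
        (fun l2 s2 => Cleared D S j (fun u => Z l u ∨ u ∈ l2) s2) (fun _ => okCost D.K + 50)
        (by simp) (by simp [hS'.SL y hyn]) hyn (Dat.sl_le y) (by simp)
        (by simp [Lim.idx, hyL]) rfl ?_ ?_ hD ?_
      · refine Cleared.congr (Z := Z l) ⟨by simpa using hI.DC, by simpa using hI.out,
          by simpa using hI.X⟩ (by simp)
      · intro l2 u x1 s2 hpre2 hu hun hx1 hwt2 hI2 hfr2 hS2
        have huL : u < M.L := by omega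
        have hR2 : Rep D S j s2 := ((hR'.setV _ _).setV _ _).frame hfr2 rfl
        have hM2 : Marked D j s2 := (show Marked D j ((s'.setV .x1 x0).setV .w1 y) from hM').frame
          hfr2 rfl
        have hXb := hI2.X_le
        have eC := hI2.DC u hun
        rw [wp_ite_eq]
        refine ⟨by simp [Lim.idx, huL], fun h => ?_, fun h => ?_⟩
        · simp only [eval_get, eval_var, St.setV_v_self, St.setV_a, eval_zero] at h
          have hz : Z l u ∨ u ∈ l2 ∨ D.common S j u = 0 := by
            rw [h] at eC
            by_cases hz : Z l u ∨ u ∈ l2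
            · exact hz.elim Or.inl fun h => Or.inr (Or.inl h)
            · rw [if_neg hz] at eC; exact Or.inr (Or.inr eC.symm)
          simp
          refine ⟨fun u' hu' => ?_, hI2.out, ?_⟩
          · simp only [St.setV_a, hI2.DC u' hu']
            by_cases he : u' = u
            · subst he
              simp [← hI2.DC u' hu', h]
            · simp [he]
          · rw [show ((s2.setV .x2 x1).setV .u2 u).v .X = s2.v .X from rfl, hI2.X]
            refine card_filter_congr fun u' hu' => ?_
            refine and_congr_left fun hg => ?_
            by_cases he : u' = u
            · subst he
              refine ⟨fun _ => by simp, fun _ => ?_⟩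
              rcases hz with h | h | h
              · exact Or.inl h
              · exact Or.inr h
              · exact absurd h hg.1
            · simp [he]
        · simp only [eval_get, eval_var, St.setV_v_self, St.setV_a, eval_zero] at h
          have hz : ¬ (Z l u ∨ u ∈ l2) := fun hz => h (by rw [eC, if_pos hz])
          rw [if_neg hz] at eC
          rw [wp_seq, wp_set]
          refine ⟨by simp, ?_⟩
          rw [wp_seq]
          refine wp_mono (wp_ok' hD hF (((hS2.setV _ rfl).setV _ rfl).setV _ rfl)
            (((hR2.setV _ _).setV _ _).setV _ _) hM2 hun (by simp) (by simpa using eC)) ?_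
          rintro k s3 hfr3 ⟨hk, hok⟩
          have eX : s3.v .X = s2.v .X := by rw [hfr3.v .X rfl]; simp
          have eu : s3.v .u2 = u := by rw [hfr3.v .u2 rfl]; simp
          have eDC : s3.a .DC = s2.a .DC := by rw [hfr3.a .DC rfl]; simp
          have hok1 : s3.v .okf ≤ 1 := by rw [hok]; split <;> omega
          simp only [wp_seq, wp_set, wp_put]
          refine ⟨by simp [eX]; omega, by simp [eu]; omega, ?_, ?_⟩
          · simp; omega
          · refine ⟨fun u' hu' => ?_, fun u' hu' => ?_, ?_⟩
            · have hI2' := hI2.DC u' hu'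
              by_cases he : u' = u
              · subst he; simp [eu]
              · simp [eu, eDC, he, hI2']
            · have he : u' ≠ u := by omega
              simp [eu, eDC, he, hI2.out u' hu']
            · simp only [eval_add, eval_var, eX, St.setA_v, St.setV_v_self, hok, hI2.X]
              have h0 : D.common S j u ≠ 0 := by rwa [eC] at h
              refine (card_filter_new (Finset.mem_range.2 hun) (by simp [hz]) (fun v _ hv => ?_)
                ?_).symm
              · simp [hv]
              · simp [h0]
      · intro k s2 hfr2 hS2 hk hI2
        refine ⟨?_, hI2.congr fun u => ?_⟩
        · have hsl := Dat.sl_le (D := D) y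
          simp only [List.map_const', List.sum_replicate, smul_eq_mul, cost_var, cost_get,
            cost_one, List.length_take, min_eq_left hsl] at hk ⊢
          have : (okCost D.K + 70) * D.sl y = D.sl y * (okCost D.K + 50 + 15) + 5 * D.sl y := by
            ring
          omega
        · simp only [Z, List.mem_append, List.mem_singleton, or_and_right, exists_or,
            exists_eq_left, hyS, true_and]
    · have hyS : y ∉ S := by
        intro hn
        rw [if_pos hn] at eI
        simp [eI] at h
      simp
      refine ⟨by omega, Cleared.congr (Z := Z l) ⟨by simpa using hI.DC, by simpa using hI.out,
          by simpa using hI.X⟩ fun u => ?_⟩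
      simp only [Z, List.mem_append, List.mem_singleton, or_and_right, exists_or,
            exists_eq_left, hyS, false_and, or_false]
  · intro k s' hfr hS' hk hI
    simp only [List.take_length] at hk hI
    -- A vertex with nonzero `common` lies on the short list of a common neighbour and is met; hence
    -- at the end all counters are zero.
    have hZ : ∀ u, D.common S j u ≠ 0 → Z (D.nb j) u := by
      intro u hu
      obtain ⟨w, hw⟩ := Finset.card_pos.1 (Nat.pos_of_ne_zero hu)
      rw [Finset.mem_filter] at hw
      exact ⟨w, hD.mem_nb.2 hw.2.1, hw.1, hD.mem_take_sl.2 ⟨Dat.adj_symm hw.2.2.1, hw.2.2.2⟩⟩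
    refine ⟨?_, fun u => ?_, ?_⟩
    · have : ((D.nb j).map fun y => 60 + (okCost D.K + 70) * D.sl y + 15).sum =
          75 * (D.nb j).length + (okCost D.K + 70) * D.shortSum j := by
        unfold Dat.shortSum
        clear hk hI hZ
        induction D.nb j with
        | nil => simp
        | cons a l ih => simp only [List.map_cons, List.sum_cons, List.length_cons, ih]; ring
      rw [this] at hk
      simp only [cost_var, cost_get, cost_zero] at hk ⊢
      have : (okCost D.K + 80) * D.shortSum j = (okCost D.K + 70) * D.shortSum j +
        10 * D.shortSum j := by ring
      omega
    · by_cases hu : u < D.n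
      · rw [hI.DC u hu]
        split
        · rfl
        · next h => by_contra h0; exact h (hZ u h0)
      · exact hI.out u (by omega)
    · rw [hI.X]
      exact card_filter_congr fun u _ => ⟨fun h => h.2, fun h => ⟨hZ u h.1, h⟩⟩

theorem Digits.lt {D : Dat} (hD : D.Good) {S : Finset ℕ} {l : List ℕ} {s : St}
    (h : Digits D S l s) : ∀ t < s.v .q + 1, s.a .QA t < D.b := by
  intro t ht
  rcases (h.mem _).1 ⟨t, by omega, rfl⟩ with h0 | ⟨w, -, -, -, h0⟩
  · rw [h0]; exact hD.b_pos
  · rw [← h0]; exact hD.ix_lt w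

/-- The `q + 1` digits are distinct numbers below `b`. Together with `q ≤ deg j` this bounds the
number of codes tried. -/
theorem Digits.q_lt {D : Dat} (hD : D.Good) {S : Finset ℕ} {l : List ℕ} {s : St}
    (h : Digits D S l s) : s.v .q + 1 ≤ D.b := by
  have := Finset.card_le_card_of_injOn (s := Finset.range (s.v .q + 1)) (t := Finset.range D.b)
    (s.a .QA) (fun t ht => Finset.mem_coe.2 (Finset.mem_range.2 (h.lt hD t (by simpa using ht))))
    (fun t ht t' ht' he => h.inj t (by simpa [Nat.lt_succ_iff] using ht) t'
      (by simpa [Nat.lt_succ_iff] using ht') he)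
  simpa using this

/-- An index determines its vertex, and the digit zero is always at hand. So a code can be spelled
with the collected digits exactly if it names only neighbours of `j`. -/
theorem Digits.mem_heavy {D : Dat} (hD : D.Good) {S : Finset ℕ} {j : ℕ} {s : St}
    (h : Digits D S (D.nb j) s) (u : ℕ) :
    (∀ p < D.K, ∃ t < s.v .q + 1, s.a .QA t = D.dig S u p) ↔ D.Heavy S j u := by
  have e : ∀ x, (∃ t < s.v .q + 1, s.a .QA t = x) ↔
      x = 0 ∨ ∃ w ∈ D.nb j, w ∈ S ∧ D.ix w ≠ 0 ∧ D.ix w = x := by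
    intro x; rw [← h.mem x]; simp only [Nat.lt_succ_iff]
  simp only [e]
  constructor
  · intro H w hw hwS hw0
    have hp : (D.O u).idxOf w < (D.O u).length := List.idxOf_lt_length_iff.2 hw
    have hd : D.dig S u ((D.O u).idxOf w) = D.ix w := by
      simp [Dat.dig, hp, hwS]
    rcases H _ (hp.trans_le (hD.len u)) with h0 | ⟨w', hw', -, h0, h1⟩
    · exact absurd (hd.symm.trans h0) hw0
    · rw [hd] at h1
      rw [← hD.ix_inj w' w h0 h1]
      exact hD.mem_nb.1 hw'
  · intro H p hp
    unfold Dat.dig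
    split
    · next hl =>
      split
      · next hS =>
        by_cases h0 : D.ix (D.O u)[p] = 0
        · exact Or.inl h0
        · exact Or.inr ⟨_, hD.mem_nb.2 (H _ (List.getElem_mem hl) hS h0), hS, h0, rfl⟩
      · exact Or.inl rfl
    · exact Or.inl rfl

theorem div_mod_eq_sub (y B : ℕ) : y - y / B * B = y % B := by
  have := Nat.div_add_mod y B
  rw [mul_comm] at this
  omega

def tableCost (K q : ℕ) : ℕ := (q + 1) ^ K * (60 * K + 60) + 30 * K + 30

open Classical in
theorem wp_table {M : Lim} {D : Dat} (hD : D.Good) (hF : Fits M D) {s : St} (hS : Static D s)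
    {S : Finset ℕ} {j : ℕ} (hR : Rep D S j s) (hQ : Digits D S (D.nb j) s)
    (hX : s.v .X ≤ D.n) (hq : s.v .q ≤ D.n) :
    wp M tableCmd s (fun k s' => k ≤ tableCost D.K (s.v .q) ∧
      s'.v .X = s.v .X + ((Finset.range D.n).filter fun u =>
        s.a .DEF u = 0 ∧ D.code S u ≠ 0 ∧ D.Heavy S j u).card) := by
  have hFn := hF.n
  have hFW := hF.W
  have hFp := hF.pow
  set B := s.v .q + 1 with hB
  have hBb : B ≤ D.b := hQ.q_lt hD
  have hB0 : 0 < B := Nat.succ_pos _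
  have hA : ∀ t < B, s.a .QA t < D.b := hQ.lt hD
  have hpow : ∀ t ≤ D.K, B ^ t ≤ D.b ^ D.K := fun t ht =>
    (Nat.pow_le_pow_left hBb t).trans (Nat.pow_le_pow_right hD.b_pos ht)
  have hinj : ∀ t < B, ∀ t' < B, s.a .QA t = s.a .QA t' → t = t' := fun t ht t' ht' =>
    hQ.inj t (by omega) t' (by omega)
  set en := enc (s.a .QA) D.K B D.b with hen
  have hcnt : ∀ c ≤ B ^ D.K, ∑ x ∈ Finset.Ico 1 c, s.a .T (en x) =
      ((Finset.range D.n).filter fun u => s.a .DEF u = 0 ∧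
        ∃ x ∈ Finset.Ico 1 c, en x = s.a .CODE u).card := by
    intro c hc
    simp only [hR.T]
    rw [sum_cnt_eq]
    · exact card_filter_congr fun u _ => Iff.rfl
    · intro x hx y hy h
      rw [Finset.mem_Ico] at hx hy
      exact enc_inj hB0 hA hinj (by omega) (by omega) h
  -- Partial sums of table entries count distinct vertices, so `X` stays a small word although many
  -- entries are added.
  have hsum : ∀ c ≤ B ^ D.K, ∑ x ∈ Finset.Ico 1 c, s.a .T (en x) ≤ D.n := by
    intro c hc
    rw [hcnt c hc]
    exact card_filter_range_le
  rw [tableCmd, wp_seq, wp_set]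
  refine ⟨by simp; omega, ?_⟩
  rw [wp_seq]
  refine wp_loop 0 D.K (fun t s' => s'.v .pw = B ^ t) (fun _ => 20) (by simp) (by simp [hS.vK])
    (Nat.zero_le _) (by simp) (by simp) (by simp) ?_ ?_
  · intro t s' _ ht hI hfr
    have eq : s'.v .q + 1 = B := by rw [hfr.v .q rfl]; simp [hB]
    have h1 := hpow (t + 1) (by omega)
    rw [pow_succ] at h1
    simp [hI, eq, pow_succ]
    omega
  · intro k0 s1 hfr1 hk0 hI1
    have eq1 : s1.v .q + 1 = B := by rw [hfr1.v .q rfl]; simp [hB]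
    have eX1 : s1.v .X = s.v .X := by rw [hfr1.v .X rfl]; simp
    have eA1 : ∀ a, s1.a a = s.a a := fun a => by rw [hfr1.a a rfl]; simp
    have hS1 : Static D s1 := (hS.setV _ rfl).frame hfr1 rfl
    have hpw0 : 1 ≤ B ^ D.K := Nat.one_le_iff_ne_zero.2 (pow_pos hB0 _).ne'
    refine wp_loop 1 (B ^ D.K) (fun c s' => s'.v .X = s.v .X + ∑ x ∈ Finset.Ico 1 c, s.a .T (en x))
      (fun _ => 60 * D.K + 50) (by simp) (by simp [hI1]) hpw0 (by simp; omega) (by simp)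
      (by simp [eX1]) ?_ ?_
    · intro c s2 hc1 hc2 hI2 hfr2
      have eq2 : s2.v .q + 1 = B := by rw [hfr2.v .q rfl]; exact eq1
      have eA2 : ∀ a, s2.a a = s.a a := fun a => by rw [hfr2.a a rfl]; exact eA1 a
      have eK2 : s2.v .K = D.K := (hS1.frame hfr2 rfl).vK
      have eb2 : s2.v .b = D.b := (hS1.frame hfr2 rfl).vb
      have hcW : c ≤ D.b ^ D.K := by have := hpow D.K le_rfl; omega
      simp only [wp_seq, wp_set]
      refine ⟨by simp, by simp, by simp; omega, ?_⟩
      refine wp_loop 0 D.K (fun t s' => s'.v .y = c / B ^ t ∧ s'.v .g = D.b ^ t ∧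
          s'.v .s = ∑ p ∈ Finset.range t, s.a .QA (c / B ^ p % B) * D.b ^ p) (fun _ => 50)
        (by simp) (by simp [eK2]) (Nat.zero_le _) (by simp) (by simp) (by simp) ?_ ?_
      · rintro t s3 - ht ⟨h1, h2, h3⟩ hfr3
        have eq3 : s3.v .q + 1 = B := by rw [hfr3.v .q rfl]; simp [eq2]
        have eA3 : ∀ a, s3.a a = s.a a := fun a => by rw [hfr3.a a rfl]; simp [eA2]
        have eb3 : s3.v .b = D.b := by rw [hfr3.v .b rfl]; simp [eb2]
        have hyc : c / B ^ t ≤ c := Nat.div_le_self _ _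
        have hyd : c / B ^ t / B ≤ c / B ^ t := Nat.div_le_self _ _
        have hym : c / B ^ t / B * B ≤ c / B ^ t := Nat.div_mul_le_self _ _
        have hm : c / B ^ t % B < B := Nat.mod_lt _ hB0
        have hs1 : ∑ p ∈ Finset.range (t + 1), s.a .QA (c / B ^ p % B) * D.b ^ p <
          D.b ^ (t + 1) := sum_dig_lt fun p _ => hA _ (Nat.mod_lt _ hB0)
        rw [Finset.sum_range_succ] at hs1
        have hb1 : D.b ^ (t + 1) ≤ D.b ^ D.K := Nat.pow_le_pow_right hD.b_pos (by omega)
        have hb2 : D.b ^ t * D.b = D.b ^ (t + 1) := (pow_succ _ _).symm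
        have hqa := hA _ hm
        have hb3 : D.b ≤ D.b ^ D.K := Nat.le_self_pow (by have := hD.K_pos; omega) _
        have hd2 : c / (B ^ t * B) = c / B ^ t / B := (Nat.div_div_eq_div_mul _ _ _).symm
        simp [Lim.idx, h1, h2, h3, eq3, eA3, eb3, div_mod_eq_sub, Finset.sum_range_succ, hd2,
          pow_succ]
        and_intros <;> omega
      · rintro k s3 hfr3 hk ⟨h1, h2, h3⟩
        have eX3 : s3.v .X = s2.v .X := by rw [hfr3.v .X rfl]; simp
        have eA3 : ∀ a, s3.a a = s.a a := fun a => by rw [hfr3.a a rfl]; simp [eA2]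
        have hs3 : s3.v .s = en c := h3
        have hlt : en c < D.b ^ D.K := enc_lt hB0 hA c
        have hs1 := hsum (c + 1) (by omega)
        have hs0 := hsum c (by omega)
        rw [Finset.sum_Ico_succ_top hc1] at hs1
        simp only [Finset.sum_const, Nat.card_Ico, smul_eq_mul, cost_zero, cost_var] at hk
        simp [Lim.idx, eX3, eA3, hs3, hI2, Finset.sum_Ico_succ_top hc1]
        and_intros <;> omega
    · intro k s2 hfr2 hk hI2
      simp only [Finset.sum_const, Nat.card_Ico, smul_eq_mul, cost_zero, cost_var, cost_one]
        at hk hk0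
      refine ⟨?_, ?_⟩
      · have h1 : (B ^ D.K - 1) * (5 + (60 * D.K + 50)) + (5 + (60 * D.K + 50)) =
            B ^ D.K * (60 * D.K + 60) - 5 * B ^ D.K := by
          rw [← Nat.succ_mul, Nat.succ_eq_add_one, Nat.sub_add_cancel hpw0, mul_comm 5,
            ← Nat.mul_sub]
          congr 1
          omega
        rw [tableCost, ← hB]
        simp only [cost_one]
        have h2 : 5 * B ^ D.K ≤ B ^ D.K * (60 * D.K + 60) := by
          rw [mul_comm]; exact Nat.mul_le_mul_left _ (by omega)
        omega
      · rw [hI2, hcnt _ le_rfl]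
        congr 1
        refine card_filter_congr fun u hu => ?_
        rw [hR.CODE u (Finset.mem_range.1 hu), hD.code_eq]
        rw [exists_enc_iff hB0 hA hQ.zero hinj _ fun p _ => hD.dig_lt S u p, hQ.mem_heavy hD]

/-- The first three terms pay for marking and for the short lists. The last bounds the table phase;
one of the `K` factors `q + 1` is estimated by `deg j + 1` and the others by `b`, so that the sum
over `j` involves only the total degree. -/
def Dat.testCost (D : Dat) (j : ℕ) : ℕ :=
  (60 * D.K + 500) * ((D.nb j).length + D.shortSum j + 1 +
    ((D.nb j).length + 1) * D.b ^ (D.K - 1))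

/-- The auxiliary arrays are clear. -/
structure Clean (s : St) : Prop where
  MK : ∀ w, s.a .MK w = 0
  DC : ∀ w, s.a .DC w = 0
  QA : s.a .QA 0 = 0

theorem wp_test {M : Lim} {D : Dat} (hD : D.Good) (hF : Fits M D) {s : St} (hS : Static D s)
    {S : Finset ℕ} {j : ℕ} (hR : Rep D S j s) (hC : Clean s) (hj : j < D.n) (hi : s.v .i = j) :
    wp M testCmd s (fun k s' => k ≤ D.testCost j ∧ Clean s' ∧
      (s'.v .X = s'.v .Y ↔ Mis.Valid D.adj S j)) := by
  rw [testCmd, wp_seq]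
  refine wp_mono (wp_mark hD hF hS hR hC.MK hC.QA hj hi) ?_
  rintro k1 s1 f1 ⟨c1, hM1, hQ1, q1⟩
  have hS1 := hS.frame f1 rfl
  have hR1 := hR.frame f1 rfl
  have i1 : s1.v .i = j := by rw [f1.v .i rfl, hi]
  have hDC1 : ∀ u, s1.a .DC u = 0 := by rw [f1.a .DC rfl]; exact hC.DC
  rw [wp_seq]
  refine wp_mono (wp_count hD hF hS1 hR1 hDC1 hj i1) ?_
  rintro k2 s2 f2 ⟨c2, hC2, hC2'⟩
  have hS2 := hS1.frame f2 rfl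
  have hR2 := hR1.frame f2 rfl
  have hM2 := hM1.frame f2 rfl
  have i2 : s2.v .i = j := by rw [f2.v .i rfl, i1]
  rw [wp_seq]
  refine wp_mono (wp_good hD hF hS2 hR2 hM2 hC2 hj i2) ?_
  rintro k3 s3 f3 ⟨c3, hY3⟩
  have hS3 := hS2.frame f3 rfl
  have hR3 := hR2.frame f3 rfl
  have hM3 := hM2.frame f3 rfl
  have i3 : s3.v .i = j := by rw [f3.v .i rfl, i2]
  have hDC3 : s3.a .DC = s2.a .DC := f3.a .DC rfl
  rw [wp_seq]
  refine wp_mono (wp_touched hD hF hS3 hR3 hM3 (by rw [hDC3]; exact hC2)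
    (by rw [hDC3]; exact hC2') hj i3) ?_
  rintro k4 s4 f4 ⟨c4, hDC4, hX4⟩
  have hS4 := hS3.frame f4 rfl
  have hR4 := hR3.frame f4 rfl
  have hM4 := hM3.frame f4 rfl
  have i4 : s4.v .i = j := by rw [f4.v .i rfl, i3]
  have eQA : s4.a .QA = s1.a .QA := by rw [f4.a .QA rfl, f3.a .QA rfl, f2.a .QA rfl]
  have eq4 : s4.v .q = s1.v .q := by rw [f4.v .q rfl, f3.v .q rfl, f2.v .q rfl]
  have hQ4 : Digits D S (D.nb j) s4 :=
    ⟨by rw [eQA]; exact hQ1.zero, by rw [eQA, eq4]; exact hQ1.inj,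
      by rw [eQA, eq4]; exact hQ1.mem⟩
  have hln := hD.nb_length_le j
  have hX4n : s4.v .X ≤ D.n := by rw [hX4]; exact card_filter_range_le
  rw [wp_seq]
  refine wp_mono (wp_table hD hF hS4 hR4 hQ4 hX4n (by omega)) ?_
  rintro k5 s5 f5 ⟨c5, hX5⟩
  have hS5 := hS4.frame f5 rfl
  have hM5 := hM4.frame f5 rfl
  have i5 : s5.v .i = j := by rw [f5.v .i rfl, i4]
  refine wp_mono (wp_unmark hD hF hS5 hM5 hj i5) ?_
  rintro k6 s6 f6 ⟨c6, hMK6⟩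
  refine ⟨?_, ⟨hMK6, ?_, ?_⟩, ?_⟩
  · have hq : (s4.v .q + 1) ^ D.K ≤ ((D.nb j).length + 1) * D.b ^ (D.K - 1) := by
      obtain ⟨K, hK⟩ := Nat.exists_eq_add_of_le' hD.K_pos
      rw [hK, Nat.add_sub_cancel, pow_succ, mul_comm]
      exact Nat.mul_le_mul (by omega) (Nat.pow_le_pow_left (hQ4.q_lt hD) _)
    have h7 := Nat.mul_le_mul_right (60 * D.K + 60) hq
    rw [tableCost] at c5
    rw [okCost] at c3 c4
    unfold Dat.testCost
    generalize (D.nb j).length = d at *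
    generalize D.shortSum j = e at *
    generalize (s4.v .q + 1) ^ D.K = a at *
    generalize (d + 1) * D.b ^ (D.K - 1) = g at *
    nlinarith
  · intro w; rw [f6.a .DC rfl, f5.a .DC rfl]; exact hDC4 w
  · rw [f6.a .QA rfl, f5.a .QA rfl]; exact hQ4.zero
  · have eX : s6.v .X = s5.v .X := f6.v .X rfl
    have eY : s6.v .Y = s3.v .Y := by rw [f6.v .Y rfl, f5.v .Y rfl, f4.v .Y rfl]
    rw [eX, eY, hX5, hX4, hY3, Dat.valid_iff hj, hD.card_lost (d := s4.a .DEF) hR4.DEF]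

end Loop

/-! ## A round of the enumeration -/

namespace Mis
open Classical

/-! ### Vertices added and removed along a path of the tree. -/

section Path
variable {adj : ℕ → ℕ → Prop} {l : ℕ} {P : ℕ → Finset ℕ}

theorem IsPath.step (hP : IsPath adj l P) {i : ℕ} (hi : i < l) :
    P (i + 1) = insert i (P i) ∨ P (i + 1) = P i ∨
      P (i + 1) = insert i (drop adj (P i) i) := by
  have h := hP.succ i hi
  unfold kids at h
  split at h
  · exact Or.inl (List.mem_singleton.1 h)
  · rcases List.mem_cons.1 h with h | h
    · exact Or.inr (Or.inl h)
    · split at h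
      · exact Or.inr (Or.inr (List.mem_singleton.1 h))
      · simp at h

theorem IsPath.subset (hP : IsPath adj l P) {i : ℕ} (hi : i < l) : P (i + 1) ⊆ insert i (P i) := by
  rcases hP.step hi with h | h | h
  · rw [h]
  · rw [h]; exact Finset.subset_insert _ _
  · rw [h]; exact Finset.insert_subset_insert _ (Finset.filter_subset _ _)

theorem IsPath.of_removed (hP : IsPath adj l P) {i w : ℕ} (hi : i < l) (h1 : w ∈ P i)
    (h2 : w ∉ P (i + 1)) : adj i w ∧ i ∈ P (i + 1) := by
  rcases hP.step hi with h | h | h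
  · exact absurd (h ▸ Finset.mem_insert_of_mem h1) h2
  · exact absurd (h ▸ h1) h2
  · refine ⟨?_, h ▸ Finset.mem_insert_self _ _⟩
    by_contra ha
    exact h2 (h ▸ Finset.mem_insert_of_mem (Finset.mem_filter.2 ⟨h1, ha⟩))

theorem IsPath.eq_of_notMem (hP : IsPath adj l P) {i : ℕ} (hi : i < l) (h : i ∉ P (i + 1)) :
    P (i + 1) = P i := by
  rcases hP.step hi with h' | h' | h'
  · exact absurd (h' ▸ Finset.mem_insert_self _ _) h
  · exact h'
  · exact absurd (h' ▸ Finset.mem_insert_self _ _) h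

theorem IsPath.lt (hP : IsPath adj l P) {i w : ℕ} (hi : i ≤ l) (hw : w ∈ P i) : w < i := by
  induction i with
  | zero => rw [hP.zero] at hw; simp at hw
  | succ i ih =>
    rcases Finset.mem_insert.1 (hP.subset hi hw) with rfl | h
    · exact Nat.lt_succ_self _
    · exact (ih (by omega) h).trans (Nat.lt_succ_self _)

/-- Members of `P i` are less than `i`, whereas later steps add only vertices that are at least `i`.
So a removed vertex never returns, and each vertex is removed at most once on a path. -/
theorem IsPath.notMem_of_removed (hP : IsPath adj l P) {i w : ℕ} (h1 : w ∈ P i)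
    (h2 : w ∉ P (i + 1)) {k : ℕ} (hik : i < k) (hk : k ≤ l) : w ∉ P k := by
  induction k with
  | zero => omega
  | succ k ih =>
    rcases Nat.lt_succ_iff_lt_or_eq.1 hik with h | rfl
    · intro h'
      have hw := hP.lt (by omega) h1
      rcases Finset.mem_insert.1 (hP.subset hk h') with rfl | h'
      · omega
      · exact ih h (by omega) h'
    · exact h2

theorem IsPath.mono (hP : IsPath adj l P) {m : ℕ} (h : m ≤ l) : IsPath adj m P :=
  ⟨hP.zero, fun i hi => hP.succ i (by omega)⟩

theorem IsPath.extend (hP : IsPath adj l P) {T : Finset ℕ} (hT : T ∈ kids adj l (P l)) :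
    IsPath adj (l + 1) (Function.update P (l + 1) T) := by
  refine ⟨by rw [Function.update_of_ne (by omega)]; exact hP.zero, fun i hi => ?_⟩
  rw [Function.update_of_ne (show i ≠ l + 1 by omega)]
  rcases Nat.lt_succ_iff_lt_or_eq.1 hi with h | rfl
  · rw [Function.update_of_ne (by omega)]; exact hP.succ i h
  · rwa [Function.update_self]

end Path
end Mis

namespace Loop
open Classical Mis

/-- The marks in `REM` say at which levels of the path vertices were removed. -/
def Rem (P : ℕ → Finset ℕ) (l : ℕ) (s : St) : Prop :=
  ∀ w i, s.a .REM w = i + 1 ↔ i < l ∧ w ∈ P i ∧ w ∉ P (i + 1)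

/-- The memory describes the end of the path `P`. -/
structure Pos (D : Dat) (P : ℕ → Finset ℕ) (l : ℕ) (s : St) : Prop where
  static : Static D s
  rep : Rep D (P l) l s
  path : IsPath D.adj l P
  rem : Rem P l s
  clean : Clean s

theorem Clean.frame {c : Cmd} {s s' : St} (h : Clean s) (hF : Frame c s s')
    (hc : (c.wa .MK || c.wa .DC || c.wa .QA) = false) : Clean s' := by
  simp only [Bool.or_eq_false_iff] at hc
  obtain ⟨⟨c1, c2⟩, c3⟩ := hc
  exact ⟨by rw [hF.a _ c1]; exact h.MK, by rw [hF.a _ c2]; exact h.DC,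
    by rw [hF.a _ c3]; exact h.QA⟩

theorem Rem.frame {P : ℕ → Finset ℕ} {l : ℕ} {c : Cmd} {s s' : St} (h : Rem P l s)
    (hF : Frame c s s') (hc : c.wa .REM = false) : Rem P l s' := by
  unfold Rem; rw [hF.a _ hc]; exact h

theorem Rem.congr {P P' : ℕ → Finset ℕ} {l : ℕ} {s : St} (h : Rem P l s)
    (hP : ∀ i ≤ l, P' i = P i) : Rem P' l s := by
  intro w i
  rw [h w i]
  refine and_congr_right fun hi => ?_
  rw [hP i (by omega), hP (i + 1) (by omega)]

/-- Nothing is removed at level `l`. -/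
theorem Rem.succ {P : ℕ → Finset ℕ} {l : ℕ} {s : St} (h : P l ⊆ P (l + 1)) :
    Rem P (l + 1) s ↔ Rem P l s := by
  refine forall_congr' fun w => forall_congr' fun i => ?_
  have : (i < l + 1 ∧ w ∈ P i ∧ w ∉ P (i + 1)) ↔ (i < l ∧ w ∈ P i ∧ w ∉ P (i + 1)) := by
    refine ⟨fun ⟨h1, h2, h3⟩ => ⟨?_, h2, h3⟩, fun ⟨h1, h2⟩ => ⟨by omega, h2⟩⟩
    rcases Nat.lt_succ_iff_lt_or_eq.1 h1 with h1 | rfl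
    · exact h1
    · exact absurd (h h2) h3
  rw [this]

theorem Rep.congr_set {D : Dat} {S S' : Finset ℕ} {l : ℕ} {s : St} (h : Rep D S l s)
    (hS : S = S') : Rep D S' l s := hS ▸ h

/-- Each neighbour in `S` is either counted by `defv` or adds a positive weight to the code. -/
theorem Dat.Good.free_iff {D : Dat} (hD : D.Good) {S : Finset ℕ} {u : ℕ} :
    Free D.adj S u ↔ D.defv S u + D.code S u = 0 := by
  have hwt : ∀ w, D.wt w u ≠ 0 → D.adj u w := fun w h => by
    rw [Ne, hD.wt_eq_zero, not_or, not_not] at h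
    exact Or.inl h.1
  rw [Nat.add_eq_zero_iff, Dat.defv, Dat.code, Finset.card_eq_zero, Finset.filter_eq_empty_iff,
    Finset.sum_eq_zero_iff]
  constructor
  · exact fun h => ⟨fun w hw h' => h w hw h'.1, fun w hw => by
      by_contra h0; exact h w hw (hwt w h0)⟩
  · rintro ⟨h1, h2⟩ w hw h
    exact h1 hw ⟨h, h2 w hw⟩

/-! ### Descent, output, return and branching. -/

section Round
variable {M : Lim} {D : Dat}

/-- The sets still to be written. -/
noncomputable def remaining (D : Dat) (P : ℕ → Finset ℕ) (l : ℕ) : List (Finset ℕ) :=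
  leaves D.adj (D.n - l) l (P l) ++ todo D.adj D.n P l

theorem wp_forward (hD : D.Good) (hF : Fits M D) {s : St} {P : ℕ → Finset ℕ} {l : ℕ}
    (hP : Pos D P l s) (hl : l ≤ D.n) (hlvl : s.v .lvl = l) :
    wp M forward s (fun k s' => k ≤ 10 + ∑ j ∈ Finset.range D.n, (flipCost (D.nb j).length + 150) ∧
      ∃ P', Pos D P' D.n s' ∧ remaining D P' D.n = remaining D P l) := by
  have hFn := hF.n
  have hFW := hF.W
  refine wp_loop l D.n (fun j s' => ∃ P', Pos D P' j s' ∧ remaining D P' j = remaining D P l)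
    (fun j => flipCost (D.nb j).length + 140) (by simp [hlvl]) (by simp [hP.static.vn]) hl (by simp)
    (by simp) ⟨P, hP, rfl⟩ ?_ ?_
  · rintro j s1 - hj ⟨P1, hP1, hrem⟩ -
    have hjL : j < M.L := by omega
    rw [wp_seq]
    refine wp_mono (wp_activate hD hF (hP1.rep.setV .i j) hj (by simp)) ?_
    rintro k s2 f2 ⟨k2, hR2⟩
    have i2 : s2.v .i = j := by rw [f2.v .i rfl]; simp
    have hS2 : Static D s2 := (hP1.static.setV _ rfl).frame f2 rfl
    have hC2 : Clean s2 := (show Clean (s1.setV .i j) from ⟨hP1.clean.MK, hP1.clean.DC,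
      hP1.clean.QA⟩).frame f2 rfl
    have hM2 : Rem P1 j s2 := (show Rem P1 j (s1.setV .i j) from hP1.rem).frame f2 rfl
    have eD := hR2.DEF j hj
    have eC := hR2.CODE j hj
    rw [if_pos (Nat.lt_succ_self j), add_zero] at eD
    have hlt : ∀ u ∈ P1 j, u < D.n := fun u hu => (hP1.path.lt le_rfl hu).trans hj
    have b1 := Dat.defv_le (D := D) hlt j
    have b2 := hD.code_lt (P1 j) j
    have hFp := hF.pow
    -- Either branch of the conditional leaves a representation of the first child; nothing is
    -- removed in that step, so `REM` stays as it is.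
    have key : ∀ s3 : St, Static D s3 → Clean s3 → Rem P1 j s3 →
        Rep D (first D.adj (P1 j) j) (j + 1) s3 →
        ∃ P', Pos D P' (j + 1) s3 ∧ remaining D P' (j + 1) = remaining D P l := by
      intro s3 h1 h2 h3 h4
      set P' := Function.update P1 (j + 1) (first D.adj (P1 j) j) with hP'
      have hP'le : ∀ i ≤ j, P' i = P1 i := fun i hi => Function.update_of_ne (by omega) _ _
      have hpath : IsPath D.adj (j + 1) P' := hP1.path.extend (first_mem_kids _ _)
      have e1 : P' (j + 1) = first D.adj (P1 j) j := Function.update_self _ _ _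
      refine ⟨P', ⟨h1, e1 ▸ h4, hpath, ?_, h2⟩, ?_⟩
      · rw [Rem.succ]
        · exact h3.congr hP'le
        · rw [e1, hP'le j le_rfl, first]
          split
          · exact Finset.subset_insert _ _
          · exact subset_rfl
      · rw [← hrem, remaining, ← leaves_append_todo (adj := D.adj) (fun _ _ h => Dat.adj_symm h) hD.adj_irrefl hj
          (hpath.mono (Nat.le_succ j)) (by rw [e1, hP'le j le_rfl]), hP'le j le_rfl,
          todo_congr hP'le, remaining]
    rw [wp_ite_lt]
    refine ⟨by simp [Lim.idx, i2, eD, eC]; omega, fun h => ?_, fun h => ?_⟩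
    · simp only [eval_add, eval_get, eval_var, eval_zero, i2, eD, eC] at h
      have hnf : ¬ Free D.adj (P1 j) j := by rw [hD.free_iff]; omega
      simp only [wp_skip]
      refine ⟨?_, key s2 hS2 hC2 hM2 ?_⟩
      · simp; omega
      · rwa [first, if_neg hnf]
    · simp only [eval_add, eval_get, eval_var, eval_zero, i2, eD, eC] at h
      have hf : Free D.adj (P1 j) j := by rw [hD.free_iff]; omega
      have hjn : j ∉ P1 j := fun h => lt_irrefl _ (hP1.path.lt le_rfl h)
      rw [wp_seq, wp_set]
      refine ⟨by simp, ?_⟩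
      rw [wp_seq, wp_set]
      refine ⟨by simp; omega, ?_⟩
      refine wp_mono (wp_flip hD hF ((hS2.setV _ rfl).setV _ rfl) ((hR2.setV _ _).setV _ _) hlt hj
        (f := 1) (by simp [i2]) (by simp) (Or.inl ⟨rfl, hjn⟩)) ?_
      rintro k3 s3 f3 ⟨hk3, hR3⟩
      refine ⟨by simp; omega, key s3 ?_ ?_ ?_ ?_⟩
      · exact ((hS2.setV _ rfl).setV _ rfl).frame f3 rfl
      · exact (show Clean ((s2.setV _ _).setV _ _) from ⟨hC2.MK, hC2.DC, hC2.QA⟩).frame f3 rfl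
      · exact (show Rem P1 j ((s2.setV _ _).setV _ _) from hM2).frame f3 rfl
      · rw [first, if_pos hf]
        exact hR3.congr_set (by rw [flipSet, if_pos rfl])
  · rintro k s' - hk hI
    refine ⟨?_, hI⟩
    have : ∑ x ∈ Finset.Ico l D.n, (5 + (flipCost (D.nb x).length + 140)) ≤
        ∑ j ∈ Finset.range D.n, (flipCost (D.nb j).length + 150) := by
      refine (Finset.sum_le_sum fun x _ => ?_).trans
        (Finset.sum_le_sum_of_subset fun x hx => ?_)
      · omega
      · simp only [Finset.mem_Ico, Finset.mem_range] at hx ⊢; omega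
    simp only [cost_var] at hk
    omega

/-- A set as it is written. -/
noncomputable def written (n : ℕ) (S : Finset ℕ) : List (Option ℕ) :=
  ((List.range n).filter (· ∈ S)).map some ++ [none]

theorem wp_emit_set (hF : Fits M D) {s : St} (hS : Static D s) {S : Finset ℕ} {l : ℕ}
    (hR : Rep D S l s) :
    wp M emitCmd s (fun k s' => k ≤ 30 * D.n + 30 ∧ s'.out = s.out ++ written D.n S) := by
  have hFn := hF.n
  have hFW := hF.W
  rw [emitCmd, wp_seq]
  refine wp_loop 0 D.n (fun v s' => s'.out = s.out ++ ((List.range v).filter (· ∈ S)).map some)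
    (fun _ => 20) (by simp) (by simp [hS.vn]) (Nat.zero_le _) (by simp) (by simp) (by simp) ?_ ?_
  · intro v s1 _ hv hI f1
    have hvL : v < M.L := by omega
    have eI : s1.a .INS v = if v ∈ S then 1 else 0 := by
      rw [f1.a .INS rfl]; exact hR.INS v hv
    have hW1 : 1 ≤ M.W := by omega
    by_cases hvS : v ∈ S
    · simp [Lim.idx, hvL, eI, hvS, hI, List.range_succ, List.filter_append, hW1]
    · simp [Lim.idx, hvL, eI, hvS, hI, List.range_succ, List.filter_append, hW1]
  · intro k s' _ hk hI
    simp only [Finset.sum_const, Nat.card_Ico, smul_eq_mul, cost_zero, cost_var] at hk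
    simp [hI, written]
    omega

/-- The cost of putting back the vertices removed at level `i` of the path. -/
noncomputable def restoreCost (D : Dat) (P : ℕ → Finset ℕ) (i : ℕ) : ℕ :=
  ∑ w ∈ P i \ P (i + 1), (flipCost (D.nb w).length + 100)

theorem sum_map_ite_le {l : List ℕ} (hl : l.Nodup) (R : Finset ℕ) (g : ℕ → ℕ) (c : ℕ) :
    (l.map fun y => (if y ∈ R then g y else 0) + c).sum ≤ l.length * c + ∑ y ∈ R, g y := by
  have h1 : (l.map fun y => (if y ∈ R then g y else 0) + c).sum =
      (l.map fun y => if y ∈ R then g y else 0).sum + l.length * c := by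
    rw [List.sum_map_add]; simp
  have h2 : (l.map fun y => if y ∈ R then g y else 0).sum =
      ∑ y ∈ l.toFinset, if y ∈ R then g y else 0 := (List.sum_toFinset _ hl).symm
  rw [h1, h2, ← Finset.sum_filter, add_comm]
  refine Nat.add_le_add_left (Finset.sum_le_sum_of_subset fun y hy => ?_) _
  exact (Finset.mem_filter.1 hy).2

/-- Vertices removed at level `i` are neighbours of `i`, so one pass over the list of `i` restores
them all. The cost is linear in the degree of `i`, apart from the flips of vertices actually put
back. -/
theorem wp_undo (hD : D.Good) (hF : Fits M D) {s : St} {P : ℕ → Finset ℕ} {i : ℕ}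
    (hP : Pos D P (i + 1) s) (hi : i < D.n) (hv : s.v .i = i) (hiP : i ∈ P (i + 1)) :
    wp M undoCmd s (fun k s' => k ≤ 350 * (D.nb i).length + 250 + restoreCost D P i ∧
      Pos D P i s') := by
  have hFn := hF.n
  have hFW := hF.W
  have hin : i ∉ P i := fun h => lt_irrefl _ (hP.path.lt (Nat.le_succ i) h)
  have hlt1 : ∀ u ∈ P (i + 1), u < D.n := fun u hu => by
    have := hP.path.lt le_rfl hu; omega
  have hlt0 : ∀ u ∈ P i, u < D.n := fun u hu => (hP.path.lt (Nat.le_succ i) hu).trans hi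
  rw [undoCmd, wp_seq, wp_set]
  refine ⟨by simp, ?_⟩
  rw [wp_seq, wp_set]
  refine ⟨by simp, ?_⟩
  rw [wp_seq]
  refine wp_mono (wp_flip hD hF ((hP.static.setV _ rfl).setV _ rfl) ((hP.rep.setV _ _).setV _ _)
    hlt1 hi (f := 0) (by simp [hv]) (by simp) (Or.inr ⟨rfl, hiP⟩)) ?_
  rintro k1 s1 f1 ⟨hk1, hR1⟩
  have hR1' := hR1.congr_set (S' := (P (i + 1)).erase i) (by rw [flipSet, if_neg (by simp)])
  have hS1 : Static D s1 := ((hP.static.setV _ rfl).setV _ rfl).frame f1 rfl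
  have i1 : s1.v .i = i := by rw [f1.v .i rfl]; simp [hv]
  have eM1 : s1.a .REM = s.a .REM := by rw [f1.a .REM rfl]; rfl
  have hC1 : Clean s1 := (show Clean ((s.setV _ _).setV _ _) from
    ⟨hP.clean.MK, hP.clean.DC, hP.clean.QA⟩).frame f1 rfl
  rw [wp_seq, wp_set]
  refine ⟨by simp; omega, ?_⟩
  rw [wp_seq]
  set R := P i \ P (i + 1) with hRdef
  have hrem : ∀ w, s.a .REM w = i + 1 ↔ w ∈ R := fun w => by
    rw [hP.rem w i, hRdef, Finset.mem_sdiff]; simp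
  -- The set in memory after the entries in `l` have been processed: `i` is gone, and the removed
  -- vertices among `l` are back.
  let S' : List ℕ → Finset ℕ := fun l => (P (i + 1)).erase i ∪ (R.filter (· ∈ l))
  have hS'lt : ∀ l, ∀ u ∈ S' l, u < D.n := by
    intro l u hu
    rcases Finset.mem_union.1 hu with h | h
    · exact hlt1 u (Finset.mem_of_mem_erase h)
    · exact hlt0 u (Finset.mem_sdiff.1 (Finset.mem_filter.1 h).1).1
  refine wp_each hF (hS1.setV _ rfl) i (D.nb i).length (fun l s' =>
    Rep D (S' l) (i + 1) s' ∧ s'.v .f = 1 ∧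
      ∀ w, s'.a .REM w = if w ∈ l ∧ w ∈ R then 0 else s.a .REM w)
    (fun w => (if w ∈ R then flipCost (D.nb w).length + 60 else 0) + 60)
    (by simp [i1]) (by simp [i1, hS1.LN i hi]) hi le_rfl (by simp)
    (by simp [i1, Lim.idx]; omega) rfl ?_ ?_ hD ?_
  · refine ⟨(hR1'.setV _ _).congr_set (by simp [S']), by simp, by simp [eM1]⟩
  · rintro l y x0 s2 hpre hy hyn hx0 hwt ⟨hI1, hI2, hI3⟩ hfr hS2
    have hyl := nodup_of_prefix hD hpre
    have hyL : y < M.L := by omega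
    have i2 : s2.v .i = i := by rw [hfr.v .i rfl]; simp [i1]
    have e3 := hI3 y
    rw [if_neg (fun h => hyl h.1)] at e3
    rw [wp_ite_eq]
    refine ⟨by simp [Lim.idx, hyL, i2]; omega, fun h => ?_, fun h => ?_⟩
    · simp only [eval_get, eval_var, eval_add, eval_one, ne_eq, reduceCtorEq, not_false_eq_true,
        St.setV_v_ne, i2, St.setV_v_self, St.setV_a, e3, hrem] at h
      have hyS : y ∉ S' l := by
        intro h'
        rcases Finset.mem_union.1 h' with h' | h'
        · exact (Finset.mem_sdiff.1 h).2 (Finset.mem_of_mem_erase h')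
        · exact hyl (Finset.mem_filter.1 h').2
      rw [wp_seq, wp_set]
      refine ⟨by simp, ?_⟩
      rw [wp_seq]
      refine wp_mono (wp_flip hD hF (((hS2.setV _ rfl).setV _ rfl).setV _ rfl)
        (((hI1.setV _ _).setV _ _).setV _ _) (hS'lt l) hyn
        (f := 1) (by simp) (by simp [hI2]) (Or.inl ⟨rfl, hyS⟩)) ?_
      rintro k3 s3 f3 ⟨hk3, hR3⟩
      have ew : s3.v .w1 = y := by rw [f3.v .w1 rfl]; simp
      have ef : s3.v .f = 1 := by rw [f3.v .f rfl]; simp [hI2]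
      have eM : s3.a .REM = s2.a .REM := by rw [f3.a .REM rfl]; rfl
      rw [wp_put]
      refine ⟨by simp [ew]; omega, ?_, ?_, by simpa using ef, fun w => ?_⟩
      · simp [h]; omega
      · have : Rep D (flipSet 1 y (S' l)) (i + 1) (s3.setA .REM y 0) :=
          hR3.frame (c := .put .REM (.lit y) (.lit 0))
            (Cmd.frame_run (.put .REM (.lit y) (.lit 0)) s3) rfl
        have h' := this.congr_set (S' := S' (l ++ [y])) (by
          rw [flipSet, if_pos rfl]
          ext u
          by_cases hu : u = y
          · subst hu; simp [S', h]
          · simp [S', hu])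
        simpa [ew] using h'
      · by_cases hw : w = y
        · subst hw; simp [ew, h]
        · simp [ew, hw, eM, hI3 w]
    · simp only [eval_get, eval_var, eval_add, eval_one, ne_eq, reduceCtorEq, not_false_eq_true,
        St.setV_v_ne, i2, St.setV_v_self, St.setV_a, e3, hrem] at h
      rw [wp_skip]
      refine ⟨by simp, ((hI1.setV _ _).setV _ _).congr_set ?_, by simp [hI2], fun w => ?_⟩
      · ext u
        by_cases hu : u = y
        · subst hu; simp [S', h]
        · simp [S', hu]
      · by_cases hw : w = y
        · subst hw; simp [h, hI3 w]
        · simp [hw, hI3 w]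
  · rintro k2 s2 f2 hS2 hk2 ⟨hI1, hI2, hI3⟩
    simp only [List.take_length] at hk2 hI1 hI3
    have i2 : s2.v .i = i := by rw [f2.v .i rfl]; simp [i1]
    have hset : S' (D.nb i) = P i := by
      ext u
      simp only [S', Finset.mem_union, Finset.mem_filter, Finset.mem_erase, hRdef,
        Finset.mem_sdiff, hD.mem_nb]
      constructor
      · rintro (⟨h1, h2⟩ | h)
        · exact (Finset.mem_insert.1 (hP.path.subset (Nat.lt_succ_self i) h2)).resolve_left h1
        · exact h.1.1
      · intro h
        by_cases h' : u ∈ P (i + 1)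
        · exact Or.inl ⟨fun he => hin (he ▸ h), h'⟩
        · exact Or.inr ⟨⟨h, h'⟩, (hP.path.of_removed (Nat.lt_succ_self i) h h').1⟩
    have hC2 : Clean s2 := (show Clean (s1.setV _ _) from ⟨hC1.MK, hC1.DC, hC1.QA⟩).frame f2 rfl
    refine wp_mono (wp_deactivate hD hF (hI1.congr_set hset) hlt0 hi i2) ?_
    rintro k3 s3 f3 ⟨hk3, hR3⟩
    refine ⟨?_, hS2.frame f3 rfl, hR3, hP.path.mono (Nat.le_succ i), ?_, hC2.frame f3 rfl⟩
    · have h1 := sum_map_ite_le (hD.nb_nodup i) R (fun w => flipCost (D.nb w).length + 60) 75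
      have h2 : ∑ y ∈ R, (flipCost (D.nb y).length + 60) ≤ restoreCost D P i :=
        Finset.sum_le_sum fun y _ => by omega
      simp only [add_assoc, Nat.reduceAdd] at hk2 h1 h2
      simp only [cost_var, cost_get, cost_zero, cost_one] at hk2 ⊢
      rw [flipCost] at hk1
      omega
    · refine Rem.frame (s := s2) ?_ f3 rfl
      intro w i'
      rw [hI3 w]
      split
      · next h =>
        simp only [Nat.zero_ne_add_one, false_iff]
        rintro ⟨h1, h2, h3⟩
        exact hP.path.notMem_of_removed h2 h3 h1 (Nat.le_succ i) (Finset.mem_sdiff.1 h.2).1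
      · next h =>
        rw [hP.rem w i']
        refine ⟨fun ⟨h1, h2, h3⟩ => ⟨?_, h2, h3⟩, fun ⟨h1, h2⟩ => ⟨by omega, h2⟩⟩
        rcases Nat.lt_succ_iff_lt_or_eq.1 h1 with h1 | rfl
        · exact h1
        · refine absurd ⟨?_, Finset.mem_sdiff.2 ⟨h2, h3⟩⟩ h
          exact hD.mem_nb.2 (hP.path.of_removed (Nat.lt_succ_self _) h2 h3).1

theorem wp_branch (hD : D.Good) (hF : Fits M D) {s : St} {P : ℕ → Finset ℕ} {i : ℕ}
    (hP : Pos D P i s) (hi : i < D.n) (hv : s.v .i = i) (hf : ¬ Free D.adj (P i) i)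
    (hvalid : Valid D.adj (P i) i) :
    wp M branch s (fun k s' =>
      k ≤ 400 + ∑ j ∈ Finset.range D.n, (flipCost (D.nb j).length + 300) ∧
      s'.v .lvl = i + 1 ∧ ∃ P', Pos D P' (i + 1) s' ∧ remaining D P' (i + 1) =
        leaves D.adj (D.n - (i + 1)) (i + 1) (insert i (drop D.adj (P i) i)) ++
          todo D.adj D.n P i) := by
  have hFn := hF.n
  have hFW := hF.W
  have hin : i ∉ P i := fun h => lt_irrefl _ (hP.path.lt le_rfl h)
  have hlt0 : ∀ u ∈ P i, u < D.n := fun u hu => (hP.path.lt le_rfl hu).trans hi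
  rw [branch, wp_seq, wp_set]
  refine ⟨by simp, ?_⟩
  rw [wp_seq]
  let S' : List ℕ → Finset ℕ := fun l => (P i).filter (· ∉ l)
  have hS'lt : ∀ l, ∀ u ∈ S' l, u < D.n := fun l u hu => hlt0 u (Finset.mem_filter.1 hu).1
  refine wp_each hF (hP.static.setV _ rfl) i (D.nb i).length (fun l s' =>
    Rep D (S' l) i s' ∧ s'.v .f = 0 ∧
      ∀ w, s'.a .REM w = if w ∈ l ∧ w ∈ P i then i + 1 else s.a .REM w)
    (fun w => (if w ∈ P i then flipCost (D.nb w).length + 60 else 0) + 60)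
    (by simp [hv]) (by simp [hv, hP.static.LN i hi]) hi le_rfl (by simp)
    (by simp [hv, Lim.idx]; omega) rfl ?_ ?_ hD ?_
  · exact ⟨(hP.rep.setV _ _).congr_set (by simp [S']), by simp, by simp⟩
  · rintro l y x0 s2 hpre hy hyn hx0 hwt ⟨hI1, hI2, hI3⟩ hfr hS2
    have hyl := nodup_of_prefix hD hpre
    have hyL : y < M.L := by omega
    have i2 : s2.v .i = i := by rw [hfr.v .i rfl]; simp [hv]
    have e3 := hI1.INS y hyn
    have hyS : y ∈ S' l ↔ y ∈ P i := by simp [S', hyl]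
    rw [wp_ite_eq]
    refine ⟨by simp [Lim.idx, hyL]; omega, fun h => ?_, fun h => ?_⟩
    · simp only [eval_get, eval_var, St.setV_v_self, St.setV_a, eval_one, e3, hyS] at h
      have hyP : y ∈ P i := by by_contra hn; simp [hn] at h
      rw [wp_seq, wp_set]
      refine ⟨by simp, ?_⟩
      rw [wp_seq]
      refine wp_mono (wp_flip hD hF (((hS2.setV _ rfl).setV _ rfl).setV _ rfl)
        (((hI1.setV _ _).setV _ _).setV _ _) (hS'lt l) hyn
        (f := 0) (by simp) (by simp [hI2]) (Or.inr ⟨rfl, hyS.2 hyP⟩)) ?_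
      rintro k3 s3 f3 ⟨hk3, hR3⟩
      have ew : s3.v .w1 = y := by rw [f3.v .w1 rfl]; simp
      have ei : s3.v .i = i := by rw [f3.v .i rfl]; simp [i2]
      have ef : s3.v .f = 0 := by rw [f3.v .f rfl]; simp [hI2]
      have eM : s3.a .REM = s2.a .REM := by rw [f3.a .REM rfl]; rfl
      rw [wp_put]
      refine ⟨by simp [ew, ei]; omega, ?_, ?_, by simpa using ef, fun w => ?_⟩
      · simp [hyP]; omega
      · have : Rep D (flipSet 0 y (S' l)) i (s3.setA .REM y (i + 1)) :=
          hR3.frame (c := .put .REM (.lit y) (.lit (i + 1)))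
            (Cmd.frame_run (.put .REM (.lit y) (.lit (i + 1))) s3) rfl
        have h' := this.congr_set (S' := S' (l ++ [y])) (by
          rw [flipSet, if_neg (by simp)]
          ext u
          by_cases hu : u = y
          · subst hu; simp [S']
          · simp [S', hu])
        simpa [ew, ei] using h'
      · by_cases hw : w = y
        · subst hw; simp [ew, ei, hyP]
        · simp [ew, ei, hw, eM, hI3 w]
    · simp only [eval_get, eval_var, St.setV_v_self, St.setV_a, eval_one, e3, hyS] at h
      have hyP : y ∉ P i := by intro hn; simp [hn] at h
      rw [wp_skip]
      refine ⟨by simp, ((hI1.setV _ _).setV _ _).congr_set ?_, by simp [hI2], fun w => ?_⟩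
      · ext u
        by_cases hu : u = y
        · subst hu; simp [S', hyP]
        · simp [S', hu]
      · by_cases hw : w = y
        · subst hw; simp [hyP, hI3 w]
        · simp [hw, hI3 w]
  · rintro k1 s1 f1 hS1 hk1 ⟨hI1, hI2, hI3⟩
    simp only [List.take_length] at hk1 hI1 hI3
    have i1 : s1.v .i = i := by rw [f1.v .i rfl]; simp [hv]
    have hset : S' (D.nb i) = drop D.adj (P i) i := by
      ext u
      simp only [S', drop, Finset.mem_filter, hD.mem_nb]
    have hC1 : Clean s1 := (show Clean (s.setV _ _) from
      ⟨hP.clean.MK, hP.clean.DC, hP.clean.QA⟩).frame f1 rfl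
    rw [wp_seq]
    refine wp_mono (wp_activate hD hF (hI1.congr_set hset) hi i1) ?_
    rintro k2 s2 f2 ⟨hk2, hR2⟩
    have hS2 := hS1.frame f2 rfl
    have i2 : s2.v .i = i := by rw [f2.v .i rfl, i1]
    rw [wp_seq, wp_set]
    refine ⟨by simp, ?_⟩
    rw [wp_seq, wp_set]
    refine ⟨by simp; omega, ?_⟩
    rw [wp_seq]
    have hdn : i ∉ drop D.adj (P i) i := fun h => hin (Finset.mem_filter.1 h).1
    have hdlt : ∀ u ∈ drop D.adj (P i) i, u < D.n := fun u hu => hlt0 u (Finset.mem_filter.1 hu).1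
    refine wp_mono (wp_flip hD hF ((hS2.setV _ rfl).setV _ rfl) ((hR2.setV _ _).setV _ _) hdlt hi
        (f := 1) (by simp [i2]) (by simp) (Or.inl ⟨rfl, hdn⟩)) ?_
    rintro k3 s3 f3 ⟨hk3, hR3⟩
    have hS3 : Static D s3 := ((hS2.setV _ rfl).setV _ rfl).frame f3 rfl
    have i3 : s3.v .i = i := by rw [f3.v .i rfl]; simp [i2]
    have eM : ∀ w, s3.a .REM w = if w ∈ D.nb i ∧ w ∈ P i then i + 1 else s.a .REM w := by
      rw [f3.a .REM rfl]
      simp only [St.setV_a]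
      rw [f2.a .REM rfl]
      exact hI3
    have hC3 : Clean s3 := (show Clean ((s2.setV _ _).setV _ _) from
      (let h := hC1.frame f2 rfl; ⟨h.MK, h.DC, h.QA⟩)).frame f3 rfl
    rw [wp_set]
    refine ⟨by simp [i3]; omega, ?_, by simp [i3], ?_⟩
    · have h1 := sum_map_ite_le (hD.nb_nodup i) (P i) (fun w => flipCost (D.nb w).length + 60) 75
      have h2 : ∑ y ∈ P i, (flipCost (D.nb y).length + 60) ≤
          ∑ j ∈ Finset.range D.n, (flipCost (D.nb j).length + 60) := by
        refine Finset.sum_le_sum_of_subset fun u hu => ?_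
        have := hlt0 u hu
        simpa using this
      have h3 : ∑ j ∈ (Finset.range D.n).erase i, (flipCost (D.nb j).length + 60) +
          (flipCost (D.nb i).length + 60) =
          ∑ j ∈ Finset.range D.n, (flipCost (D.nb j).length + 60) :=
        Finset.sum_erase_add _ _ (by simpa using hi)
      -- Since `i ∉ P i`, the flip of `i` and those of the dropped vertices concern different
      -- vertices, and a single sum over all vertices pays for both.
      have h2' : ∑ y ∈ P i, (flipCost (D.nb y).length + 60) ≤
          ∑ j ∈ (Finset.range D.n).erase i, (flipCost (D.nb j).length + 60) := by
        refine Finset.sum_le_sum_of_subset fun u hu => ?_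
        have := hlt0 u hu
        simp only [Finset.mem_erase, Finset.mem_range]
        exact ⟨fun he => hin (he ▸ hu), this⟩
      have hln := hD.nb_length_le i
      have h4 : ∑ j ∈ Finset.range D.n, (flipCost (D.nb j).length + 300) =
          ∑ j ∈ Finset.range D.n, (flipCost (D.nb j).length + 60) + D.n * 240 := by
        simp only [Finset.sum_add_distrib, Finset.sum_const, Finset.card_range, smul_eq_mul]
        ring
      simp only [add_assoc, Nat.reduceAdd] at hk1 h1
      simp only [cost_var, cost_get, cost_zero, cost_one, cost_add] at hk1 ⊢
      omega
    · set T := insert i (drop D.adj (P i) i) with hT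
      set P' := Function.update P (i + 1) T with hP'
      have hP'le : ∀ m ≤ i, P' m = P m := fun m hm => Function.update_of_ne (by omega) _ _
      have e1 : P' (i + 1) = T := Function.update_self _ _ _
      have hTk : T ∈ kids D.adj i (P i) := by
        rw [kids, if_neg hf, if_pos hvalid]; exact List.mem_cons_of_mem _ (List.mem_singleton.2 hT)
      refine ⟨P', ⟨hS3.setV _ rfl, ?_, hP.path.extend hTk, ?_, ⟨hC3.MK, hC3.DC, hC3.QA⟩⟩, ?_⟩
      · rw [e1]
        exact (hR3.congr_set (by rw [flipSet, if_pos rfl])).setV _ _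
      · intro w m
        simp only [St.setV_a, eM]
        have hmem : w ∈ P i → (w ∉ P' (i + 1) ↔ w ∈ D.nb i) := by
          intro hw
          have hne : w ≠ i := fun he => hin (he ▸ hw)
          rw [e1, hT, Finset.mem_insert, drop, Finset.mem_filter, hD.mem_nb]
          simp [hne, hw]
        split
        · next h =>
          rw [Nat.add_right_cancel_iff]
          constructor
          · rintro rfl
            exact ⟨Nat.lt_succ_self _, by rw [hP'le _ le_rfl]; exact h.2, (hmem h.2).2 h.1⟩
          · rintro ⟨h1, h2, h3⟩
            rcases Nat.lt_succ_iff_lt_or_eq.1 h1 with h1 | rfl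
            · rw [hP'le m (by omega)] at h2
              rw [hP'le (m + 1) (by omega)] at h3
              -- A vertex still present in `P i` was not removed earlier, so writing its entry of
              -- `REM` destroys no information.
              exact absurd h.2 (hP.path.notMem_of_removed h2 h3 h1 le_rfl)
            · rfl
        · next h =>
          rw [hP.rem w m]
          constructor
          · rintro ⟨h1, h2, h3⟩
            exact ⟨by omega, by rwa [hP'le m (by omega)], by rwa [hP'le (m + 1) (by omega)]⟩
          · rintro ⟨h1, h2, h3⟩
            rcases Nat.lt_succ_iff_lt_or_eq.1 h1 with h1 | rfl
            · rw [hP'le m (by omega)] at h2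
              rw [hP'le (m + 1) (by omega)] at h3
              exact ⟨h1, h2, h3⟩
            · rw [hP'le m le_rfl] at h2
              exact absurd ⟨(hmem h2).1 h3, h2⟩ h
      · rw [remaining, e1, todo, pend, e1, todo_congr hP'le]
        simp [hT]

/-- What holds between the levels on the way back; `R` are the sets still to be written. -/
def Back (D : Dat) (P : ℕ → Finset ℕ) (R : List (Finset ℕ)) (l : ℕ) (s : St) : Prop :=
  (s.v .found = 0 ∧ Pos D P l s ∧ todo D.adj D.n P l = R) ∨
  (s.v .found = 1 ∧ ∃ i < D.n, s.v .i = i ∧ Pos D P i s ∧ ¬ Free D.adj (P i) i ∧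
    Valid D.adj (P i) i ∧
    R = leaves D.adj (D.n - (i + 1)) (i + 1) (insert i (drop D.adj (P i) i)) ++
      todo D.adj D.n P i)

theorem Pos.setV {P : ℕ → Finset ℕ} {l : ℕ} {s : St} (h : Pos D P l s) {x : Var} (k : ℕ)
    (hx : (Cmd.set x 0).keeps = true) : Pos D P l (s.setV x k) :=
  ⟨h.static.setV k hx, h.rep.setV x k, h.path, h.rem, ⟨h.clean.MK, h.clean.DC, h.clean.QA⟩⟩

noncomputable def backCost (D : Dat) (P : ℕ → Finset ℕ) (i : ℕ) : ℕ :=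
  D.testCost i + 350 * (D.nb i).length + 400 + restoreCost D P i

theorem wp_backward (hD : D.Good) (hF : Fits M D) {s : St} {P : ℕ → Finset ℕ}
    (hP : Pos D P D.n s) :
    wp M backward s (fun k s' => k ≤ 20 + ∑ i ∈ Finset.range D.n, (backCost D P i + 5) ∧
      Back D P (todo D.adj D.n P D.n) 0 s') := by
  have hFn := hF.n
  have hFW := hF.W
  rw [backward, wp_seq, wp_set]
  refine ⟨by simp, ?_⟩
  refine wp_loop 0 D.n (fun a s' => Back D P (todo D.adj D.n P D.n) (D.n - a) s')
    (fun a => backCost D P (D.n - 1 - a)) (by simp) (by simp [hP.static.vn]) (Nat.zero_le _)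
    (by simp) (by simp) (Or.inl ⟨by simp, hP.setV _ rfl, rfl⟩) ?_ ?_
  · intro a s1 _ ha hI f1
    rw [wp_ite_eq]
    refine ⟨by simp; omega, fun h => ?_, fun h => ?_⟩
    · simp only [eval_var, eval_one, ne_eq, reduceCtorEq, not_false_eq_true, St.setV_v_ne] at h
      rcases hI with ⟨h', -⟩ | ⟨hfd, i, hi, hv, hp, h1, h2, h3⟩
      · omega
      · rw [wp_skip]
        refine ⟨by simp [backCost]; omega, Or.inr ⟨by simpa using hfd, i, hi, by simpa using hv,
          hp.setV _ rfl, h1, h2, h3⟩⟩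
    · simp only [eval_var, eval_one, ne_eq, reduceCtorEq, not_false_eq_true, St.setV_v_ne] at h
      rcases hI with ⟨hfd, hp, ht⟩ | ⟨hfd, -⟩
      swap
      · exact absurd hfd h
      have vn : s1.v .n = D.n := hp.static.vn
      rw [wp_seq, wp_set]
      refine ⟨by simp; omega, ?_⟩
      obtain ⟨i, hi⟩ : ∃ i, D.n - a = i + 1 := ⟨D.n - a - 1, by omega⟩
      have hia : D.n - 1 - a = i := by omega
      have hin : i < D.n := by omega
      have hia' : D.n - (a + 1) = i := by omega
      rw [hi] at hp ht
      have hev : (Ex.var .n - 1 - Ex.var .a1).eval (s1.setV .a1 a) = i := by simp [vn, hia]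
      rw [hev]
      set s2 := (s1.setV .a1 a).setV .i i with hs2
      have hp2 : Pos D P (i + 1) s2 := (hp.setV _ rfl).setV _ rfl
      have v2 : s2.v .i = i := by simp [hs2]
      have fd2 : s2.v .found = 0 := by simp [hs2, hfd]
      have eI := hp2.rep.INS i hin
      rw [hia, hia']
      rw [wp_ite_eq]
      refine ⟨by simp [Lim.idx, v2]; omega, fun h => ?_, fun h => ?_⟩
      · simp only [eval_get, eval_var, eval_one, v2, eI] at h
        have hiP : i ∈ P (i + 1) := by by_contra hn; simp [hn] at h
        refine wp_mono (wp_undo hD hF hp2 hin v2 hiP) ?_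
        rintro k s3 f3 ⟨hk, hp3⟩
        refine ⟨by simp [backCost]; omega, Or.inl ⟨by rw [f3.v .found rfl, fd2], hp3, ?_⟩⟩
        -- The path already went to the child containing `i`; nothing is pending at this level.
        rw [← ht, todo, pend, if_neg (fun h => h.1 hiP), List.nil_append]
      · simp only [eval_get, eval_var, eval_one, v2, eI] at h
        have hiP : i ∉ P (i + 1) := by intro hn; simp [hn] at h
        have heq := hp2.path.eq_of_notMem (Nat.lt_succ_self i) hiP
        have hlt0 : ∀ u ∈ P i, u < D.n := fun u hu =>
          (hp2.path.lt (Nat.le_succ i) hu).trans hin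
        rw [wp_seq]
        refine wp_mono (wp_deactivate hD hF (hp2.rep.congr_set heq) hlt0 hin v2) ?_
        rintro k3 s3 f3 ⟨hk3, hR3⟩
        have hS3 := hp2.static.frame f3 rfl
        have v3 : s3.v .i = i := by rw [f3.v .i rfl, v2]
        have hM3 : Rem P i s3 := ((Rem.succ (by rw [heq])).1 hp2.rem).frame f3 rfl
        rw [wp_seq]
        refine wp_mono (wp_test hD hF hS3 hR3 (hp2.clean.frame f3 rfl) hin v3) ?_
        rintro k4 s4 f4 ⟨hk4, hC4, hXY⟩
        have v4 : s4.v .i = i := by rw [f4.v .i rfl, v3]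
        have fd4 : s4.v .found = 0 := by rw [f4.v .found rfl, f3.v .found rfl, fd2]
        have hp4 : Pos D P i s4 := ⟨hS3.frame f4 rfl, hR3.frame f4 rfl,
          hp2.path.mono (Nat.le_succ i), hM3.frame f4 rfl, hC4⟩
        rw [wp_ite_eq]
        refine ⟨by simp, fun h => ?_, fun h => ?_⟩
        · have hv := hXY.1 (by simpa using h)
          rw [wp_set]
          refine ⟨by simp; omega, by simp [backCost]; omega, Or.inr ⟨by simp, i, hin,
            by simpa using v4, hp4.setV _ rfl, fun hf => ?_, hv, ?_⟩⟩
          -- If `i` were free, its node would have only the child containing `i`, and the path would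
          -- contain it.
          · have := hp2.path.succ i (Nat.lt_succ_self i)
            rw [kids, if_pos hf, List.mem_singleton] at this
            exact hiP (this ▸ Finset.mem_insert_self _ _)
          · rw [← ht, todo, pend, if_pos ⟨hiP, hv⟩]
        · have hv : ¬ Valid D.adj (P i) i := fun hv => h (by simpa using hXY.2 hv)
          rw [wp_skip]
          refine ⟨by simp [backCost]; omega, Or.inl ⟨fd4, hp4, ?_⟩⟩
          rw [← ht, todo, pend, if_neg (fun h => hv h.2), List.nil_append]
  · intro k s' _ hk hI
    refine ⟨?_, by simpa using hI⟩
    have : ∑ x ∈ Finset.Ico 0 D.n, (5 + backCost D P (D.n - 1 - x)) =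
        ∑ i ∈ Finset.range D.n, (backCost D P i + 5) := by
      rw [Nat.Ico_zero_eq_range, ← Finset.sum_range_reflect (fun i => backCost D P i + 5)]
      exact Finset.sum_congr rfl fun _ _ => add_comm _ _
    rw [this] at hk
    simp only [cost_zero, cost_var] at hk ⊢
    omega

/-- The sets removed at different levels are disjoint, so restoring all of them costs no more than
flipping every vertex once. -/
theorem sum_restoreCost_le {P : ℕ → Finset ℕ} (hP : IsPath D.adj D.n P) :
    ∑ i ∈ Finset.range D.n, restoreCost D P i ≤
      ∑ w ∈ Finset.range D.n, (flipCost (D.nb w).length + 100) := by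
  unfold restoreCost
  rw [← Finset.sum_biUnion]
  · refine Finset.sum_le_sum_of_subset fun w hw => ?_
    obtain ⟨i, hi, hw⟩ := Finset.mem_biUnion.1 hw
    have hi := Finset.mem_range.1 hi
    rw [Finset.mem_range]
    exact (hP.lt hi.le (Finset.mem_sdiff.1 hw).1).trans hi
  · intro i hi i' hi' hne
    have hi := Finset.mem_range.1 (Finset.mem_coe.1 hi)
    have hi' := Finset.mem_range.1 (Finset.mem_coe.1 hi')
    refine Finset.disjoint_left.2 fun w hw hw' => ?_
    rw [Finset.mem_sdiff] at hw hw'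
    rcases lt_or_gt_of_ne hne with h | h
    · exact hP.notMem_of_removed hw.1 hw.2 h hi'.le hw'.1
    · exact hP.notMem_of_removed hw'.1 hw'.2 h hi.le hw.1

def Dat.roundCost (D : Dat) : ℕ := 10 * ∑ j ∈ Finset.range D.n, D.testCost j + 1000

/-- The bound for the tests absorbs all work linear in the degrees; this makes the factor `10` in
`roundCost` sufficient. -/
theorem le_testCost (j : ℕ) : 500 * ((D.nb j).length + 1) ≤ D.testCost j := by
  unfold Dat.testCost
  exact Nat.mul_le_mul (by omega) (by omega)

/-- The memory at the beginning of a round; `R` are the sets still to be written. -/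
def Ready (D : Dat) (R : List (Finset ℕ)) (s : St) : Prop :=
  ∃ P l, l ≤ D.n ∧ s.v .lvl = l ∧ Pos D P l s ∧ remaining D P l = R

theorem wp_round (hD : D.Good) (hF : Fits M D) {s : St} {R : List (Finset ℕ)}
    (hR : Ready D R s) :
    wp M round s (fun k s' => k ≤ D.roundCost ∧ ∃ S R', R = S :: R' ∧
      s'.out = s.out ++ written D.n S ∧
      (s'.v .alive = 1 ∧ Ready D R' s' ∨ s'.v .alive = 0 ∧ R' = [])) := by
  have hFn := hF.n
  have hFW := hF.W
  obtain ⟨P0, l, hl, hlvl, hP0, rfl⟩ := hR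
  rw [round, wp_seq]
  refine wp_mono (wp_forward hD hF hP0 hl hlvl) ?_
  rintro k1 s1 f1 ⟨hk1, P, hP, hrem⟩
  rw [wp_seq]
  refine wp_mono (wp_emit_set hF hP.static hP.rep) ?_
  rintro k2 s2 f2 ⟨hk2, hout⟩
  have hP2 : Pos D P D.n s2 := ⟨hP.static.frame f2 rfl, hP.rep.frame f2 rfl, hP.path,
    hP.rem.frame f2 rfl, hP.clean.frame f2 rfl⟩
  rw [wp_seq]
  refine wp_mono (wp_backward hD hF hP2) ?_
  rintro k3 s3 f3 ⟨hk3, hB⟩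
  have o1 : s1.out = s.out := f1.out rfl
  have o3 : s3.out = s2.out := f3.out rfl
  -- At level `n` the only leaf below the node is the node itself, which is the set written in this
  -- round.
  have hrem' : remaining D P0 l = P D.n :: todo D.adj D.n P D.n := by
    rw [← hrem, remaining, Nat.sub_self, leaves]; rfl
  have hsum : k1 + k2 + k3 + (400 + ∑ j ∈ Finset.range D.n, (flipCost (D.nb j).length + 300)) +
      100 ≤ D.roundCost := by
    have h1 := sum_restoreCost_le hP.path
    have h2 : ∑ i ∈ Finset.range D.n, (backCost D P i + 5) =
        ∑ i ∈ Finset.range D.n, (D.testCost i + 350 * (D.nb i).length + 405) +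
        ∑ i ∈ Finset.range D.n, restoreCost D P i := by
      rw [← Finset.sum_add_distrib]
      refine Finset.sum_congr rfl fun i _ => ?_
      rw [backCost]; ring
    have h3 : 30 * D.n = ∑ i ∈ Finset.range D.n, 30 := by simp [mul_comm]
    have h4 : ∑ j ∈ Finset.range D.n, (flipCost (D.nb j).length + 150) +
        ∑ i ∈ Finset.range D.n, 30 +
        (∑ i ∈ Finset.range D.n, (D.testCost i + 350 * (D.nb i).length + 405) +
          ∑ w ∈ Finset.range D.n, (flipCost (D.nb w).length + 100)) +
        ∑ j ∈ Finset.range D.n, (flipCost (D.nb j).length + 300) ≤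
        10 * ∑ j ∈ Finset.range D.n, D.testCost j := by
      rw [Finset.mul_sum, ← Finset.sum_add_distrib, ← Finset.sum_add_distrib,
        ← Finset.sum_add_distrib, ← Finset.sum_add_distrib]
      refine Finset.sum_le_sum fun i _ => ?_
      have := le_testCost (D := D) i
      simp only [flipCost]
      generalize D.testCost i = t at *
      generalize (D.nb i).length = d at *
      clear hk1 hk2 hk3 h1 h2 h3
      linarith
    rw [Dat.roundCost]
    omega
  rcases hB with ⟨hf, hp3, ht⟩ | ⟨hf, i, hi, hv, hp3, h1, h2, h3⟩
  · rw [wp_seq, wp_ite_eq]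
    refine ⟨by simp; omega, fun h => by simp [hf] at h, fun h => ?_⟩
    rw [wp_skip, wp_set]
    refine ⟨by simp, by simp; omega, _, _, hrem', by simp [o3, hout, o1], Or.inr ⟨by simp [hf], ?_⟩⟩
    rw [← ht, todo]
  · rw [wp_seq, wp_ite_eq]
    refine ⟨by simp; omega, fun h => ?_, fun h => absurd (by simpa using hf) h⟩
    refine wp_mono (wp_branch hD hF hp3 hi hv h1 h2) ?_
    rintro k4 s4 f4 ⟨hk4, hl4, P', hP', hr'⟩
    have o4 : s4.out = s3.out := f4.out rfl
    have fd4 : s4.v .found = 1 := by rw [f4.v .found rfl, hf]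
    rw [wp_set]
    refine ⟨by simp, by simp; omega, _, _, hrem', by simp [o4, o3, hout, o1], Or.inl ⟨by simp [fd4],
      P', i + 1, by omega, by simpa using hl4, hP'.setV _ rfl, by rw [hr', h3]⟩⟩

end Round
end Loop

/-! ## Preprocessing -/

namespace Loop

/-- `d` changes nothing that `c` does not change. -/
structure Cmd.Within (d c : Cmd) : Prop where
  v : ∀ x, c.wv x = false → d.wv x = false
  a : ∀ x, c.wa x = false → d.wa x = false
  o : c.wo = false → d.wo = false

theorem Frame.step {c d : Cmd} {s s' s'' : St} (h : Frame c s s') (h' : Frame d s' s'')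
    (hd : d.Within c) : Frame c s s'' :=
  ⟨fun x hx => (h'.v x (hd.v x hx)).trans (h.v x hx),
    fun x hx => (h'.a x (hd.a x hx)).trans (h.a x hx),
    fun ho => (h'.out (hd.o ho)).trans (h.out ho)⟩

theorem Frame.refl (c : Cmd) (s : St) : Frame c s s := ⟨fun _ _ => rfl, fun _ _ => rfl, fun _ => rfl⟩

theorem Frame.stepV {c : Cmd} {s s' : St} (h : Frame c s s') {x : Var} (k : ℕ)
    (hx : c.wv x = true) : Frame c s (s'.setV x k) := by
  refine ⟨fun y hy => ?_, h.a, h.out⟩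
  rw [St.setV_v_ne]
  · exact h.v y hy
  · rintro rfl; rw [hx] at hy; exact absurd hy (by simp)

/-- The lists of out-neighbours of an oriented graph. -/
structure Oriented (n : ℕ) (O : ℕ → List ℕ) : Prop where
  lt : ∀ u, ∀ w ∈ O u, w < n ∧ u < n
  nodup : ∀ u, (O u).Nodup
  asymm : ∀ u, ∀ w ∈ O u, u ∉ O w

def size (O : ℕ → List ℕ) (v : ℕ) : ℕ := ∑ u ∈ Finset.range v, (O u).length

/-- The position of the data of `v` in the input. -/
def pos (O : ℕ → List ℕ) (v : ℕ) : ℕ := 1 + ∑ u ∈ Finset.range v, ((O u).length + 1)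

theorem pos_succ (O : ℕ → List ℕ) (v : ℕ) : pos O (v + 1) = pos O v + ((O v).length + 1) := by
  rw [pos, Finset.sum_range_succ, ← add_assoc]; rfl

theorem pos_mono (O : ℕ → List ℕ) {v v' : ℕ} (h : v ≤ v') : pos O v ≤ pos O v' :=
  Nat.add_le_add_left (Finset.sum_le_sum_of_subset (Finset.range_subset_range.2 h)) 1

theorem pos_eq (O : ℕ → List ℕ) (v : ℕ) : pos O v = 1 + v + size O v := by
  rw [pos, Finset.sum_add_distrib, size]; simp; ring

/-- The array `inp` holds the graph. -/
structure Inp (n : ℕ) (O : ℕ → List ℕ) (s : St) : Prop where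
  zero : s.a .inp 0 = n
  deg : ∀ v < n, s.a .inp (pos O v) = (O v).length
  nbr : ∀ v < n, ∀ t (h : t < (O v).length), s.a .inp (pos O v + 1 + t) = (O v)[t]

theorem Inp.congr {n : ℕ} {O : ℕ → List ℕ} {s s' : St} (h : Inp n O s)
    (hs : s'.a .inp = s.a .inp) : Inp n O s' :=
  ⟨by rw [hs]; exact h.zero, by rw [hs]; exact h.deg, by rw [hs]; exact h.nbr⟩

/-- `pre` and `body` are allowed in `edges`. -/
def edgesOk (pre body : Cmd) : Bool :=
  !(pre.wv .p || pre.wv .d || pre.wv .v || pre.wa .inp ||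
    body.wv .p || body.wv .d || body.wv .v || body.wa .inp)

/-- `I v` holds before vertex `v` is treated, and `J v l` after its arcs to `l`. The condition
`edgesOk` protects the position `p`, the degree `d`, the vertex `v` and the input from the inserted
commands. -/
theorem wp_edges {M : Lim} {n : ℕ} {O : ℕ → List ℕ} {s : St} (hI : Inp n O s)
    (hB : pos O n ≤ M.B) (hW : M.B + 2 ≤ M.W) (vn : s.v .n = n) {pre body : Cmd}
    {Q : ℕ → St → Prop} (I : ℕ → St → Prop) (J : ℕ → List ℕ → St → Prop) (kp kb : ℕ)
    (hok : edgesOk pre body = true) (h0 : I 0 (s.setV .p 1))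
    (hpre : ∀ v < n, ∀ s', I v s' → Frame (edges pre body) s s' →
      wp M pre ((s'.setV .v v).setV .d (O v).length) (fun k s'' => k ≤ kp ∧ J v [] s''))
    (hbody : ∀ v < n, ∀ l w e s', l ++ [w] <+: O v → w ∈ O v → s'.v .v = v → J v l s' →
      Frame (edges pre body) s s' →
      wp M body ((s'.setV .e e).setV .w w) (fun k s'' => k ≤ kb ∧ J v (l ++ [w]) s''))
    (hend : ∀ v < n, ∀ s' p, J v (O v) s' → Frame (edges pre body) s s' → I (v + 1) (s'.setV .p p))
    (hQ : ∀ k s', Frame (edges pre body) s s' →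
      k ≤ 20 + n * (kp + 40) + size O n * (kb + 20) → I n s' → Q k s') :
    wp M (edges pre body) s Q := by
  simp only [edgesOk, Bool.not_eq_true', Bool.or_eq_false_iff] at hok
  obtain ⟨⟨⟨⟨⟨⟨⟨o1, o2⟩, o3⟩, o4⟩, o5⟩, o6⟩, o7⟩, o8⟩ := hok
  set c := edges pre body with hc
  have hwv : ∀ x, c.wv x = (decide (x = .p) || (decide (x = .v) || (decide (x = .d) || (pre.wv x ||
      ((decide (x = .e) || (decide (x = .w) || body.wv x)) || decide (x = .p)))))) := fun _ => rfl
  have hwa : ∀ x, c.wa x = (false || (false || (pre.wa x || ((false || body.wa x) || false)))) :=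
    fun _ => rfl
  have hwo : c.wo = (false || (false || (pre.wo || ((false || body.wo) || false)))) := rfl
  have wpre : pre.Within c := by
    refine ⟨fun x hx => ?_, fun x hx => ?_, fun hx => ?_⟩
    · rw [hwv] at hx; simp only [Bool.or_eq_false_iff] at hx; tauto
    · rw [hwa] at hx; simp only [Bool.or_eq_false_iff] at hx; tauto
    · rw [hwo] at hx; simp only [Bool.or_eq_false_iff] at hx; tauto
  have cv : c.wv .v = true := by rw [hwv]; simp
  have cd : c.wv .d = true := by rw [hwv]; simp
  have cp : c.wv .p = true := by rw [hwv]; simp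
  have ca : c.wa .inp = false := by rw [hwa, o4, o8]; rfl
  have inpEq : ∀ {s'}, Frame c s s' → Inp n O s' := fun h => hI.congr (h.a _ ca)
  have hBn := pos_eq O n
  rw [hc, edges, wp_seq, wp_set]
  refine ⟨by simp; omega, ?_⟩
  refine wp_loop 0 n (fun v s' => I v s' ∧ s'.v .p = pos O v)
    (fun v => kp + 32 + (O v).length * (kb + 15)) (by simp) (by simp [vn]) (Nat.zero_le _) (by simp)
    (by simp) ⟨by simpa using h0, by simp [pos]⟩ ?_ ?_
  · rintro v s1 - hv ⟨hI1, hp1⟩ f1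
    have F1 : Frame c s s1 := ((Frame.refl c s).stepV _ cp).step f1 (by
      refine ⟨fun x hx => ?_, fun x hx => ?_, fun hx => ?_⟩
      · rw [hwv] at hx; rw [Bool.or_eq_false_iff] at hx; exact hx.2
      · rw [hwa] at hx; rw [Bool.or_eq_false_iff] at hx; exact hx.2
      · rw [hwo] at hx; rw [Bool.or_eq_false_iff] at hx; exact hx.2)
    have ed : (Ex.get .inp (.var .p)).eval (s1.setV .v v) = (O v).length := by
      simp [hp1, (inpEq F1).deg v hv]
    have hps := pos_succ O v
    have hpm := pos_mono O (show v + 1 ≤ n from hv)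
    rw [wp_seq, wp_set]
    refine ⟨by simp [hp1, Lim.idx]; omega, ?_⟩
    rw [ed, wp_seq]
    refine wp_mono (hpre v hv s1 hI1 F1) ?_
    rintro k2 s2 f2 ⟨hk2, hJ2⟩
    have F2 : Frame c s s2 := ((F1.stepV v cv).stepV _ cd).step f2 wpre
    have p2 : s2.v .p = pos O v := by rw [f2.v .p o1]; simp [hp1]
    have d2 : s2.v .d = (O v).length := by rw [f2.v .d o2]; simp
    have v2 : s2.v .v = v := by rw [f2.v .v o3]; simp
    rw [wp_seq]
    refine wp_loop (pos O v + 1) (pos O v + 1 + (O v).length)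
      (fun e s' => J v ((O v).take (e - (pos O v + 1))) s' ∧ s'.v .p = pos O v ∧
        s'.v .d = (O v).length ∧ s'.v .v = v) (fun _ => kb + 10) (by simp [p2])
      (by simp [p2, d2]; ring) (by omega) (by simp [p2]; omega) (by simp [p2, d2]; omega)
      ⟨by simpa using hJ2, p2, d2, v2⟩ ?_ ?_
    · rintro e s3 he1 he2 ⟨hJ3, p3, d3, v3⟩ f3
      have F3 : Frame c s s3 := F2.step f3 (by
        refine ⟨fun x hx => ?_, fun x hx => ?_, fun hx => ?_⟩
        · rw [hwv] at hx; simp only [Bool.or_eq_false_iff] at hx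
          change (decide (x = .e) || (decide (x = .w) || body.wv x)) = false
          simp only [Bool.or_eq_false_iff]; tauto
        · rw [hwa] at hx; simp only [Bool.or_eq_false_iff] at hx
          change (false || body.wa x) = false
          simp only [Bool.or_eq_false_iff]; tauto
        · rw [hwo] at hx; simp only [Bool.or_eq_false_iff] at hx
          change (false || body.wo) = false
          simp only [Bool.or_eq_false_iff]; tauto)
      obtain ⟨t, rfl⟩ := Nat.exists_eq_add_of_le he1
      have ht : t < (O v).length := by omega
      simp only [Nat.add_sub_cancel_left, show pos O v + 1 + t + 1 - (pos O v + 1) = t + 1 by omega]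
        at hJ3 ⊢
      have ew : (Ex.get .inp (.var .e)).eval (s3.setV .e (pos O v + 1 + t)) = (O v)[t] := by
        simp [(inpEq F3).nbr v hv t ht]
      rw [wp_seq, wp_set]
      refine ⟨by simp [Lim.idx]; omega, ?_⟩
      rw [ew]
      have e2 : (O v).take t ++ [(O v)[t]] = (O v).take (t + 1) := by
        rw [List.take_append_getElem]
      refine wp_mono (hbody v hv _ _ _ s3 (by rw [e2]; exact List.take_prefix _ _)
        (List.getElem_mem ht) v3 hJ3 F3) ?_
      rintro k s4 f4 ⟨hk, hJ4⟩
      rw [e2] at hJ4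
      refine ⟨by simp; omega, hJ4, ?_, ?_, ?_⟩
      · rw [f4.v .p o5]; simp [p3]
      · rw [f4.v .d o6]; simp [d3]
      · rw [f4.v .v o7]; simp [v3]
    · rintro k3 s3 f3 hk3 ⟨hJ3, p3, d3, v3⟩
      have F3 : Frame c s s3 := F2.step f3 (by
        refine ⟨fun x hx => ?_, fun x hx => ?_, fun hx => ?_⟩
        · rw [hwv] at hx; simp only [Bool.or_eq_false_iff] at hx
          change (decide (x = .e) || (decide (x = .w) || body.wv x)) = false
          simp only [Bool.or_eq_false_iff]; tauto
        · rw [hwa] at hx; simp only [Bool.or_eq_false_iff] at hx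
          change (false || body.wa x) = false
          simp only [Bool.or_eq_false_iff]; tauto
        · rw [hwo] at hx; simp only [Bool.or_eq_false_iff] at hx
          change (false || body.wo) = false
          simp only [Bool.or_eq_false_iff]; tauto)
      simp only [Nat.add_sub_cancel_left, List.take_length] at hJ3
      rw [wp_set]
      refine ⟨by simp [p3, d3]; omega, ?_, hend v hv s3 _ hJ3 F3, by simp [p3, d3, hps]⟩
      simp only [Finset.sum_const, Nat.card_Ico, smul_eq_mul, cost_var, cost_add, cost_one,
        Nat.add_sub_cancel_left] at hk3
      simp only [cost_var, cost_add, cost_one, cost_get]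
      have : (O v).length * (5 + (kb + 10)) = (O v).length * (kb + 15) := by ring
      omega
  · rintro k1 s1 f1 hk1 ⟨hI1, -⟩
    have F1 : Frame c s s1 := ((Frame.refl c s).stepV _ cp).step f1 (by
      refine ⟨fun x hx => ?_, fun x hx => ?_, fun hx => ?_⟩
      · rw [hwv] at hx; rw [Bool.or_eq_false_iff] at hx; exact hx.2
      · rw [hwa] at hx; rw [Bool.or_eq_false_iff] at hx; exact hx.2
      · rw [hwo] at hx; rw [Bool.or_eq_false_iff] at hx; exact hx.2)
    refine hQ _ _ F1 ?_ hI1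
    have : ∑ x ∈ Finset.Ico 0 n, (5 + (kp + 32 + (O x).length * (kb + 15))) =
        n * (kp + 37) + size O n * (kb + 15) := by
      rw [Nat.Ico_zero_eq_range, size, Finset.sum_mul]
      simp only [Finset.sum_add_distrib, Finset.sum_const, Finset.card_range, smul_eq_mul]
      ring
    rw [this] at hk1
    have h1 : n * (kp + 37) ≤ n * (kp + 40) := Nat.mul_le_mul_left _ (by omega)
    have h2 : size O n * (kb + 15) ≤ size O n * (kb + 20) := Nat.mul_le_mul_left _ (by omega)
    simp only [cost_zero, cost_var, cost_one] at hk1 ⊢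
    omega

/-! ### The parameters -/

/-- The maximum of `1` and the first `v` out-degrees. -/
def maxDeg (O : ℕ → List ℕ) (v : ℕ) : ℕ := max 1 ((Finset.range v).sup fun u => (O u).length)

theorem maxDeg_succ (O : ℕ → List ℕ) (v : ℕ) :
    maxDeg O (v + 1) = max (maxDeg O v) (O v).length := by
  rw [maxDeg, maxDeg, Finset.range_add_one, Finset.sup_insert, max_assoc]
  congr 1
  exact max_comm _ _

theorem length_le_maxDeg (O : ℕ → List ℕ) {n v : ℕ} (hv : v < n) : (O v).length ≤ maxDeg O n :=
  (Finset.le_sup (f := fun u => (O u).length) (Finset.mem_range.2 hv)).trans (le_max_right _ _)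

theorem wp_prepare₀ {M : Lim} {n : ℕ} {O : ℕ → List ℕ} {s : St} (hI : Inp n O s)
    (hB : pos O n ≤ M.B) (hW : M.B + 2 ≤ M.W) :
    wp M prepare₀ s (fun k s' => k ≤ 60 * n + 60 ∧ s'.v .n = n ∧ s'.v .K = maxDeg O n ∧
      s'.v .p = pos O n) := by
  have hBn := pos_eq O n
  rw [prepare₀, wp_seq, wp_set]
  refine ⟨by simp [Lim.idx]; omega, ?_⟩
  rw [wp_seq, wp_set]
  refine ⟨by simp; omega, ?_⟩
  rw [wp_seq, wp_set]
  refine ⟨by simp; omega, ?_⟩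
  refine wp_loop 0 n (fun v s' => s'.v .p = pos O v ∧ s'.v .K = maxDeg O v) (fun _ => 50)
    (by simp) (by simp [hI.zero]) (Nat.zero_le _) (by simp) (by simp) (by simp [pos, maxDeg]) ?_ ?_
  · rintro v s1 - hv ⟨h1, h2⟩ f1
    have hps := pos_succ O v
    have hpm := pos_mono O (show v + 1 ≤ n from hv)
    have ei : s1.a .inp (pos O v) = (O v).length := by
      rw [f1.a .inp rfl]; exact hI.deg v hv
    rw [maxDeg_succ, hps]
    by_cases hK : maxDeg O v < (O v).length
    · simp [Lim.idx, h1, h2, ei, hK, hK.le, hK.not_ge]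
      omega
    · simp [Lim.idx, h1, h2, ei, hK, not_lt.1 hK]
      omega
  · rintro k s1 f1 hk ⟨h1, h2⟩
    refine ⟨?_, ?_, h2, h1⟩
    · simp only [Finset.sum_const, Nat.card_Ico, smul_eq_mul, cost_zero, cost_var, cost_one,
        cost_get] at hk ⊢
      omega
    · rw [f1.v .n rfl]; simp [hI.zero]

/-- The in-degree of `w`, only the first `v` vertices counted. -/
def indeg (O : ℕ → List ℕ) (v w : ℕ) : ℕ := ((List.range v).filter fun u => w ∈ O u).length

theorem indeg_succ (O : ℕ → List ℕ) (v w : ℕ) :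
    indeg O (v + 1) w = indeg O v w + if w ∈ O v then 1 else 0 := by
  rw [indeg, indeg, List.range_succ, List.filter_append, List.length_append]
  by_cases h : w ∈ O v <;> simp [h]

theorem indeg_le (O : ℕ → List ℕ) (v w : ℕ) : indeg O v w ≤ v :=
  (List.length_filter_le _ _).trans (by simp)

theorem sum_indeg {n : ℕ} {O : ℕ → List ℕ} (hO : Oriented n O) (v : ℕ) :
    ∑ w ∈ Finset.range n, indeg O v w = size O v := by
  induction v with
  | zero => simp [indeg, size]
  | succ v ih =>
    simp only [indeg_succ, Finset.sum_add_distrib, ih]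
    rw [size, size, Finset.sum_range_succ, Finset.sum_boole]
    congr 1
    rw [← List.toFinset_card_of_nodup (hO.nodup v)]
    simp only [Nat.cast_id]
    congr 1
    ext w
    simp only [Finset.mem_filter, Finset.mem_range, List.mem_toFinset]
    exact ⟨fun h => h.2, fun h => ⟨(hO.lt v w h).1, h⟩⟩

theorem notMem_of_prefix {l m : List ℕ} {y : ℕ} (hm : m.Nodup) (h : l ++ [y] <+: m) : y ∉ l := by
  have hnd := hm.sublist h.sublist
  rw [List.nodup_append] at hnd
  exact fun h' => hnd.2.2 y h' y (List.mem_singleton_self y) rfl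

theorem wp_deg {M : Lim} {n : ℕ} {O : ℕ → List ℕ} {s : St} (hO : Oriented n O) (hI : Inp n O s)
    (hB : pos O n ≤ M.B) (hW : M.B + 2 ≤ M.W) (hL : n + 2 ≤ M.L) (hWL : M.L ≤ M.W)
    (vn : s.v .n = n) (h0 : ∀ w, s.a .ID w = 0) :
    wp M degCmd s (fun k s' => k ≤ 20 + 100 * n + 100 * size O n ∧
      (∀ w < n, s'.a .OD w = (O w).length) ∧ ∀ w < n, s'.a .ID w = indeg O n w) := by
  refine wp_edges hI hB hW vn
    (fun v s' => (∀ w < v, s'.a .OD w = (O w).length) ∧ ∀ w < n, s'.a .ID w = indeg O v w)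
    (fun v l s' => (∀ w < v + 1, s'.a .OD w = (O w).length) ∧
      ∀ w < n, s'.a .ID w = indeg O v w + if w ∈ l then 1 else 0) 20 30 rfl ?_ ?_ ?_ ?_ ?_
  · simp [h0, indeg]
  · rintro v hv s1 ⟨h1, h2⟩ -
    have hvL : v < M.L := by omega
    simp [hvL]
    refine ⟨fun w hw => ?_, h2⟩
    rcases Nat.lt_or_eq_of_le hw with h | rfl
    · rw [Function.update_of_ne (by omega)]; exact h1 w h
    · simp
  · rintro v hv l w e s1 hpre hw hvv ⟨h1, h2⟩ -
    have hwn := (hO.lt v w hw).1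
    have hwL : w < M.L := by omega
    have hwl := notMem_of_prefix (hO.nodup v) hpre
    have e1 := h2 w hwn
    rw [if_neg hwl, add_zero] at e1
    have := indeg_le O v w
    have hb : s1.a .ID w + 1 ≤ M.W := by omega
    have hW1 : 1 ≤ M.W := by omega
    simp [Lim.idx, hwL, hb, hW1]
    refine ⟨fun w hw => h1 w (by omega), fun u hu => ?_⟩
    by_cases h : u = w
    · subst h; simp [e1]
    · simp [h, h2 u hu]
  · rintro v hv s1 p ⟨h1, h2⟩ -
    refine ⟨h1, fun w hw => ?_⟩
    rw [indeg_succ]; exact h2 w hw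
  · rintro k s1 - hk ⟨h1, h2⟩
    refine ⟨?_, h1, h2⟩
    omega

/-- `r` is the least positive number with `n ≤ r ^ K`. -/
structure IsRoot (n K r : ℕ) : Prop where
  pos : 1 ≤ r
  le : n ≤ r ^ K
  lt : r = 1 ∨ (r - 1) ^ K < n

/-- For `r ≥ 2` one has `r ≤ 2 * (r - 1)`, so rounding the root up costs at most a factor `2 ^ K`.
-/
theorem root_pow_le {n K r : ℕ} (hr : 1 ≤ r) (h : r = 1 ∨ (r - 1) ^ K < n) :
    r ^ K ≤ 2 ^ K * (n + 1) := by
  rcases h with rfl | h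
  · rw [one_pow]; exact Nat.one_le_iff_ne_zero.2 (by positivity)
  · by_cases h1 : r = 1
    · subst h1; rw [one_pow]; exact Nat.one_le_iff_ne_zero.2 (by positivity)
    · calc r ^ K ≤ (2 * (r - 1)) ^ K := Nat.pow_le_pow_left (by omega) K
        _ = 2 ^ K * (r - 1) ^ K := mul_pow _ _ _
        _ ≤ 2 ^ K * (n + 1) := Nat.mul_le_mul_left _ (by omega)

theorem root_le {n K r : ℕ} (hK : 1 ≤ K) (h : r = 1 ∨ (r - 1) ^ K < n) : r ≤ n + 1 := by
  rcases h with rfl | h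
  · omega
  · have := Nat.le_self_pow (by omega : K ≠ 0) (r - 1)
    omega

theorem wp_root {M : Lim} {n K : ℕ} {s : St} (hK : 1 ≤ K) (hL : 2 ^ K * (n + 1) ≤ M.L)
    (hnL : n + 2 ≤ M.L) (hWL : M.L ≤ M.W) (vn : s.v .n = n) (vK : s.v .K = K) :
    wp M rootCmd s (fun k s' => k ≤ 20 + n * (40 + 20 * K) ∧ IsRoot n K (s'.v .r)) := by
  rw [rootCmd, wp_seq, wp_set]
  refine ⟨by simp; omega, ?_⟩
  refine wp_loop 0 n (fun t s' => 1 ≤ s'.v .r ∧ (s'.v .r = 1 ∨ (s'.v .r - 1) ^ K < n) ∧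
    -- Until the goal is reached, `r` has grown in every round; after `n` rounds it would exceed
    -- `n`, and then so does its power.
    (n ≤ s'.v .r ^ K ∨ t + 1 ≤ s'.v .r)) (fun _ => 35 + 20 * K) (by simp) (by simp [vn])
    (Nat.zero_le _) (by simp) (by simp) (by simp) ?_ ?_
  · rintro t s1 - ht ⟨h1, h2, h3⟩ f1
    have vK1 : s1.v .K = K := by rw [f1.v .K rfl]; simp [vK]
    have vn1 : s1.v .n = n := by rw [f1.v .n rfl]; simp [vn]
    have hp := root_pow_le h1 h2
    have hrn := root_le hK h2
    have hpt : ∀ e ≤ K, s1.v .r ^ e ≤ M.W := fun e he =>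
      (Nat.pow_le_pow_right h1 he).trans (hp.trans (hL.trans hWL))
    rw [wp_seq, wp_set]
    refine ⟨by simp; omega, ?_⟩
    rw [wp_seq]
    refine wp_loop 0 K (fun e s' => s'.v .pw = s1.v .r ^ e) (fun _ => 10) (by simp) (by simp [vK1])
      (Nat.zero_le _) (by simp) (by simp) (by simp) ?_ ?_
    · rintro e s2 - he hI f2
      have r2 : s2.v .r = s1.v .r := by rw [f2.v .r rfl]; simp
      have := hpt (e + 1) he
      rw [pow_succ] at this
      simp [hI, r2, pow_succ, this]
    · rintro k2 s2 f2 hk2 hI2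
      have r2 : s2.v .r = s1.v .r := by rw [f2.v .r rfl]; simp
      have n2 : s2.v .n = n := by rw [f2.v .n rfl]; simp [vn1]
      simp only [Finset.sum_const, Nat.card_Ico, smul_eq_mul, cost_zero, cost_var] at hk2
      by_cases hlt : s1.v .r ^ K < n
      · simp [hI2, r2, n2, hlt]
        refine ⟨by omega, by omega, ?_⟩
        rcases h3 with h3 | h3
        · omega
        · right; omega
      · simp [hI2, r2, n2, hlt, h1, h2, not_lt.1 hlt]
        omega
  · rintro k s1 - hk ⟨h1, h2, h3⟩
    refine ⟨?_, h1, ?_, h2⟩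
    · simp only [Finset.sum_const, Nat.card_Ico, smul_eq_mul, cost_zero, cost_var, cost_one] at hk ⊢
      have : (n - 0) * (5 + (35 + 20 * K)) = n * (40 + 20 * K) := by rw [Nat.sub_zero]; ring
      omega
    · rcases h3 with h3 | h3
      · exact h3
      · have := Nat.le_self_pow (by omega : K ≠ 0) (s1.v .r)
        omega

end Loop

/-! ### Heavy vertices and the layout of the adjacency lists. -/

namespace Loop

/-- The number of heavy vertices less than `w`. -/
def heavyCount (n : ℕ) (O : ℕ → List ℕ) (r w : ℕ) : ℕ :=
  ((List.range w).filter fun u => n ≤ indeg O n u * r).length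

theorem heavyCount_succ (n : ℕ) (O : ℕ → List ℕ) (r w : ℕ) :
    heavyCount n O r (w + 1) = heavyCount n O r w + if n ≤ indeg O n w * r then 1 else 0 := by
  rw [heavyCount, heavyCount, List.range_succ, List.filter_append, List.length_append]
  by_cases h : n ≤ indeg O n w * r <;> simp [h]

theorem heavyCount_mono (n : ℕ) (O : ℕ → List ℕ) (r : ℕ) {w w' : ℕ} (h : w ≤ w') :
    heavyCount n O r w ≤ heavyCount n O r w' := by
  induction w', h using Nat.le_induction with
  | base => exact le_rfl
  | succ w' _ ih => rw [heavyCount_succ]; omega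

/-- Averaging: each heavy `u` satisfies `n ≤ indeg O n u * r`, and the in-degrees add up to the
number of arcs. -/
theorem heavyCount_mul_le (n : ℕ) (O : ℕ → List ℕ) (r w : ℕ) :
    heavyCount n O r w * n ≤ (∑ u ∈ Finset.range w, indeg O n u) * r := by
  induction w with
  | zero => simp [heavyCount]
  | succ w ih =>
    rw [heavyCount_succ, Finset.sum_range_succ, add_mul, add_mul]
    split
    · omega
    · omega

/-- The data for the graph. -/
def mkDat (n K : ℕ) (O : ℕ → List ℕ) (r : ℕ) : Dat where
  n := n
  K := K
  b := heavyCount n O r n + 1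
  O := O
  ix w := if w < n ∧ n ≤ indeg O n w * r then heavyCount n O r w + 1 else 0

theorem Oriented.eq_nil {n : ℕ} {O : ℕ → List ℕ} (hO : Oriented n O) {u : ℕ} (hu : n ≤ u) :
    O u = [] := by
  rw [List.eq_nil_iff_forall_not_mem]
  exact fun w hw => absurd (hO.lt u w hw).2 (by omega)

theorem maxDeg_pos (O : ℕ → List ℕ) (n : ℕ) : 1 ≤ maxDeg O n := le_max_left _ _

theorem size_le (O : ℕ → List ℕ) (n : ℕ) : size O n ≤ n * maxDeg O n := by
  have : ∀ u ∈ Finset.range n, (O u).length ≤ maxDeg O n := fun u hu =>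
    length_le_maxDeg O (Finset.mem_range.1 hu)
  have := Finset.sum_le_card_nsmul _ _ _ this
  simpa [size] using this

theorem mkDat_good {n r : ℕ} {O : ℕ → List ℕ} (hO : Oriented n O) :
    (mkDat n (maxDeg O n) O r).Good where
  lt := hO.lt
  nodup := hO.nodup
  asymm := hO.asymm
  len u := by
    by_cases hu : u < n
    · exact length_le_maxDeg O hu
    · change (O u).length ≤ _
      rw [hO.eq_nil (by omega)]; simp
  ix_lt w := by
    change (if w < n ∧ n ≤ indeg O n w * r then heavyCount n O r w + 1 else 0) <
      heavyCount n O r n + 1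
    split
    · next h =>
      have := heavyCount_mono n O r (show w + 1 ≤ n from h.1)
      rw [heavyCount_succ, if_pos h.2] at this
      omega
    · omega
  ix_inj w w' h0 he := by
    change (if w < n ∧ n ≤ indeg O n w * r then heavyCount n O r w + 1 else 0) ≠ 0 at h0
    change (if w < n ∧ n ≤ indeg O n w * r then heavyCount n O r w + 1 else 0) =
      (if w' < n ∧ n ≤ indeg O n w' * r then heavyCount n O r w' + 1 else 0) at he
    have h1 : w < n ∧ n ≤ indeg O n w * r := by by_contra h; exact h0 (if_neg h)
    rw [if_pos h1] at he
    have h2 : w' < n ∧ n ≤ indeg O n w' * r := by by_contra h; rw [if_neg h] at he; omega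
    rw [if_pos h2] at he
    rcases lt_trichotomy w w' with h | h | h
    · have := heavyCount_mono n O r (show w + 1 ≤ w' from h)
      rw [heavyCount_succ, if_pos h1.2] at this
      omega
    · exact h
    · have := heavyCount_mono n O r (show w' + 1 ≤ w from h)
      rw [heavyCount_succ, if_pos h2.2] at this
      omega
  K_pos := maxDeg_pos O n

section MkDat
variable {n K r : ℕ} {O : ℕ → List ℕ}

theorem mkDat_nb_length (w : ℕ) :
    ((mkDat n K O r).nb w).length = (O w).length + indeg O n w := List.length_append

theorem mkDat_st (hO : Oriented n O) : (mkDat n K O r).st n = 2 * size O n := by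
  unfold Dat.st
  simp only [mkDat_nb_length, Finset.sum_add_distrib, sum_indeg hO]
  rw [size]; ring

/-- At most `K * r` vertices are heavy. The digit zero adds one, absorbed by the factor `2`. -/
theorem mkDat_b_le (hO : Oriented n O) (hr : 1 ≤ r) (hK : size O n ≤ n * K) (hK1 : 1 ≤ K) :
    (mkDat n K O r).b ≤ 2 * K * r := by
  have hKr : 1 ≤ K * r := Nat.one_le_iff_ne_zero.2 (by positivity)
  change heavyCount n O r n + 1 ≤ _
  have h := heavyCount_mul_le n O r n
  rw [sum_indeg hO] at h
  have h2 : heavyCount n O r n * n ≤ K * r * n := by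
    refine h.trans ((Nat.mul_le_mul_right r hK).trans (le_of_eq (by ring)))
  have h3 : heavyCount n O r n ≤ K * r := by
    rcases Nat.eq_zero_or_pos n with rfl | hn
    · simp [heavyCount]
    · exact Nat.le_of_mul_le_mul_right h2 hn
  have : 2 * K * r = K * r + K * r := by ring
  omega

/-- The table has one cell per code, so this is the bound behind the linear space. -/
theorem mkDat_b_pow_le (hO : Oriented n O) (hr : IsRoot n K r) (hK : size O n ≤ n * K)
    (hK1 : 1 ≤ K) : (mkDat n K O r).b ^ K ≤ (4 * K) ^ K * (n + 1) := by
  calc (mkDat n K O r).b ^ K ≤ (2 * K * r) ^ K := Nat.pow_le_pow_left (mkDat_b_le hO hr.pos hK hK1) K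
    _ = (2 * K) ^ K * r ^ K := mul_pow _ _ _
    _ ≤ (2 * K) ^ K * (2 ^ K * (n + 1)) := Nat.mul_le_mul_left _ (root_pow_le hr.pos hr.lt)
    _ = (4 * K) ^ K * (n + 1) := by
      rw [← mul_assoc, ← mul_pow]; congr 2; ring

end MkDat

theorem wp_heavy {M : Lim} {n K : ℕ} {O : ℕ → List ℕ} {s : St} (hL : n + 2 ≤ M.L)
    (hWL : 2 * M.L ≤ M.W) (hW2 : n * (n + 1) ≤ M.W) {r : ℕ} (hr : r ≤ n + 1) (vn : s.v .n = n)
    (vr : s.v .r = r) (hID : ∀ w < n, s.a .ID w = indeg O n w) (h0 : ∀ w, s.a .IX w = 0) :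
    wp M heavyCmd s (fun k s' => k ≤ 20 + 60 * n ∧ s'.v .b = (mkDat n K O r).b ∧
      ∀ w < n, s'.a .IX w = (mkDat n K O r).ix w) := by
  rw [heavyCmd, wp_seq, wp_set]
  refine ⟨by simp; omega, ?_⟩
  refine wp_loop 0 n (fun w s' => s'.v .b = heavyCount n O r w + 1 ∧
    ∀ u, s'.a .IX u = if u < w then (mkDat n K O r).ix u else 0) (fun _ => 50) (by simp)
    (by simp [vn]) (Nat.zero_le _) (by simp) (by simp) ?_ ?_ ?_
  · simp [heavyCount, h0]
  · rintro w s1 - hw ⟨h1, h2⟩ f1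
    have vr1 : s1.v .r = r := by rw [f1.v .r rfl]; simp [vr]
    have vn1 : s1.v .n = n := by rw [f1.v .n rfl]; simp [vn]
    have eI : s1.a .ID w = indeg O n w := by rw [f1.a .ID rfl]; exact hID w hw
    have hwL : w < M.L := by omega
    have hb : indeg O n w * r ≤ M.W :=
      (Nat.mul_le_mul (indeg_le O n w) hr).trans hW2
    have hc : heavyCount n O r w ≤ w := (List.length_filter_le _ _).trans (by simp)
    rw [heavyCount_succ]
    by_cases h : n ≤ indeg O n w * r
    · simp [Lim.idx, vr1, vn1, eI, hwL, hb, h, h1]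
      refine ⟨by omega, fun u => ?_⟩
      by_cases hu : u = w
      · subst hu; simp [mkDat, hw, h]
      · have : u ≤ w ↔ u < w := by omega
        simp [hu, h2, this]
    · have h' := not_le.1 h
      simp [Lim.idx, vr1, vn1, eI, hwL, hb, h, h', h1]
      intro u
      by_cases hu : u = w
      · subst hu; simp [mkDat, h, h2]
      · have : u ≤ w ↔ u < w := by omega
        simp [h2, this]
  · rintro k s1 - hk ⟨h1, h2⟩
    refine ⟨?_, h1, fun w hw => by rw [h2, if_pos hw]⟩
    simp only [Finset.sum_const, Nat.card_Ico, smul_eq_mul, cost_zero, cost_var, cost_one] at hk ⊢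
    omega

theorem Dat.st_succ (D : Dat) (w : ℕ) : D.st (w + 1) = D.st w + (D.nb w).length :=
  Finset.sum_range_succ _ _

theorem Dat.st_mono (D : Dat) {w w' : ℕ} (h : w ≤ w') : D.st w ≤ D.st w' :=
  Finset.sum_le_sum_of_subset (Finset.range_subset_range.2 h)

theorem wp_offset {M : Lim} {D : Dat} {s : St} (hL : D.n + 2 ≤ M.L) (hst : D.st D.n ≤ M.L)
    (hWL : 2 * M.L ≤ M.W) (vn : s.v .n = D.n) (hOD : ∀ w < D.n, s.a .OD w = (D.O w).length)
    (hID : ∀ w < D.n, s.a .ID w = (D.ins w).length) (hIX : ∀ w < D.n, s.a .IX w = D.ix w) :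
    wp M offsetCmd s (fun k s' => k ≤ 20 + 120 * D.n ∧ ∀ w < D.n, s'.a .ST w = D.st w ∧
      s'.a .PS w = D.st w ∧ s'.a .LN w = (D.nb w).length ∧ s'.a .SL w = D.sl w) := by
  rw [offsetCmd, wp_seq, wp_set]
  refine ⟨by simp, ?_⟩
  refine wp_loop 0 D.n (fun w s' => s'.v .acc = D.st w ∧ ∀ u < w, s'.a .ST u = D.st u ∧
      s'.a .PS u = D.st u ∧ s'.a .LN u = (D.nb u).length ∧ s'.a .SL u = D.sl u) (fun _ => 110)
    (by simp) (by simp [vn]) (Nat.zero_le _) (by simp) (by simp) ⟨by simp [Dat.st], by simp⟩ ?_ ?_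
  · rintro w s1 - hw ⟨h1, h2⟩ f1
    have eO : s1.a .OD w = (D.O w).length := by rw [f1.a .OD rfl]; exact hOD w hw
    have eI : s1.a .ID w = (D.ins w).length := by rw [f1.a .ID rfl]; exact hID w hw
    have eX : s1.a .IX w = D.ix w := by rw [f1.a .IX rfl]; exact hIX w hw
    have hwL : w < M.L := by omega
    have e1 := D.st_succ w
    have e2 := D.st_mono (show w + 1 ≤ D.n from hw)
    have e3 : (D.O w).length + (D.ins w).length = (D.nb w).length := by simp [Dat.nb]
    have hA : D.st w ≤ M.W := by omega
    have hB : (D.nb w).length ≤ M.W := by omega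
    have hC : D.st w + (D.nb w).length ≤ M.W := by omega
    have hgen : ∀ w' < w + 1, ∀ f : ℕ → ℕ, ∀ g : ℕ → ℕ, ∀ x, (∀ u < w, f u = g u) → x = g w →
        Function.update f w x w' = g w' := by
      intro w' hw' f g x hf hx
      by_cases h : w' = w
      · subst h; simp [hx]
      · rw [Function.update_of_ne h]; exact hf w' (by omega)
    by_cases hx : D.ix w = 0
    · simp [Lim.idx, h1, eO, eI, eX, hwL, e3, hB, hC, hx]
      refine ⟨e1.symm, fun u hu => ⟨?_, ?_, ?_, ?_⟩⟩
      · exact hgen u (by omega) _ D.st _ (fun u hu => (h2 u hu).1) rfl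
      · exact hgen u (by omega) _ D.st _ (fun u hu => (h2 u hu).2.1) rfl
      · exact hgen u (by omega) _ (fun u => (D.nb u).length) _ (fun u hu => (h2 u hu).2.2.1) rfl
      · exact hgen u (by omega) _ D.sl _ (fun u hu => (h2 u hu).2.2.2) (by rw [Dat.sl, if_pos hx])
    · simp [Lim.idx, h1, eO, eI, eX, hwL, e3, hB, hC, hx]
      refine ⟨e1.symm, fun u hu => ⟨?_, ?_, ?_, ?_⟩⟩
      · exact hgen u (by omega) _ D.st _ (fun u hu => (h2 u hu).1) rfl
      · exact hgen u (by omega) _ D.st _ (fun u hu => (h2 u hu).2.1) rfl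
      · exact hgen u (by omega) _ (fun u => (D.nb u).length) _ (fun u hu => (h2 u hu).2.2.1) rfl
      · exact hgen u (by omega) _ D.sl _ (fun u hu => (h2 u hu).2.2.2) (by rw [Dat.sl, if_neg hx])
  · rintro k s1 - hk ⟨h1, h2⟩
    refine ⟨?_, h2⟩
    simp only [Finset.sum_const, Nat.card_Ico, smul_eq_mul, cost_zero, cost_var] at hk ⊢
    omega

/-- The array `A` holds the list `G u` from position `D.st u` on. -/
def Seg (D : Dat) (A : ℕ → ℕ) (G : ℕ → List ℕ) : Prop :=
  ∀ u < D.n, ∀ t (h : t < (G u).length), A (D.st u + t) = (G u)[t]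

theorem Dat.st_add_inj {D : Dat} {u u' t t' : ℕ} (ht : t < (D.nb u).length)
    (ht' : t' < (D.nb u').length) (h : D.st u + t = D.st u' + t') : u = u' := by
  rcases lt_trichotomy u u' with hu | hu | hu
  · have h1 := D.st_mono (show u + 1 ≤ u' from hu)
    rw [D.st_succ] at h1; omega
  · exact hu
  · have h1 := D.st_mono (show u' + 1 ≤ u from hu)
    rw [D.st_succ] at h1; omega

theorem Seg.push {D : Dat} {A : ℕ → ℕ} {G : ℕ → List ℕ} (h : Seg D A G)
    (hG : ∀ u < D.n, (G u).length ≤ (D.nb u).length) {u : ℕ}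
    (hlt : (G u).length < (D.nb u).length) (x : ℕ) :
    Seg D (Function.update A (D.st u + (G u).length) x) (Function.update G u (G u ++ [x])) := by
  intro u' hu' t ht
  by_cases he : u' = u
  · subst he
    simp only [Function.update_self] at ht ⊢
    rw [List.length_append, List.length_singleton] at ht
    rcases Nat.lt_succ_iff_lt_or_eq.1 ht with ht | rfl
    · rw [Function.update_of_ne (by omega), h u' hu' t ht, List.getElem_append_left ht]
    · simp
  · simp only [Function.update_of_ne he] at ht ⊢
    rw [Function.update_of_ne, h u' hu' t ht]
    intro heq
    exact he (Dat.st_add_inj (ht.trans_le (hG u' hu')) hlt heq)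

theorem Seg.congr {D : Dat} {A : ℕ → ℕ} {G G' : ℕ → List ℕ} (h : Seg D A G)
    (hG : ∀ u < D.n, G' u = G u) : Seg D A G' := by
  intro u hu t ht
  have := h u hu t (by rw [← hG u hu]; exact ht)
  rw [this]
  simp only [hG u hu]

/-- The lists `G u` have been written to the adjacency lists. -/
structure Written (D : Dat) (G : ℕ → List ℕ) (s : St) : Prop where
  seg : Seg D (s.a .NB) G
  PS : ∀ u < D.n, s.a .PS u = D.st u + (G u).length
  le : ∀ u < D.n, (G u).length ≤ (D.nb u).length

theorem Written.congr {D : Dat} {G G' : ℕ → List ℕ} {s : St} (h : Written D G s)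
    (hG : ∀ u < D.n, G' u = G u) : Written D G' s :=
  ⟨h.seg.congr hG, fun u hu => by rw [hG u hu]; exact h.PS u hu,
    fun u hu => by rw [hG u hu]; exact h.le u hu⟩

theorem Written.push {D : Dat} {G G' : ℕ → List ℕ} {s s' : St} (h : Written D G s) {u x : ℕ}
    (hu : u < D.n) (hlt : (G u).length < (D.nb u).length)
    (hN : s'.a .NB = Function.update (s.a .NB) (s.a .PS u) x)
    (hP : s'.a .PS = Function.update (s.a .PS) u (s.a .PS u + 1))
    (hG : ∀ v < D.n, G' v = Function.update G u (G u ++ [x]) v) : Written D G' s' := by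
  refine Written.congr (G := Function.update G u (G u ++ [x])) ⟨?_, fun v hv => ?_, fun v hv => ?_⟩ hG
  · rw [hN, h.PS u hu]; exact h.seg.push h.le hlt x
  · rw [hP]
    by_cases he : v = u
    · subst he; simp [h.PS v hv]; ring
    · simp [he, h.PS v hv]
  · by_cases he : v = u
    · subst he; simp; omega
    · simp [he, h.le v hv]

theorem wp_outs {M : Lim} {D : Dat} {s : St} (hI : Inp D.n D.O s)
    (hB : pos D.O D.n ≤ M.B) (hW : M.B + 2 ≤ M.W) (hL : D.n + 2 ≤ M.L) (hst : D.st D.n ≤ M.L)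
    (hWL : 2 * M.L ≤ M.W) (vn : s.v .n = D.n) (hPS : ∀ w < D.n, s.a .PS w = D.st w) :
    wp M outsCmd s (fun k s' => k ≤ 20 + 60 * D.n + 60 * size D.O D.n ∧ Written D D.O s') := by
  refine wp_edges hI hB hW vn (fun v s' => Written D (fun u => if u < v then D.O u else []) s')
    (fun v l s' => Written D (fun u => if u < v then D.O u else if u = v then l else []) s') 0 40
    rfl ?_ ?_ ?_ ?_ ?_
  · exact ⟨fun u _ t ht => by simp at ht, fun u hu => by simpa using hPS u hu, by simp⟩
  · intro v hv s1 h _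
    rw [wp_skip]
    refine ⟨le_rfl, Written.congr (G := fun u => if u < v then D.O u else []) ⟨h.seg, h.PS, h.le⟩
      fun u _ => ?_⟩
    by_cases hu : u = v <;> simp [hu]
  · intro v hv l w e s1 hpre hw hvv h _
    have hle := hpre.length_le
    rw [List.length_append, List.length_singleton] at hle
    have hlt : l.length < (D.nb v).length := by simp [Dat.nb]; omega
    have hps := h.PS v hv
    simp only [lt_irrefl, if_false, if_true] at hps
    have hslt := Dat.st_add_lt hv hlt
    have hvL : v < M.L := by omega
    have hpL : s1.a .PS v < M.L := by omega
    have hpW : s1.a .PS v < M.W := by omega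
    have hW1 : 1 ≤ M.W := by omega
    simp [Lim.idx, hvv, hvL, hpL, hpW, hW1]
    refine h.push (u := v) (x := w) hv (by simpa using hlt) (by simp) (by simp) fun u _ => ?_
    by_cases hu : u = v
    · subst hu; simp
    · simp [hu]
  · intro v hv s1 p h _
    refine Written.congr (G := fun u => if u < v then D.O u else if u = v then D.O v else [])
      ⟨h.seg, h.PS, h.le⟩ fun u _ => ?_
    rcases lt_trichotomy u v with hu | rfl | hu
    · simp [hu, hu.trans (Nat.lt_succ_self v)]
    · simp
    · simp [hu.ne', show ¬ u < v by omega, show ¬ u < v + 1 by omega]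
  · intro k s1 _ hk h
    refine ⟨by omega, h.congr fun u hu => by simp [hu]⟩

theorem wp_ins {M : Lim} {D : Dat} (hD : D.Good) {s : St}
    (hI : Inp D.n D.O s) (hF : Fits M D)
    (hB : pos D.O D.n ≤ M.B) (hW : M.B + 2 ≤ M.W) (vn : s.v .n = D.n) (vb : s.v .b = D.b)
    (hIX : ∀ w < D.n, s.a .IX w = D.ix w) (hN : Written D D.O s) (hWT : ∀ i, s.a .WT i = 0) :
    wp M insCmd s (fun k s' => k ≤ 20 + 60 * D.n + 100 * size D.O D.n ∧ Written D D.nb s' ∧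
      Seg D (s'.a .WT) fun u => (D.nb u).map (D.wt u)) := by
  have hL := hF.n
  have hst := hF.st
  have hFp := hF.pow
  have hFW := hF.W
  -- The list of `u` when the arcs out of the vertices below `v`, and those from `v` to `l`, have
  -- been entered.
  let G : ℕ → List ℕ → ℕ → List ℕ := fun v l u =>
    D.O u ++ ((List.range v).filter (fun x => u ∈ D.O x) ++ if u ∈ l then [v] else [])
  have hG0 : ∀ v u, G (v + 1) [] u = G v (D.O v) u := by
    intro v u
    simp only [G, List.range_succ, List.filter_append]
    by_cases h : u ∈ D.O v <;> simp [h]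
  have hGn : ∀ u, G D.n [] u = D.nb u := by intro u; simp [G, Dat.nb, Dat.ins]
  have hGO : ∀ u, G 0 [] u = D.O u := by intro u; simp [G]
  refine wp_edges hI hB hW vn
    (fun v s' => Written D (G v []) s' ∧ Seg D (s'.a .WT) fun u => (G v [] u).map (D.wt u))
    (fun v l s' => Written D (G v l) s' ∧ (Seg D (s'.a .WT) fun u => (G v l u).map (D.wt u)) ∧
      s'.v .g = D.b ^ l.length) 10 70
    rfl ?_ ?_ ?_ ?_ ?_
  · refine ⟨Written.congr (G := D.O) ⟨hN.seg, hN.PS, hN.le⟩ fun u _ => hGO u, ?_⟩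
    intro u hu t ht
    simp only [hGO, List.getElem_map, St.setV_a, hWT]
    symm
    rw [hD.wt_eq_zero]
    -- An out-neighbour of `u` has no arc to `u`'s detriment in the code: as the arc runs from `u`,
    -- the entry has weight zero, which is the initial content of `WT`.
    exact Or.inl (hD.asymm _ _ (List.getElem_mem _))
  · rintro v hv s1 ⟨h1, h2⟩ -
    simp only [wp_set, safe_one]
    refine ⟨by omega, by simp, ⟨h1.seg, h1.PS, h1.le⟩, h2, by simp⟩
  · rintro v hv l w e s1 hpre hw hvv ⟨h1, h2, h3⟩ f1
    have hwn := (hD.lt v w hw).1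
    have hwl := notMem_of_prefix (hD.nodup v) hpre
    have hle := hpre.length_le
    rw [List.length_append, List.length_singleton] at hle
    have hlen := hD.len v
    have hlt : (G v l w).length < (D.nb w).length := by
      have e1 : (G v l w).length = (D.O w).length + indeg D.O v w := by simp [G, hwl, indeg]
      have e2 : (D.nb w).length = (D.O w).length + indeg D.O D.n w := by
        simp [Dat.nb, indeg, Dat.ins]
      have e3 : indeg D.O (v + 1) w ≤ indeg D.O D.n w :=
        (((List.range_sublist.2 (show v + 1 ≤ D.n from hv))).filter _).length_le
      rw [indeg_succ, if_pos hw] at e3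
      omega
    have hps := h1.PS w hwn
    have hslt := Dat.st_add_lt hwn hlt
    have hwL : w < M.L := by omega
    have hpL : s1.a .PS w < M.L := by omega
    have hpW : s1.a .PS w < M.W := by omega
    have hW1 : 1 ≤ M.W := by omega
    have eX : s1.a .IX w = D.ix w := by rw [f1.a .IX rfl]; exact hIX w hwn
    have eb : s1.v .b = D.b := by rw [f1.v .b rfl]; exact vb
    -- The loop visits the list in order, so the position of `w` is the number of entries before it,
    -- and `g` holds the matching power of `b`.
    have hidx : (D.O v).idxOf w = l.length := by
      obtain ⟨m, hm⟩ := hpre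
      rw [← hm, List.idxOf_append_of_mem (by simp), List.idxOf_append_of_notMem hwl]
      simp
    have hwt : D.ix w * D.b ^ l.length = D.wt w v := by rw [Dat.wt, if_pos hw, hidx]
    have hwtlt := hD.wt_lt w v
    have hwtW : D.wt w v ≤ M.W := by omega
    have hgb : D.b ^ l.length * D.b ≤ M.W := by
      rw [← pow_succ]
      have := Nat.pow_le_pow_right hD.b_pos (show l.length + 1 ≤ D.K by omega)
      omega
    have hGu : ∀ u, G v (l ++ [w]) u = Function.update (G v l) w (G v l w ++ [v]) u := by
      intro u
      by_cases hu : u = w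
      · subst hu; simp [G, hwl]
      · simp [G, hu]
    simp [Lim.idx, hvv, hwL, hpL, hpW, hW1, eX, h3, eb, hwt, hwtW, hgb, pow_succ]
    refine ⟨h1.push (u := w) (x := v) hwn hlt (by simp) (by simp) fun u _ => hGu u, ?_⟩
    have := h2.push (u := w) (fun u hu => by simpa using h1.le u hu) (by simpa using hlt) (D.wt w v)
    rw [List.length_map, ← hps] at this
    refine this.congr fun u _ => ?_
    rw [hGu]
    by_cases hu : u = w
    · subst hu; simp
    · simp [hu]
  · rintro v hv s1 p ⟨h1, h2, -⟩ -
    refine ⟨Written.congr (G := G v (D.O v)) ⟨h1.seg, h1.PS, h1.le⟩ fun u _ => hG0 v u, ?_⟩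
    exact Seg.congr (G := fun u => (G v (D.O v) u).map (D.wt u)) h2 fun u _ => by rw [hG0]
  · rintro k s1 - hk ⟨h1, h2⟩
    refine ⟨by omega, h1.congr fun u _ => (hGn u).symm, h2.congr fun u _ => by rw [hGn]⟩

/-- The bounds leave room for the graph. -/
structure Room (M : Lim) (n : ℕ) (O : ℕ → List ℕ) : Prop where
  B : pos O n ≤ M.B
  BW : M.B + 2 ≤ M.W
  L : n + 2 ≤ M.L
  size : 2 * Loop.size O n ≤ M.L
  pow : (4 * maxDeg O n) ^ maxDeg O n * (n + 1) ≤ M.L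
  W : 32 * M.L + 32 ≤ M.W
  sq : n * (n + 1) ≤ M.W

theorem wp_init {M : Lim} {D : Dat} {s : St} (hL : D.n + 2 ≤ M.L) (hWL : M.L ≤ M.W)
    (vn : s.v .n = D.n) (h0 : ∀ i, s.a .DEF i = 0) :
    wp M initCmd s (fun k s' => k ≤ 20 + 30 * D.n ∧ s'.v .alive = 1 ∧
      ∀ i, s'.a .DEF i = if i < D.n then 1 else 0) := by
  rw [initCmd, wp_seq]
  refine wp_loop 0 D.n (fun v s' => ∀ i, s'.a .DEF i = if i < v then 1 else 0) (fun _ => 20)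
    (by simp) (by simp [vn]) (Nat.zero_le _) (by simp) (by simp) (by simpa using h0) ?_ ?_
  · intro v s1 _ hv h _
    have hvL : v < M.L := by omega
    have hW1 : 1 ≤ M.W := by omega
    simp [hvL, hW1]
    intro i
    by_cases hi : i = v
    · subst hi; simp
    · have : i ≤ v ↔ i < v := by omega
      simp [hi, h, this]
  · intro k s1 _ hk h
    simp only [Finset.sum_const, Nat.card_Ico, smul_eq_mul, cost_zero, cost_var] at hk
    simp [h]
    omega

def prepCost (n K m : ℕ) : ℕ := 500 + 500 * n + 20 * n * K + 300 * m

theorem wp_prepare₁ {M : Lim} {n : ℕ} {O : ℕ → List ℕ} {s : St} (hO : Oriented n O)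
    (hI : Inp n O s) (hM : Room M n O) (vz : s.v .zero = 0) (vl : s.v .lvl = 0) (vn : s.v .n = n)
    (vK : s.v .K = maxDeg O n) (h0 : ∀ a, a ≠ .inp → ∀ i, s.a a i = 0) :
    wp M prepare₁ s (fun k s' => k ≤ prepCost n (maxDeg O n) (size O n) ∧ s'.v .alive = 1 ∧
      ∃ r, IsRoot n (maxDeg O n) r ∧ Fits M (mkDat n (maxDeg O n) O r) ∧
        Ready (mkDat n (maxDeg O n) O r)
          (Mis.leaves (mkDat n (maxDeg O n) O r).adj n 0 ∅) s') := by
  have hB := hM.B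
  have hBW := hM.BW
  have hn := hM.L
  have hsz := hM.size
  have hpow := hM.pow
  have hW := hM.W
  have hsq := hM.sq
  have hK1 := maxDeg_pos O n
  have hzK := size_le O n
  have h2K : 2 ^ maxDeg O n * (n + 1) ≤ M.L :=
    (Nat.mul_le_mul_right _ (Nat.pow_le_pow_left (by omega) _)).trans hpow
  rw [prepare₁, wp_seq]
  refine wp_mono (wp_deg hO hI hB hBW hn (by omega) vn (h0 .ID (by decide))) ?_
  rintro k1 s1 f1 ⟨hk1, hOD1, hID1⟩
  have vn1 : s1.v .n = n := by rw [f1.v .n rfl, vn]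
  have vK1 : s1.v .K = maxDeg O n := by rw [f1.v .K rfl, vK]
  rw [wp_seq]
  refine wp_mono (wp_root hK1 h2K hn (by omega) vn1 vK1) ?_
  rintro k2 s2 f2 ⟨hk2, hr⟩
  have vn2 : s2.v .n = n := by rw [f2.v .n rfl, vn1]
  have hrn := root_le hK1 hr.lt
  generalize hrr : s2.v .r = r at hr hrn
  have hID2 : ∀ w < n, s2.a .ID w = indeg O n w := by rw [f2.a .ID rfl]; exact hID1
  rw [wp_seq]
  refine wp_mono (wp_heavy (K := maxDeg O n) hn (by omega) hsq hrn vn2 hrr hID2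
    (by rw [f2.a .IX rfl, f1.a .IX rfl]; exact h0 .IX (by decide))) ?_
  set D := mkDat n (maxDeg O n) O r with hDdef
  have hD : D.Good := mkDat_good hO
  rintro k3 s3 f3 ⟨hk3, hb3, hIX3⟩
  have hF : Fits M D := ⟨hn, by
    change (mkDat n (maxDeg O n) O r).st n ≤ _
    rw [mkDat_st hO]; exact hsz, (mkDat_b_pow_le hO hr hzK hK1).trans hpow, hW⟩
  have vn3 : s3.v .n = D.n := (f3.v .n rfl).trans vn2
  rw [wp_seq]
  refine wp_mono (wp_offset (D := D) hn hF.st (by omega) vn3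
    (by rw [f3.a .OD rfl, f2.a .OD rfl]; exact hOD1) (by rw [f3.a .ID rfl]; exact hID2) hIX3) ?_
  rintro k4 s4 f4 ⟨hk4, h4⟩
  have vn4 : s4.v .n = D.n := by rw [f4.v .n rfl, vn3]
  have hI4 : Inp D.n D.O s4 := hI.congr (by
    rw [f4.a .inp rfl, f3.a .inp rfl, f2.a .inp rfl, f1.a .inp rfl])
  rw [wp_seq]
  refine wp_mono (wp_outs (D := D) hI4 hB hBW hn hF.st (by omega) vn4
    fun w hw => (h4 w hw).2.1) ?_
  rintro k5 s5 f5 ⟨hk5, hN5⟩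
  have vn5 : s5.v .n = D.n := by rw [f5.v .n rfl, vn4]
  have vb5 : s5.v .b = D.b := by rw [f5.v .b rfl, f4.v .b rfl, hb3]
  have hIX5 : ∀ w < D.n, s5.a .IX w = D.ix w := by rw [f5.a .IX rfl, f4.a .IX rfl]; exact hIX3
  rw [wp_seq]
  refine wp_mono (wp_ins hD (hI4.congr (f5.a .inp rfl)) hF hB hBW vn5 vb5 hIX5 hN5 (by
    rw [f5.a .WT rfl, f4.a .WT rfl, f3.a .WT rfl, f2.a .WT rfl, f1.a .WT rfl]
    exact h0 .WT (by decide))) ?_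
  rintro k6 s6 f6 ⟨hk6, hN6, hW6⟩
  have vn6 : s6.v .n = D.n := by rw [f6.v .n rfl, vn5]
  have keep : ∀ a, degCmd.wa a = false → rootCmd.wa a = false → heavyCmd.wa a = false →
      offsetCmd.wa a = false → outsCmd.wa a = false → insCmd.wa a = false → s6.a a = s.a a := by
    intro a h1 h2 h3 h4 h5 h6
    rw [f6.a a h6, f5.a a h5, f4.a a h4, f3.a a h3, f2.a a h2, f1.a a h1]
  refine wp_mono (wp_init (D := D) hn (by omega) vn6 (by
    rw [keep .DEF rfl rfl rfl rfl rfl rfl]; exact h0 .DEF (by decide))) ?_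
  rintro k7 s7 f7 ⟨hk7, hal, hDEF⟩
  refine ⟨?_, hal, r, hr, hF, fun _ => ∅, 0, Nat.zero_le _, ?_, ?_, ?_⟩
  · change k4 ≤ 20 + 120 * n at hk4
    change k5 ≤ 20 + 60 * n + 60 * Loop.size O n at hk5
    change k6 ≤ 20 + 60 * n + 100 * Loop.size O n at hk6
    change k7 ≤ 20 + 30 * n at hk7
    have : n * (40 + 20 * maxDeg O n) = 40 * n + 20 * n * maxDeg O n := by ring
    rw [prepCost]
    omega
  · rw [f7.v .lvl rfl, f6.v .lvl rfl, f5.v .lvl rfl, f4.v .lvl rfl, f3.v .lvl rfl, f2.v .lvl rfl,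
      f1.v .lvl rfl, vl]
  · have z : ∀ a, a ≠ .inp → degCmd.wa a = false → rootCmd.wa a = false → heavyCmd.wa a = false →
        offsetCmd.wa a = false → outsCmd.wa a = false → insCmd.wa a = false →
        initCmd.wa a = false → ∀ i, s7.a a i = 0 := by
      intro a h h1 h2 h3 h4 h5 h6 h7
      rw [f7.a a h7, keep a h1 h2 h3 h4 h5 h6]
      exact h0 a h
    refine ⟨⟨?_, ?_, ?_, ?_, ?_, ?_, ?_, ?_, ?_, ?_, ?_⟩, ⟨fun u hu => ?_, fun u hu => ?_,
      fun u hu => ?_, fun u hu => ?_, fun x => ?_⟩, ⟨rfl, fun i hi => absurd hi (by omega)⟩,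
      fun w i => ?_, ?_⟩
    · rw [f7.v .zero rfl, f6.v .zero rfl, f5.v .zero rfl, f4.v .zero rfl, f3.v .zero rfl,
        f2.v .zero rfl, f1.v .zero rfl, vz]
    · rw [f7.v .n rfl, vn6]
    · rw [f7.v .K rfl, f6.v .K rfl, f5.v .K rfl, f4.v .K rfl, f3.v .K rfl, f2.v .K rfl, vK1]
      rfl
    · rw [f7.v .b rfl, f6.v .b rfl, vb5]
    · rw [f7.a .ST rfl, f6.a .ST rfl, f5.a .ST rfl]; exact fun w hw => (h4 w hw).1
    · rw [f7.a .LN rfl, f6.a .LN rfl, f5.a .LN rfl]; exact fun w hw => (h4 w hw).2.2.1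
    · rw [f7.a .SL rfl, f6.a .SL rfl, f5.a .SL rfl]; exact fun w hw => (h4 w hw).2.2.2
    · rw [f7.a .OD rfl, f6.a .OD rfl, f5.a .OD rfl, f4.a .OD rfl, f3.a .OD rfl, f2.a .OD rfl]
      exact hOD1
    · rw [f7.a .IX rfl, f6.a .IX rfl]; exact hIX5
    · rw [f7.a .NB rfl]; exact hN6.seg
    · rw [f7.a .WT rfl]
      intro w hw t ht
      rw [hW6 w hw t (by simpa using ht), List.getElem_map]
    · rw [hDEF, if_pos hu]; simp [Dat.defv]
    · rw [z .CODE (by decide) rfl rfl rfl rfl rfl rfl rfl]; simp [Dat.code]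
    · rw [z .LOW (by decide) rfl rfl rfl rfl rfl rfl rfl]; simp [Dat.low]
    · rw [z .INS (by decide) rfl rfl rfl rfl rfl rfl rfl]; simp
    -- At the start all vertices are inactive, so the table is zero, as the untouched memory is.
    · rw [z .T (by decide) rfl rfl rfl rfl rfl rfl rfl, cnt]
      symm
      rw [Finset.card_eq_zero, Finset.filter_eq_empty_iff]
      intro u hu h
      rw [hDEF, if_pos (Finset.mem_range.1 hu)] at h
      exact absurd h.1 one_ne_zero
    · rw [z .REM (by decide) rfl rfl rfl rfl rfl rfl rfl]
      simp
    · exact ⟨z .MK (by decide) rfl rfl rfl rfl rfl rfl rfl,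
        z .DC (by decide) rfl rfl rfl rfl rfl rfl rfl,
        z .QA (by decide) rfl rfl rfl rfl rfl rfl rfl 0⟩
  · simp [remaining, Mis.todo]; rfl

end Loop

/-! ## The run of the machine -/

namespace Loop
open RAM (Prog Instr Exec State Event)

theorem endSet_mem_of_output {tr : List Event} (h : none ∈ RAM.output tr) : Event.endSet ∈ tr := by
  rw [RAM.output, List.mem_filterMap] at h
  obtain ⟨e, he, h⟩ := h
  cases e <;> simp [Event.symbol] at h
  exact he

/-- Stretches without the completion of a set have length at most `2 * D`, and at most `D` at the
beginning. -/
structure Punct (D : ℕ) (tr : List Event) : Prop where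
  start : ∀ x y, tr = x ++ y → Event.endSet ∉ x → x.length ≤ D
  mid : ∀ x z y, tr = x ++ (z ++ y) → Event.endSet ∉ z → z.length ≤ 2 * D

theorem Punct.of_length_le {D : ℕ} {tr : List Event} (h : tr.length ≤ D) : Punct D tr := by
  refine ⟨fun x y e _ => ?_, fun x z y e _ => ?_⟩ <;> rw [e] at h <;> simp at h <;> omega

/-- A stretch without the end of a set that crosses the border consists of a piece of `b` and an
initial piece of `tr`, each of length at most `D`. -/
theorem Punct.mid_append {D : ℕ} {b tr : List Event} (h : Punct D tr) (hb : b.length ≤ D) :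
    ∀ x z y, b ++ tr = x ++ (z ++ y) → Event.endSet ∉ z → z.length ≤ 2 * D := by
  intro x z y e hz
  rcases List.append_eq_append_iff.1 e with ⟨c, rfl, e'⟩ | ⟨a, e1, e2⟩
  · exact h.mid c z y e' hz
  · have ha : a.length ≤ D := by rw [e1] at hb; simp at hb; omega
    rcases List.append_eq_append_iff.1 e2 with ⟨c, e3, e4⟩ | ⟨c, e3, e4⟩
    · rw [e3] at ha; simp at ha; omega
    · subst e3
      have := h.start c y e4 fun hc => hz (List.mem_append_right _ hc)
      rw [List.length_append]; omega

theorem Punct.append {D : ℕ} {b tr : List Event} (h : Punct D tr) (hb : b.length ≤ D)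
    (he : Event.endSet ∈ b) : Punct D (b ++ tr) := by
  refine ⟨fun x y e hx => ?_, h.mid_append hb⟩
  rcases List.append_eq_append_iff.1 e with ⟨c, rfl, -⟩ | ⟨a, rfl, -⟩
  · exact absurd (List.mem_append_left _ he) hx
  · simp at hb; omega

theorem delayAtMost_of_mid {D : ℕ} {tr : List Event}
    (h : ∀ x z y, tr = x ++ (z ++ y) → Event.endSet ∉ z → z.length ≤ D) :
    RAM.DelayAtMost (D + 1) tr := by
  rintro z ⟨x, y, rfl⟩ hz
  by_contra hn
  have := h x z y (by simp) hn
  omega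

/-- One iteration of the machine loop per set in `R`; since each iteration completes a set, the
bound for a round gives the delay as well. -/
theorem runs_rounds {M : Lim} (hM : M.Good) {D : Dat} (hD : D.Good) (hF : Fits M D)
    (R : List (Finset ℕ)) : ∀ {s : St} {m : State}, Ready D R s → s.v .alive = 1 → s.Bdd M.W →
    Sim M s m → m.reg 0 = M.B →
    ∃ tr m', Exec (.while (.lt (vreg .zero) (vreg .alive)) (round.compile 0)) m tr m' ∧
      tr.length ≤ R.length * (D.roundCost + 1) + 1 ∧ RAM.UsesSpace M.Sp tr ∧
      RAM.WordsAtMost M.W tr ∧ Punct (D.roundCost + 1) tr ∧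
      RAM.output tr = R.flatMap (written D.n) := by
  induction R with
  | nil =>
    -- An empty list cannot occur, because a round always writes a set.
    intro s m hR
    obtain ⟨-, -, S, R', h, -⟩ := wp_round hD hF hR
    simp at h
  | cons S0 R0 ih =>
    intro s m hR hal hb hS h0
    obtain ⟨hsafe, hcost, S, R', h, hout, hnext⟩ := wp_round hD hF hR
    obtain ⟨rfl, rfl⟩ := List.cons.inj h
    have vz : s.v .zero = 0 := by
      obtain ⟨P, l, -, -, hP, -⟩ := hR
      exact hP.static.vz
    obtain ⟨tr, m', hex, hlen, hsp, hw, ho, hpost⟩ := correct hM round s 0 m hb hsafe hS (Or.inl h0)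
    have ho' : RAM.output tr = written D.n S0 := List.append_cancel_left (ho.symm.trans hout)
    have hend : Event.endSet ∈ tr := endSet_mem_of_output (by rw [ho', written]; simp)
    have htest : (RAM.Test.lt (vreg .zero) (vreg .alive)).Holds m := by
      simp [RAM.Test.Holds, hS.v, vz, hal]
    have hblock : (Event.test :: tr).length ≤ D.roundCost + 1 := by simp; omega
    rcases hnext with ⟨hal', hR'⟩ | ⟨hal', rfl⟩
    · obtain ⟨tr', m'', hex', hlen', hsp', hw', hp', ho''⟩ := ih hR' hal' (Cmd.bdd_run round hb hsafe)
        hpost.sim (hpost.zero.trans h0)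
      refine ⟨_, _, .whileTrue htest hex hex', ?_, usesSpace_test.2 (usesSpace_append.2 ⟨hsp, hsp'⟩),
        wordsAtMost_test.2 (wordsAtMost_append.2 ⟨hw, hw'⟩), ?_, ?_⟩
      · rw [List.length_cons, List.length_append, List.length_cons, add_mul]
        omega
      · exact hp'.append (b := .test :: tr) hblock (List.mem_cons_of_mem _ hend)
      · rw [output_test, output_append, ho', ho'', List.flatMap_cons]
    · have htest' : ¬ (RAM.Test.lt (vreg .zero) (vreg .alive)).Holds m' := by
        simp [RAM.Test.Holds, hpost.sim.v, hal']
      have hex' := Exec.whileFalse (p := round.compile 0) htest'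
      refine ⟨_, _, .whileTrue htest hex hex', ?_, usesSpace_test.2 (usesSpace_append.2 ⟨hsp,
        usesSpace_test.2 (by simp [RAM.UsesSpace])⟩),
        wordsAtMost_test.2 (wordsAtMost_append.2 ⟨hw,
        wordsAtMost_test.2 (by simp [RAM.WordsAtMost])⟩), ?_, ?_⟩
      · simp; omega
      · exact (Punct.of_length_le (tr := [.test]) (by simp)).append (b := .test :: tr) hblock
          (List.mem_cons_of_mem _ hend)
      · rw [output_test, output_append, ho']
        simp [RAM.output, Event.symbol]

/-- The initial state. -/
def St.start (E : List ℕ) : St where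
  v _ := 0
  a a i := if a = .inp then E.getD i 0 else 0
  out := []

theorem sim_start {M : Lim} {E : List ℕ} (h : M.B = E.length) :
    Sim M (St.start E) (RAM.initial E) := by
  refine ⟨fun _ => rfl, fun i _ => by simp [St.start, RAM.initial], fun a ha i => ?_⟩
  simp [St.start, RAM.initial, ha, h, add_assoc]

theorem main_runs {M : Lim} (hM : M.Good) {n : ℕ} {O : ℕ → List ℕ} {E : List ℕ}
    (hO : Oriented n O) (hroom : Room M n O) (hB : M.B = E.length) (hE : E.length = pos O n)
    (hI : Inp n O (St.start E)) (hEW : ∀ i, E.getD i 0 ≤ M.W) :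
    ∃ r tr m', IsRoot n (maxDeg O n) r ∧ Exec mainProg (RAM.initial E) tr m' ∧
      RAM.output tr = (Mis.leaves (mkDat n (maxDeg O n) O r).adj n 0 ∅).flatMap (written n) ∧
      tr.length ≤ 60 * n + 60 + 3 + prepCost n (maxDeg O n) (size O n) +
        (Mis.leaves (mkDat n (maxDeg O n) O r).adj n 0 ∅).length *
          ((mkDat n (maxDeg O n) O r).roundCost + 1) ∧
      RAM.UsesSpace M.Sp tr ∧ RAM.WordsAtMost M.W tr ∧
      RAM.DelayAtMost (2 * (60 * n + 60 + 2 + prepCost n (maxDeg O n) (size O n) +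
        (mkDat n (maxDeg O n) O r).roundCost + 1) + 1) tr := by
  have hBW := hroom.BW
  have hb0 : (St.start E).Bdd M.W := by
    refine ⟨fun _ => Nat.zero_le _, fun a i => ?_⟩
    change (if a = .inp then E.getD i 0 else 0) ≤ M.W
    split
    · exact hEW i
    · exact Nat.zero_le _
  obtain ⟨hs0, hc0, hn0, hK0, hp0⟩ := wp_prepare₀ hI hroom.B hBW
  obtain ⟨tr0, m0, x0, l0, u0, w0, o0, q0⟩ := correct hM prepare₀ _ 0 _ hb0 hs0 (sim_start hB)
    (Or.inr rfl)
  set s1 := prepare₀.run (St.start E) with hs1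
  have f0 : Frame prepare₀ (St.start E) s1 := Cmd.frame_run _ _
  have hb1 : s1.Bdd M.W := Cmd.bdd_run _ hb0 hs0
  -- The state after the length of the input has been copied from `p` to register `0`; from here on
  -- the interleaved arrays can be addressed.
  let m1 : State := { m0 with
    reg := Function.update (Function.update m0.reg (tmp 0) 0) 0 (m0.reg (vreg .p)) }
  have hpne : (vreg .p) ≠ tmp 0 := vreg_ne_tmp _ _
  have x1 : Exec (move 0 (vreg .p) (tmp 0)) m0 ([.compute 0] ++ [.compute (m0.reg (vreg .p))]) m1 := by
    have h1 := Exec.seq (Exec.instr (.const (tmp 0) 0) m0)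
      (Exec.instr (.arith .plus 0 (vreg .p) (tmp 0)) (Instr.next m0 (.const (tmp 0) 0)))
    simpa [Instr.event, Instr.next, RAM.ArithOp.eval, hpne, m1, move] using h1
  have hpB : m0.reg (vreg .p) = M.B := by rw [q0.sim.v, hp0, hB, hE]
  have hS1 : Sim M s1 m1 := by
    refine ⟨fun x => ?_, q0.sim.inp, q0.sim.a⟩
    change Function.update (Function.update m0.reg (tmp 0) 0) 0 (m0.reg (vreg .p)) (vreg x) = _
    rw [Function.update_of_ne (vreg_ne_zero x), Function.update_of_ne (vreg_ne_tmp x 0), q0.sim.v]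
  have h10 : m1.reg 0 = M.B := by simp [m1, hpB]
  obtain ⟨hs2, hc2, hal, r, hr, hF, hR⟩ := wp_prepare₁ (s := s1) hO (hI.congr (f0.a .inp rfl)) hroom
    (f0.v .zero rfl) (f0.v .lvl rfl) hn0 hK0 (fun a ha i => by
      rw [f0.a a rfl]; simp [St.start, ha])
  obtain ⟨tr2, m2, x2, l2, u2, w2, o2, q2⟩ := correct hM prepare₁ s1 0 m1 hb1 hs2 hS1 (Or.inl h10)
  have hD : (mkDat n (maxDeg O n) O r).Good := mkDat_good hO
  obtain ⟨tr3, m3, x3, l3, u3, w3, p3, o3⟩ := runs_rounds hM hD hF _ hR hal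
    (Cmd.bdd_run _ hb1 hs2) q2.sim (q2.zero.trans h10)
  have e0 : RAM.output tr0 = [] := by
    have : s1.out = [] := f0.out rfl
    rw [this] at o0
    simpa [St.start] using o0
  have e2 : RAM.output tr2 = [] := by
    have : (prepare₁.run s1).out = s1.out := (Cmd.frame_run prepare₁ s1).out rfl
    rw [this] at o2
    simpa using o2
  have hW0 : RAM.WordsAtMost M.W ([.compute 0] ++ [.compute (m0.reg (vreg .p))]) := by
    rw [hpB]; simp [RAM.WordsAtMost]; omega
  have hU0 : RAM.UsesSpace M.Sp ([.compute 0] ++ [.compute (m0.reg (vreg .p))]) := by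
    simp [RAM.UsesSpace]
  refine ⟨r, _, m3, hr, .seq x0 (.seq x1 (.seq x2 x3)), ?_, ?_, ?_, ?_, ?_⟩
  · simp only [output_append, e0, e2, o3]
    simp [RAM.output, Event.symbol]
    rfl
  · simp only [List.length_append, List.length_singleton]
    omega
  · exact usesSpace_append.2 ⟨u0, usesSpace_append.2 ⟨hU0, usesSpace_append.2 ⟨u2, u3⟩⟩⟩
  · exact wordsAtMost_append.2 ⟨w0, wordsAtMost_append.2 ⟨hW0, wordsAtMost_append.2 ⟨w2, w3⟩⟩⟩
  · refine delayAtMost_of_mid ?_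
    have hp : Punct (60 * n + 60 + 2 + prepCost n (maxDeg O n) (size O n) +
        (mkDat n (maxDeg O n) O r).roundCost + 1) tr3 :=
      ⟨fun x y e hx => (p3.start x y e hx).trans (by omega),
        fun x z y e hz => (p3.mid x z y e hz).trans (by omega)⟩
    have := hp.mid_append (b := tr0 ++ ([.compute 0] ++ [.compute (m0.reg (vreg .p))] ++ tr2)) (by
      simp only [List.length_append, List.length_singleton]; omega)
    simpa only [List.append_assoc] using this

end Loop

/-! ## The running time -/

namespace Loop

/-- Exchange of summation: the short list of `w` is charged once for each neighbour of `w`. -/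
theorem Dat.Good.sum_shortSum {D : Dat} (hD : D.Good) :
    ∑ j ∈ Finset.range D.n, D.shortSum j =
      ∑ w ∈ Finset.range D.n, (D.nb w).length * D.sl w := by
  classical
  have h1 : ∀ (j : ℕ) (f : ℕ → ℕ), ((D.nb j).map f).sum =
      ∑ w ∈ Finset.range D.n, if D.adj j w then f w else 0 := by
    intro j f
    rw [← Finset.sum_filter, ← List.sum_toFinset _ (hD.nb_nodup j)]
    refine Finset.sum_congr ?_ fun _ _ => rfl
    ext w
    rw [List.mem_toFinset, hD.mem_nb, Finset.mem_filter, Finset.mem_range]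
    exact ⟨fun h => ⟨(hD.adj_lt h).2, h⟩, And.right⟩
  have h2 : ∀ w, (D.nb w).length = ∑ j ∈ Finset.range D.n, if D.adj j w then 1 else 0 := by
    intro w
    have := h1 w fun _ => 1
    simp only [List.map_const', List.sum_replicate, smul_eq_mul, mul_one] at this
    rw [this]
    exact Finset.sum_congr rfl fun j _ => if_congr ⟨Dat.adj_symm, Dat.adj_symm⟩ rfl rfl
  simp only [Dat.shortSum, h1, h2, Finset.sum_mul, ite_mul, one_mul, zero_mul]
  exact Finset.sum_comm

/-! ### The bound on the cost per set. -/

section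
variable {n r : ℕ} {O : ℕ → List ℕ}

/-- A light `w` has `indeg * r < n ≤ r ^ K`, hence in-degree below `r ^ (K - 1)`; a heavy one
contributes only its out-neighbours. This and the bound on `b` are the two sides balanced by the
choice of `r`. -/
theorem mkDat_sl_le (hr : IsRoot n (maxDeg O n) r) {w : ℕ} (hw : w < n) :
    (mkDat n (maxDeg O n) O r).sl w ≤ maxDeg O n + r ^ (maxDeg O n - 1) := by
  have hl := length_le_maxDeg O hw
  rw [Dat.sl, mkDat_nb_length]
  split
  · next h =>
    change (if w < n ∧ n ≤ indeg O n w * r then heavyCount n O r w + 1 else 0) = 0 at h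
    have h' : indeg O n w * r < n := by
      by_contra hn
      rw [if_pos ⟨hw, not_lt.1 hn⟩] at h
      omega
    have hlt : indeg O n w * r < r ^ (maxDeg O n - 1) * r := by
      rw [← pow_succ, Nat.sub_add_cancel (maxDeg_pos O n)]
      exact h'.trans_le hr.le
    have := lt_of_mul_lt_mul_right hlt (Nat.zero_le r)
    omega
  · exact hl.trans (Nat.le_add_right _ _)

/-- A bound for the cost per set, divided by `(n + 1) * r ^ (K - 1)`. -/
def setCost (K : ℕ) : ℕ :=
  10 * ((60 * K + 500) * (2 * K + 2 * K * (K + 1) + 1 + (2 * K + 1) * (2 * K) ^ K)) +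
    (320 * K + 2000)

theorem setCost_mono : Monotone setCost := by
  intro K k h
  have hp : (2 * K) ^ K ≤ (2 * k) ^ k := by
    rcases Nat.eq_zero_or_pos K with rfl | hK
    · rcases Nat.eq_zero_or_pos k with rfl | hk
      · exact le_rfl
      · simpa using Nat.one_le_pow _ _ (by omega)
    · exact (Nat.pow_le_pow_left (by omega) K).trans (Nat.pow_le_pow_right (by omega) h)
  unfold setCost
  gcongr

/-- The number of arcs is at most `n * K`, so the total degree is `O(n)` for fixed `K`. Short lists
and tables each contribute a constant times `(n + 1) * r ^ (K - 1)`, and the rest is linear in `n`.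
Preprocessing is included and thus charged to every set. -/
theorem cost_le (hO : Oriented n O) (hr : IsRoot n (maxDeg O n) r) :
    60 * n + 60 + 3 + prepCost n (maxDeg O n) (size O n) +
      (mkDat n (maxDeg O n) O r).roundCost + 1 ≤
      setCost (maxDeg O n) * ((n + 1) * r ^ (maxDeg O n - 1)) := by
  have hK1 := maxDeg_pos O n
  have hsz := size_le O n
  have hst := mkDat_st (K := maxDeg O n) (r := r) hO
  have hD : (mkDat n (maxDeg O n) O r).Good := mkDat_good hO
  have hsl : ∀ w ∈ Finset.range n, ((mkDat n (maxDeg O n) O r).nb w).length *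
      (mkDat n (maxDeg O n) O r).sl w ≤ ((mkDat n (maxDeg O n) O r).nb w).length *
      (maxDeg O n + r ^ (maxDeg O n - 1)) := fun w hw =>
    Nat.mul_le_mul_left _ (mkDat_sl_le hr (Finset.mem_range.1 hw))
  have hss : ∑ j ∈ Finset.range n, (mkDat n (maxDeg O n) O r).shortSum j ≤ _ :=
    hD.sum_shortSum.trans_le (Finset.sum_le_sum hsl)
  rw [← Finset.sum_mul] at hss
  have hb : (mkDat n (maxDeg O n) O r).b ^ (maxDeg O n - 1) ≤
      (2 * maxDeg O n) ^ maxDeg O n * r ^ (maxDeg O n - 1) := by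
    refine (Nat.pow_le_pow_left (mkDat_b_le hO hr.pos hsz hK1) _).trans ?_
    rw [mul_pow]
    exact Nat.mul_le_mul_right _ (Nat.pow_le_pow_right (by omega) (by omega))
  have hρ : 1 ≤ r ^ (maxDeg O n - 1) := Nat.one_le_pow _ _ hr.pos
  have hsum : ∑ j ∈ Finset.range n, (mkDat n (maxDeg O n) O r).testCost j =
      (60 * maxDeg O n + 500) * ((mkDat n (maxDeg O n) O r).st n +
        ∑ j ∈ Finset.range n, (mkDat n (maxDeg O n) O r).shortSum j + n +
        ((mkDat n (maxDeg O n) O r).st n + n) *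
          (mkDat n (maxDeg O n) O r).b ^ (maxDeg O n - 1)) := by
    unfold Dat.testCost Dat.st
    change ∑ j ∈ Finset.range n, (60 * maxDeg O n + 500) * _ = _
    rw [← Finset.mul_sum]
    congr 1
    rw [Finset.sum_add_distrib, Finset.sum_add_distrib, Finset.sum_add_distrib, ← Finset.sum_mul,
      Finset.sum_add_distrib]
    rw [Finset.sum_const, Finset.card_range, smul_eq_mul, mul_one]
    rfl
  change 60 * n + 60 + 3 + prepCost n (maxDeg O n) (size O n) +
    (10 * ∑ j ∈ Finset.range n, (mkDat n (maxDeg O n) O r).testCost j + 1000) + 1 ≤ _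
  change _ ≤ (mkDat n (maxDeg O n) O r).st n * _ at hss
  rw [hsum]
  rw [hst] at hss ⊢
  generalize maxDeg O n = K at *
  generalize r ^ (K - 1) = ρ at *
  generalize (mkDat n K O r).b ^ (K - 1) = X at *
  generalize ∑ j ∈ Finset.range n, (mkDat n K O r).shortSum j = T at *
  generalize size O n = m at *
  generalize hY : (2 * K) ^ K = Y at *
  have hN : n + 1 ≤ (n + 1) * ρ := Nat.le_mul_of_pos_right _ hρ
  have hm : 2 * m ≤ 2 * K * (n + 1) := by nlinarith
  have hm' : m ≤ K * ((n + 1) * ρ) := by nlinarith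
  have hT : T ≤ 2 * K * (K + 1) * ((n + 1) * ρ) := by
    calc T ≤ 2 * m * (K + ρ) := hss
      _ ≤ 2 * K * (n + 1) * ((K + 1) * ρ) := Nat.mul_le_mul hm (by nlinarith)
      _ = _ := by ring
  have hX : (2 * m + n) * X ≤ (2 * K + 1) * Y * ((n + 1) * ρ) := by
    calc (2 * m + n) * X ≤ ((2 * K + 1) * (n + 1)) * (Y * ρ) :=
          Nat.mul_le_mul (by nlinarith) hb
      _ = _ := by ring
  have hall : 2 * m + T + n + (2 * m + n) * X ≤
      (2 * K + 2 * K * (K + 1) + 1 + (2 * K + 1) * Y) * ((n + 1) * ρ) := by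
    have : 2 * m ≤ 2 * K * ((n + 1) * ρ) := hm.trans (Nat.mul_le_mul_left _ hN)
    simp only [add_mul] at *
    omega
  have hprep : 60 * n + 60 + 3 + prepCost n K m + 1000 + 1 ≤
      (320 * K + 2000) * ((n + 1) * ρ) := by
    have h1 : n * K ≤ K * ((n + 1) * ρ) := by nlinarith
    unfold prepCost
    have h2 : 20 * n * K = 20 * (n * K) := by ring
    rw [add_mul, mul_assoc 320]
    omega
  have := Nat.mul_le_mul_left (60 * K + 500) hall
  calc _ = 10 * ((60 * K + 500) * (2 * m + T + n + (2 * m + n) * X)) +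
        (60 * n + 60 + 3 + prepCost n K m + 1000 + 1) := by ring
    _ ≤ _ := Nat.add_le_add (Nat.mul_le_mul_left 10 this) hprep
    _ = _ := by rw [setCost, hY]; ring

/-- Since `r ≤ 2 * (n + 1) ^ (1 / K)`, its power has exponent `1 - 1 / K`. This increases with `K`,
so the actual maximum out-degree may be replaced by `k`. -/
theorem root_pow_pred_le {k : ℕ} {K : ℕ} (hK : 1 ≤ K) (hKk : K ≤ k) (hr : IsRoot n K r) :
    ((r ^ (K - 1) : ℕ) : ℝ) ≤ 2 ^ k * ((n : ℝ) + 1) ^ (1 - 1 / (k : ℝ)) := by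
  have hK0 : (0 : ℝ) < K := by exact_mod_cast hK
  have hkK : (K : ℝ) ≤ k := by exact_mod_cast hKk
  have hn1 : (1 : ℝ) ≤ (n : ℝ) + 1 := by
    have : (0 : ℝ) ≤ n := Nat.cast_nonneg n
    linarith
  have hn0 : (0 : ℝ) ≤ (n : ℝ) + 1 := by linarith
  have hroot : (r : ℝ) ≤ 2 * ((n : ℝ) + 1) ^ (1 / (K : ℝ)) := by
    have h1 : (1 : ℝ) ≤ ((n : ℝ) + 1) ^ (1 / (K : ℝ)) := Real.one_le_rpow hn1 (by positivity)
    rcases hr.lt with h | h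
    · rw [h, Nat.cast_one]; linarith
    · have h2 : ((r - 1 : ℕ) : ℝ) ^ K ≤ (n : ℝ) + 1 := by
        have : (((r - 1) ^ K : ℕ) : ℝ) ≤ n := by exact_mod_cast h.le
        push_cast at this
        linarith
      have h3 : ((r - 1 : ℕ) : ℝ) ≤ ((n : ℝ) + 1) ^ (1 / (K : ℝ)) := by
        rw [one_div, Real.le_rpow_inv_iff_of_pos (Nat.cast_nonneg _) hn0 hK0, Real.rpow_natCast]
        exact h2
      have h4 : (r : ℝ) = ((r - 1 : ℕ) : ℝ) + 1 := by
        have := hr.pos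
        rw [Nat.cast_sub this]; simp
      linarith
  have hexp : ((n : ℝ) + 1) ^ ((1 / (K : ℝ)) * ((K - 1 : ℕ) : ℝ)) ≤
      ((n : ℝ) + 1) ^ (1 - 1 / (k : ℝ)) := by
    refine Real.rpow_le_rpow_of_exponent_le hn1 ?_
    rw [Nat.cast_sub hK, mul_sub, one_div_mul_cancel hK0.ne']
    have := one_div_le_one_div_of_le hK0 hkK
    simp only [Nat.cast_one, mul_one]
    linarith
  push_cast
  calc (r : ℝ) ^ (K - 1) ≤ (2 * ((n : ℝ) + 1) ^ (1 / (K : ℝ))) ^ (K - 1) :=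
        pow_le_pow_left₀ (Nat.cast_nonneg r) hroot _
    _ = 2 ^ (K - 1) * ((n : ℝ) + 1) ^ ((1 / (K : ℝ)) * ((K - 1 : ℕ) : ℝ)) := by
        rw [mul_pow, Real.rpow_mul_natCast hn0]
    _ ≤ _ := mul_le_mul (pow_le_pow_right₀ (by norm_num) (by omega)) hexp (by positivity)
        (by positivity)

end

end Loop

/-! ## The input and the output -/

namespace Loop

theorem usesSpace_mono {a b : ℕ} {tr : List RAM.Event} (h : RAM.UsesSpace a tr) (hab : a ≤ b) :
    RAM.UsesSpace b tr := by
  intro e he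
  have := h e he
  cases e <;> simp only at this ⊢ <;> omega

theorem wordsAtMost_mono {a b : ℕ} {tr : List RAM.Event} (h : RAM.WordsAtMost a tr)
    (hab : a ≤ b) : RAM.WordsAtMost b tr := by
  intro e he
  have := h e he
  cases e <;> simp only at this ⊢ <;> omega

theorem delayAtMost_mono {a b : ℕ} {tr : List RAM.Event} (h : RAM.DelayAtMost a tr)
    (hab : a ≤ b) : RAM.DelayAtMost b tr :=
  fun l hl hb => h l hl (hab.trans hb)

section Input
variable {n k : ℕ} {G : SimpleGraph (Fin n)} (o : KOrientation G k)

/-- The list of out-neighbours of `v`. -/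
def outList (v : ℕ) : List ℕ := if h : v < n then (o.out ⟨v, h⟩).map Fin.val else []

theorem outList_val (v : Fin n) : outList o v = (o.out v).map Fin.val := dif_pos v.2

theorem mem_outList {u w : ℕ} :
    w ∈ outList o u ↔ ∃ (hu : u < n) (hw : w < n), (⟨w, hw⟩ : Fin n) ∈ o.out ⟨u, hu⟩ := by
  rw [outList]
  split
  · next h =>
    rw [List.mem_map]
    constructor
    · rintro ⟨v, hv, rfl⟩
      exact ⟨h, v.2, hv⟩
    · rintro ⟨_, hw, hv⟩
      exact ⟨_, hv, rfl⟩
  · next h => simp [h]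

theorem outList_length (u : ℕ) : (outList o u).length ≤ k := by
  rw [outList]
  split
  · rw [List.length_map]; exact o.outdegree_le _
  · simp

theorem outList_oriented : Oriented n (outList o) where
  lt u w h := by
    obtain ⟨hu, hw, -⟩ := (mem_outList o).1 h
    exact ⟨hw, hu⟩
  nodup u := by
    rw [outList]
    split
    · exact (o.nodup _).map Fin.val_injective
    · exact List.nodup_nil
  asymm u w h h' := by
    obtain ⟨hu, hw, h⟩ := (mem_outList o).1 h
    obtain ⟨_, _, h'⟩ := (mem_outList o).1 h'
    exact o.asymm _ _ h h'

theorem encode_eq :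
    o.encode = n :: (List.range n).flatMap fun v => (outList o v).length :: outList o v := by
  rw [KOrientation.encode, ← List.map_coe_finRange_eq_range, List.flatMap_map]
  simp only [outList_val, List.length_map]

theorem length_flatMap (O : ℕ → List ℕ) (a v : ℕ) :
    (a :: (List.range v).flatMap fun u => (O u).length :: O u).length = pos O v := by
  induction v with
  | zero => simp [pos]
  | succ v ih =>
    rw [pos_succ, ← ih, List.range_succ, List.flatMap_append, ← List.cons_append,
      List.length_append]
    simp

theorem encode_getD {v t : ℕ} (hv : v < n) (ht : t < ((outList o v).length :: outList o v).length) :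
    o.encode.getD (pos (outList o) v + t) 0 = ((outList o v).length :: outList o v)[t] := by
  obtain ⟨m, rfl⟩ := Nat.exists_eq_add_of_le (show v + 1 ≤ n from hv)
  rw [encode_eq, List.range_add, List.range_succ, List.flatMap_append, List.flatMap_append,
    ← List.cons_append, ← List.cons_append, List.append_assoc, ← length_flatMap _ (v + 1 + m) v,
    List.getD_eq_getElem?_getD, List.getElem?_append_right (Nat.le_add_right _ _),
    Nat.add_sub_cancel_left, List.flatMap_singleton, List.getElem?_append_left ht,
    List.getElem?_eq_getElem ht, Option.getD_some]

theorem inp_start : Inp n (outList o) (St.start o.encode) where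
  zero := rfl
  deg v hv := encode_getD o (t := 0) hv (by simp)
  nbr v hv t h := by
    have := encode_getD o (t := t + 1) hv (by simpa using h)
    rw [← add_assoc, add_right_comm] at this
    exact this

theorem encode_le (i : ℕ) : o.encode.getD i 0 ≤ n + k := by
  by_cases hi : i < o.encode.length
  · rw [List.getD_eq_getElem _ _ hi]
    have h : o.encode[i] ∈ o.encode := List.getElem_mem hi
    generalize o.encode[i] = x at h
    rw [encode_eq, List.mem_cons, List.mem_flatMap] at h
    rcases h with rfl | ⟨v, -, h⟩
    · omega
    · rcases List.mem_cons.1 h with rfl | h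
      · exact (outList_length o v).trans (Nat.le_add_left _ _)
      · have := ((outList_oriented o).lt _ _ h).1
        omega
  · rw [List.getD_eq_default _ _ (by omega)]; omega

theorem maxDeg_outList_le (hk : 1 ≤ k) : maxDeg (outList o) n ≤ k :=
  max_le hk (Finset.sup_le fun _ _ => outList_length o _)

end Input

/-! ### From sets of numbers to sets of vertices. -/

section Output
variable {n : ℕ} {G : SimpleGraph (Fin n)} {adj : ℕ → ℕ → Prop}

theorem isMis_map_iff (hadj : ∀ u v : Fin n, G.Adj u v ↔ adj u v) (T : Finset (Fin n)) :
    Mis.IsMis adj n (T.map Fin.valEmbedding) ↔ T ∈ maximalIndepSets G := by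
  classical
  change _ ↔ Maximal (fun T : Finset (Fin n) => G.IsIndepSet (T : Set (Fin n))) T
  have hind : ∀ S : Finset (Fin n), G.IsIndepSet (S : Set (Fin n)) ↔
      ∀ u ∈ S, ∀ w ∈ S, ¬ G.Adj u w := fun S =>
    ⟨fun h u hu w hw ha => h hu hw ha.ne ha, fun h u hu w hw _ => h u hu w hw⟩
  simp only [Maximal, hind]
  constructor
  · intro h
    have hi : ∀ u ∈ T, ∀ w ∈ T, ¬ G.Adj u w := fun u hu w hw ha =>
      h.indep u (Finset.mem_map_of_mem _ hu) w (Finset.mem_map_of_mem _ hw) ((hadj u w).1 ha)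
    refine ⟨hi, fun S hS hle u hu => ?_⟩
    by_contra hn
    obtain ⟨w, hw, ha⟩ := h.max u u.2 fun hm => by
      obtain ⟨x, hx, e⟩ := Finset.mem_map.1 hm
      exact hn (Fin.val_injective e ▸ hx)
    obtain ⟨x, hx, rfl⟩ := Finset.mem_map.1 hw
    exact hS u hu x (hle hx) ((hadj u x).2 ha)
  · rintro ⟨hi, hmax⟩
    refine ⟨?_, ?_, ?_⟩
    · intro u hu
      obtain ⟨x, -, rfl⟩ := Finset.mem_map.1 hu
      exact x.2
    · intro u hu w hw ha
      obtain ⟨x, hx, rfl⟩ := Finset.mem_map.1 hu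
      obtain ⟨y, hy, rfl⟩ := Finset.mem_map.1 hw
      exact hi x hx y hy ((hadj x y).2 ha)
    · intro u hu hn
      by_contra! hno
      have hno' : ∀ w ∈ T, ¬ G.Adj ⟨u, hu⟩ w := fun w hw ha =>
        hno w (Finset.mem_map_of_mem _ hw) ((hadj _ _).1 ha)
      have hS : ∀ x ∈ insert (⟨u, hu⟩ : Fin n) T, ∀ y ∈ insert (⟨u, hu⟩ : Fin n) T,
          ¬ G.Adj x y := by
        intro x hx y hy
        rcases Finset.mem_insert.1 hx with rfl | hx <;> rcases Finset.mem_insert.1 hy with rfl | hy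
        · exact G.irrefl
        · exact hno' y hy
        · exact fun ha => hno' x hx ha.symm
        · exact hi x hx y hy
      have := hmax hS (Finset.subset_insert _ _) (Finset.mem_insert_self _ _)
      exact hn (Finset.mem_map_of_mem Fin.valEmbedding this)

open Classical in
/-- The elements of `S` in increasing order. -/
noncomputable def elements (n : ℕ) (S : Finset ℕ) : List (Fin n) :=
  (List.finRange n).filter fun v => v.val ∈ S

theorem mem_elements {S : Finset ℕ} {v : Fin n} : v ∈ elements n S ↔ v.val ∈ S := by
  simp [elements]

theorem elements_toFinset_eq {S : Finset ℕ} (hS : ∀ u ∈ S, u < n) {T : Finset (Fin n)} :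
    (elements n S).toFinset = T ↔ S = T.map Fin.valEmbedding := by
  constructor
  · rintro rfl
    ext u
    rw [Finset.mem_map]
    constructor
    · exact fun h => ⟨⟨u, hS u h⟩, by rw [List.mem_toFinset, mem_elements]; exact h, rfl⟩
    · rintro ⟨v, hv, rfl⟩
      rw [List.mem_toFinset, mem_elements] at hv
      exact hv
  · rintro rfl
    ext v
    rw [List.mem_toFinset, mem_elements]
    exact Finset.mem_map' Fin.valEmbedding

theorem written_eq (S : Finset ℕ) :
    written n S = (elements n S).map (fun v => some v.val) ++ [none] := by
  rw [written, elements, ← List.map_coe_finRange_eq_range, List.filter_map, List.map_map]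
  congr 2

variable {l : List (Finset ℕ)}

theorem Lists.mem_iff (hadj : ∀ u v : Fin n, G.Adj u v ↔ adj u v) (hl : Mis.Lists adj n l)
    (T : Finset (Fin n)) :
    T ∈ (l.map (elements n)).map List.toFinset ↔ T ∈ maximalIndepSets G := by
  rw [← isMis_map_iff hadj, ← hl.2, List.map_map, List.mem_map]
  constructor
  · rintro ⟨S, hS, e⟩
    rw [← (elements_toFinset_eq ((hl.2 S).1 hS).lt).1 e]
    exact hS
  · intro h
    exact ⟨_, h, (elements_toFinset_eq ((hl.2 _).1 h).lt).2 rfl⟩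

theorem Lists.nodup (hl : Mis.Lists adj n l) :
    ((l.map (elements n)).map List.toFinset).Nodup := by
  rw [List.map_map]
  refine hl.1.map_on fun S hS S' hS' e => ?_
  have h := (elements_toFinset_eq ((hl.2 S).1 hS).lt).1 e
  rw [h]
  exact ((elements_toFinset_eq ((hl.2 S').1 hS').lt).1 rfl).symm

theorem Lists.isListing (hadj : ∀ u v : Fin n, G.Adj u v ↔ adj u v) (hl : Mis.Lists adj n l) :
    IsListing (maximalIndepSets G) (l.flatMap (written n)) := by
  refine ⟨l.map (elements n), ?_, ?_, Lists.nodup hl, Lists.mem_iff hadj hl⟩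
  · rw [List.flatMap_map]
    exact congrArg l.flatMap (funext written_eq)
  · intro e he
    obtain ⟨S, -, rfl⟩ := List.mem_map.1 he
    exact (List.nodup_finRange n).filter _

theorem Lists.ncard (hadj : ∀ u v : Fin n, G.Adj u v ↔ adj u v) (hl : Mis.Lists adj n l) :
    (maximalIndepSets G).ncard = l.length := by
  have : maximalIndepSets G = ↑((l.map (elements n)).map List.toFinset).toFinset := by
    ext T
    rw [Finset.mem_coe, List.mem_toFinset, Lists.mem_iff hadj hl]
  rw [this, Set.ncard_coe_finset, List.toFinset_card_of_nodup (Lists.nodup hl)]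
  simp

/-- Every node has a first child. Hence at least one set is written, and the preprocessing can be
charged to it. -/
theorem leaves_ne_nil (adj : ℕ → ℕ → Prop) (m i : ℕ) (S : Finset ℕ) :
    Mis.leaves adj m i S ≠ [] := by
  induction m generalizing i S with
  | zero => simp [Mis.leaves]
  | succ m ih =>
    rw [Mis.leaves, Ne, List.flatMap_eq_nil_iff]
    exact fun h => ih _ _ (h _ (Mis.first_mem_kids S i))

end Output

end Loop

/-- One program lists, for every `k ≥ 1`, all maximal independent sets of every `n`-vertex
`k`-oriented graph in total time `O(n^(2-1/k))` per set, space `O(n)` and polynomial delay,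
with words of `O(log n)` bits; the constants depend only on `k`. -/
theorem mainTheorem7 :
    ∃ P : RAM.Prog, ∀ k : ℕ, 1 ≤ k → ∃ C d : ℕ,
      ∀ (n : ℕ) (G : SimpleGraph (Fin n)) (o : KOrientation G k),
        ∃ (tr : List RAM.Event) (final : RAM.State),
          RAM.Exec P (RAM.initial o.encode) tr final ∧
          IsListing (maximalIndepSets G) (RAM.output tr) ∧
          (tr.length : ℝ) ≤
            C * ((n : ℝ) + 1) ^ (2 - 1 / (k : ℝ)) * ((maximalIndepSets G).ncard : ℝ) ∧
          RAM.UsesSpace (C * (n + 1)) tr ∧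
          RAM.DelayAtMost (C * (n + 1) ^ d) tr ∧
          RAM.WordsAtMost (C * (n + 1) ^ d) tr := by
  refine ⟨Loop.mainProg, fun k hk => ?_⟩
  -- With this `A`, the number `N = A * (n + 1)` exceeds the table size, twice the number of arcs,
  -- and all vertex numbers.
  obtain ⟨A, hA⟩ : ∃ A, A = (4 * k) ^ k + 2 * k + 2 := ⟨_, rfl⟩
  refine ⟨100 * A ^ 2 + 3 * Loop.setCost k * 2 ^ k, 2, fun n G o => ?_⟩
  obtain ⟨N, hN⟩ : ∃ N, N = A * (n + 1) := ⟨_, rfl⟩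
  -- Array indices stay below `N`. The quadratic word bound also leaves room for the addresses and
  -- for the products `indeg * r`.
  let M : Loop.Lim := ⟨o.encode.length, A * (n + 1), 100 * (A * (n + 1)) ^ 2⟩
  have hO := Loop.outList_oriented o
  have hK := Loop.maxDeg_outList_le o hk
  have hK1 := Loop.maxDeg_pos (Loop.outList o) n
  have hlen : o.encode.length = Loop.pos (Loop.outList o) n := by
    rw [Loop.encode_eq, Loop.length_flatMap]
  have hpos := Loop.pos_eq (Loop.outList o) n
  have hsize : Loop.size (Loop.outList o) n ≤ n * k :=
    (Loop.size_le _ n).trans (Nat.mul_le_mul_left n hK)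
  have hAn : (4 * k) ^ k * (n + 1) + 2 * (n * k) + 2 * k + 2 * n + 2 = N := by
    rw [hN, hA]; ring
  have hp1 : 1 ≤ (4 * k) ^ k * (n + 1) := Nat.mul_pos (Nat.pow_pos (by omega)) n.succ_pos
  have hNN : 3 * N ≤ N ^ 2 := by rw [pow_two]; exact Nat.mul_le_mul_right N (by omega)
  have hW : M.W = 100 * N ^ 2 := by rw [hN]
  have hL : M.L = N := hN.symm
  have hBM : M.B = Loop.pos (Loop.outList o) n := hlen
  have hst : Loop.stride = 32 := rfl
  have hM : M.Good := ⟨by rw [hBM, hL, hW, hst]; omega, by rw [hW, hst]; omega⟩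
  have hroom : Loop.Room M n (Loop.outList o) := by
    refine ⟨hBM.ge, ?_, ?_, ?_, ?_, ?_, ?_⟩
    · rw [hBM, hW]; omega
    · rw [hL]; omega
    · rw [hL]; omega
    · rw [hL]
      have : (4 * Loop.maxDeg (Loop.outList o) n) ^ Loop.maxDeg (Loop.outList o) n ≤ (4 * k) ^ k :=
        (Nat.pow_le_pow_left (by omega) _).trans (Nat.pow_le_pow_right (by omega) hK)
      have := Nat.mul_le_mul_right (n + 1) this
      omega
    · rw [hL, hW]; omega
    · rw [hW]
      have : n * (n + 1) ≤ N * N := Nat.mul_le_mul (by omega) (by omega)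
      rw [pow_two]; omega
  obtain ⟨r, tr, m', hr, hex, hout, htime, hspace, hwords, hdelay⟩ := Loop.main_runs hM hO hroom rfl
    hlen (Loop.inp_start o) fun i => (Loop.encode_le o i).trans (by rw [hW]; omega)
  have hcost := Loop.cost_le hO hr
  have hD := Loop.mkDat_good (r := r) hO
  have hlists := Mis.lists_leaves
    (adj := (Loop.mkDat n (Loop.maxDeg (Loop.outList o) n) (Loop.outList o) r).adj) (fun _ _ h => Loop.Dat.adj_symm h) hD.adj_irrefl n
  have hadj : ∀ u v : Fin n, G.Adj u v ↔
      (Loop.mkDat n (Loop.maxDeg (Loop.outList o) n) (Loop.outList o) r).adj u v := fun u v => by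
    rw [o.adj_iff, Loop.Dat.adj]
    change _ ↔ _ ∈ Loop.outList o u ∨ _ ∈ Loop.outList o v
    simp [Loop.mem_outList]
  have hne := List.length_pos_iff.2 (Loop.leaves_ne_nil
    (Loop.mkDat n (Loop.maxDeg (Loop.outList o) n) (Loop.outList o) r).adj n 0 ∅)
  have hcard := Loop.Lists.ncard hadj hlists
  rw [← hcard] at hne htime
  have hset := Loop.setCost_mono hK
  refine ⟨tr, m', hex, hout ▸ Loop.Lists.isListing hadj hlists, ?_, ?_, ?_, ?_⟩
  · have hρ := Loop.root_pow_pred_le hK1 hK hr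
    generalize (maximalIndepSets G).ncard = c at *
    generalize Loop.maxDeg (Loop.outList o) n = K at *
    -- Preprocessing happens once; as there is at least one set, it may be paid for once per set.
    have hnat : tr.length ≤ Loop.setCost k * ((n + 1) * r ^ (K - 1)) * c := by
      refine htime.trans ((?_ : _ ≤ (60 * n + 60 + 3 +
        Loop.prepCost n K (Loop.size (Loop.outList o) n) +
        (Loop.mkDat n K (Loop.outList o) r).roundCost + 1) * c).trans
        (Nat.mul_le_mul_right c (hcost.trans (Nat.mul_le_mul_right _ hset))))
      have := Nat.le_mul_of_pos_right
        (60 * n + 60 + 3 + Loop.prepCost n K (Loop.size (Loop.outList o) n)) hne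
      rw [add_assoc _ _ 1, add_mul, mul_comm c]
      omega
    have hn0 : (0 : ℝ) < (n : ℝ) + 1 := by positivity
    have hreal : (tr.length : ℝ) ≤
        Loop.setCost k * (((n : ℝ) + 1) * ((r ^ (K - 1) : ℕ) : ℝ)) * c := by
      exact_mod_cast hnat
    have hexp : ((n : ℝ) + 1) * ((n : ℝ) + 1) ^ (1 - 1 / (k : ℝ)) =
        ((n : ℝ) + 1) ^ (2 - 1 / (k : ℝ)) := by
      rw [← Real.rpow_one_add' hn0.le]
      · congr 1; ring
      · have : (1 : ℝ) / k ≤ 1 := by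
          rw [div_le_one (by exact_mod_cast hk)]; exact_mod_cast hk
        intro h; linarith
    refine hreal.trans (mul_le_mul_of_nonneg_right ?_ (Nat.cast_nonneg c))
    calc (Loop.setCost k : ℝ) * (((n : ℝ) + 1) * ((r ^ (K - 1) : ℕ) : ℝ))
        ≤ Loop.setCost k * (((n : ℝ) + 1) * (2 ^ k * ((n : ℝ) + 1) ^ (1 - 1 / (k : ℝ)))) := by
          gcongr
      _ = (Loop.setCost k * 2 ^ k) * ((n : ℝ) + 1) ^ (2 - 1 / (k : ℝ)) := by
          rw [← hexp]; ring
      _ ≤ _ := by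
          refine mul_le_mul_of_nonneg_right ?_ (by positivity)
          push_cast
          have h1 : (0 : ℝ) ≤ (Loop.setCost k : ℝ) * 2 ^ k := by positivity
          have h2 : (0 : ℝ) ≤ (A : ℝ) ^ 2 := by positivity
          linarith
  · refine Loop.usesSpace_mono hspace ?_
    rw [Loop.Lim.Sp, hBM, hL, hst]
    have : 33 * A ≤ 100 * A ^ 2 := by nlinarith
    calc _ ≤ 33 * N := by omega
      _ = 33 * A * (n + 1) := by rw [hN]; ring
      _ ≤ _ := Nat.mul_le_mul_right _ (by omega)
  · refine Loop.delayAtMost_mono hdelay ?_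
    generalize Loop.maxDeg (Loop.outList o) n = K at *
    have h1 : r ^ (K - 1) ≤ 2 ^ k * (n + 1) :=
      ((Nat.pow_le_pow_right hr.pos (Nat.sub_le K 1)).trans (Loop.root_pow_le hr.pos hr.lt)).trans
        (Nat.mul_le_mul_right _ (Nat.pow_le_pow_right (by omega) hK))
    have h2 : Loop.setCost K * ((n + 1) * r ^ (K - 1)) ≤ Loop.setCost k * 2 ^ k * (n + 1) ^ 2 := by
      calc _ ≤ Loop.setCost k * ((n + 1) * (2 ^ k * (n + 1))) :=
            Nat.mul_le_mul hset (Nat.mul_le_mul_left _ h1)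
        _ = _ := by ring
    rw [add_mul, mul_assoc 3, mul_assoc 3]
    omega
  · refine Loop.wordsAtMost_mono hwords ?_
    rw [hW, hN, mul_pow, ← mul_assoc]
    exact Nat.mul_le_mul_right _ (Nat.le_add_right _ _)
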